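/- **Model.** Let $d\ge 1$. Jobs arrive to a server in a Poisson process of rate $\lambda>0$. The jobs have i.i.d. resource requirements in $(0,1]^d$, distributed as $V$ with density $f_V:(0,1]^d\to[0,\infty)$, and i.i.d. $\mathrm{Exp}(1)$ durations. A state is the finite list of the requirements of the jobs present, in order of arrival. A (Markovian) policy is a measurable map that selects in each state a set of jobs whose requirements sum to at most $1$ in each coordinate; these jobs are served simultaneously, and each of them is completed at rate $1$. The system is stable under a policy (the policy stabilizes the system) if the empty state is positive recurrent, i.e. if the mean return time to the empty state, started from the empty state, is finite. **Discretization.** For $\vec K=(K_1,\dots,K_d)$ with integers $K_l\ge1$, a job with requirement $v$ has type $(\lceil K_1v_1\rceil,\dots,\lceil K_dv_d\rceil)\in\Gamma_{\vec K}=\prod_l\{1,\dots,K_l\}$. A service option $M$ is a finite multiset of types, $M^{(\vec i)}$ being the multiplicity of $\vec i$. The 2-Job efficient set $E^{2J}_{\vec K}$ consists of the options $\{\vec j\}$ for $\vec j\in\Gamma_{\vec K}$ with $j_l=K_l$ for some $l$, and the options $\{\vec j,\vec K-\vec j\}$ for $\vec j\in\Gamma_{\vec K}$ with $j_l<K_l$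 for all $l$. * *2J $\vec K$-EMW*: if $q_{\vec i}$ denotes the number of type-$\vec i$ jobs present, the policy picks in each state some $M\in E^{2J}_{\vec K}$ maximizing $\sum_{\vec i} M^{(\vec i)}q_{\vec i}$ and serves $\min(M^{(\vec i)},q_{\vec i})$ jobs of each type $\vec i$. "2J $\vec K$-EMW stabilizes the system" means that such policies exist and that the system is stable under every one of them, however ties are broken and the jobs within a type are chosen. * *2J $\vec K$-EnMSR* (nonpreemptive Markovian service rate): an autonomous modulating continuous-time Markov chain provides the service slots. It is specified by a nonempty set of at most $|\Gamma_{\vec K}|$ working options $M\in E^{2J}_{\vec K}$ and by rates $r(M,M')\ge0$, $M\ne M'$, that are irreducible on this set. While working on $M$, it provides the slots of $M$ and decides at rate $r(M,M')$ to switch to $M'$. After such a decision it keeps its slots, except that whenever a slot of a type of which there are currently more slots than in $M'$ completes (each slot, occupied or idle, completes at rate $1$), this slot is removed; as soon as the remaining slots form a sub-multiset of $M'$, it works on $M'$. At each time, for each type $\vec i$, the earliest type-$\vec i$ jobs present are in service, one per type-$\vec i$ slot as far as there are such jobs; in this way no job is ever preempted. "2J $\vec K$-EnMSR stabilizes the system"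 means that the working options and the rates can be chosen such that, for every working option $M$, the state in which no job is present and the modulating chain works on $M$ is positive recurrent. A family of policies indexed by $\vec K$ is throughput-optimal (for $V$) if, for each $\lambda>0$ for which some policy stabilizes the system, there is a $\vec K$ such that the member with parameter $\vec K$ stabilizes the system. **Theorem (2J $\vec K$-EMW and 2J $\vec K$-EnMSR).** Assume that $f_V$ is Lipschitz continuous and centrally symmetric about $\frac12\vec 1$, i.e. $f_V(v)=f_V(\vec 1-v)$ whenever $v$ and $\vec 1-v$ both lie in $(0,1]^d$. Then the 2J $\vec K$-EMW family and the 2J $\vec K$-EnMSR family are both throughput-optimal. More specifically, for every arrival rate $0<\lambda<2$ there is a $\vec K$ such that both 2J $\vec K$-EMW and 2J $\vec K$-EnMSR stabilize the system. Moreover, let $V\sim\mathrm{Unif}((0,1]^d)$ and $0<\lambda<2$, and let $K$ be the smallest odd integer with $K\ge\left\lfloor\frac{2\lambda d}{2-\lambda}\right\rfloor+1$. Then for every $\vec K$ with $K_l\ge K$ for all $l$, both 2J $\vec K$-EMW and 2J $\vec K$-EnMSR stabilize the system. If $V\sim \mathrm{Unif}((0,1])$ (so $d=1$) and $0<\lambda<2$,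 then both 2J $K$-EMW and 2J $K$-EnMSR stabilize the system for every odd $K\ge\left\lfloor\frac{\lambda}{2-\lambda}\right\rfloor+1$. -/

import Mathlib

open MeasureTheory ProbabilityTheory
open scoped ENNReal

namespace MRJ

noncomputable section

/-! ### Markov jump processes

A Markov jump process is given by its transition-rate kernel `Q`: from the state `x` the process
jumps into a set `A` (not containing `x`) at rate `Q x A`. -/

section JumpProcess

variable {S : Type*} [MeasurableSpace S]

/-- The total rate at which the process leaves `x`. -/
def exitRate (Q : Kernel S S) (x : S) : ℝ≥0∞ := Q x Set.univ

theorem measurable_exitRate (Q : Kernel S S) : Measurable (exitRate Q) :=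
  Kernel.measurable_coe Q MeasurableSet.univ

open Classical in
/-- The transition kernel of the embedded jump chain: the normalised rate kernel
(a state without a genuine exit rate is absorbing). -/
def jumpKernel (Q : Kernel S S) : Kernel S S where
  toFun x := if exitRate Q x = 0 ∨ exitRate Q x = ∞ then Measure.dirac x
    else (exitRate Q x)⁻¹ • Q x
  measurable' := by
    have hq := measurable_exitRate Q
    refine Measurable.ite ?_ Measure.measurable_dirac ?_
    · exact (hq (measurableSet_singleton 0)).union (hq (measurableSet_singleton ∞))
    · refine Measure.measurable_of_measurable_coe _ fun s hs => ?_
      simp only [Measure.smul_apply, smul_eq_mul]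
      exact hq.inv.mul (Kernel.measurable_coe Q hs)

instance (Q : Kernel S S) : IsMarkovKernel (jumpKernel Q) where
  isProbabilityMeasure x := by
    change IsProbabilityMeasure (if _ then _ else _)
    split_ifs with h
    · infer_instance
    · push Not at h
      refine ⟨?_⟩
      rw [Measure.smul_apply, smul_eq_mul]
      exact ENNReal.inv_mul_cancel h.1 h.2

/-- The law of the embedded jump chain `Y₀, Y₁, Y₂, …` started from `x₀`. -/
def jumpChainLaw (Q : Kernel S S) (x₀ : S) : Measure (ℕ → S) :=
  Kernel.trajMeasure (X := fun _ => S) (Measure.dirac x₀)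
    (fun n => (jumpKernel Q).comap (fun h => h ⟨n, Finset.mem_Iic.2 le_rfl⟩)
      (measurable_pi_apply _))

/-- The law of the jump chain together with independent `Exp(1)` clocks `e₀, e₁, e₂, …`. -/
def pathLaw (Q : Kernel S S) (x₀ : S) : Measure ((ℕ → S) × (ℕ → ℝ)) :=
  (jumpChainLaw Q x₀).prod (Measure.infinitePi fun _ : ℕ => expMeasure 1)

/-- The time of the `n`-th jump. The process spends the time `e_k / exitRate Q Y_k`, which is
exponential of rate `exitRate Q Y_k`, in its `k`-th state. -/
def jumpTime (Q : Kernel S S) (ω : (ℕ → S) × (ℕ → ℝ)) (n : ℕ) : ℝ≥0∞ :=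
  ∑ k ∈ Finset.range n, ENNReal.ofReal (ω.2 k) / exitRate Q (ω.1 k)

/-- The first time, after leaving `x₀`, at which the process is in `x₀` again (`∞` if never). -/
def returnTime (Q : Kernel S S) (x₀ : S) (ω : (ℕ → S) × (ℕ → ℝ)) : ℝ≥0∞ :=
  ⨅ (n : ℕ) (_ : 1 ≤ n ∧ ω.1 n = x₀), jumpTime Q ω n

/-- `x₀` is positive recurrent: started from `x₀`, the process has a finite mean return time. -/
def PositiveRecurrent (Q : Kernel S S) (x₀ : S) : Prop :=
  ∫⁻ ω, returnTime Q x₀ ω ∂pathLaw Q x₀ < ∞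

end JumpProcess

/-! ### The multiresource-job system -/

/-- The set `(0,1]^d` of resource requirements. -/
def cube (d : ℕ) : Set (Fin d → ℝ) := Set.pi Set.univ fun _ => Set.Ioc 0 1

/-- A resource requirement, a point of `(0,1]^d`. -/
abbrev Req (d : ℕ) : Type := cube d

/-- Lebesgue measure on `(0,1]^d`; it is also the uniform distribution on `(0,1]^d`. -/
def cubeVolume (d : ℕ) : Measure (Req d) := Measure.comap Subtype.val volume

/-- `f` is a probability density function of the distribution `μ` on `(0,1]^d`. -/
def IsPDF {d : ℕ} (f : Req d → ℝ) (μ : Measure (Req d)) : Prop :=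
  Measurable f ∧ (∀ v, 0 ≤ f v) ∧ μ = (cubeVolume d).withDensity fun v => ENNReal.ofReal (f v)

/-- Central symmetry of `f` about `½·(1,…,1)`: `f v = f (1 - v)` whenever `v` and `1 - v` both
lie in `(0,1]^d`. -/
def IsCentrallySymmetric {d : ℕ} (f : Req d → ℝ) : Prop :=
  ∀ v w : Req d, (∀ l, w.1 l = 1 - v.1 l) → f w = f v

/-- A state of the system: the finite list of the requirements of the jobs present, in the order
of arrival. -/
abbrev State (d : ℕ) : Type := Σ N : ℕ, (Fin N → Req d)

/-- The state without jobs. -/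
def emptyState (d : ℕ) : State d := ⟨0, Fin.elim0⟩

/-- A job with requirement `v` arrives. -/
def arrive {d : ℕ} (x : State d) (v : Req d) : State d := ⟨x.1 + 1, Fin.snoc x.2 v⟩

/-- The job in position `n` of the list leaves. -/
def depart {d : ℕ} : (x : State d) → Fin x.1 → State d
  | ⟨0, _⟩, n => n.elim0
  | ⟨N + 1, x⟩, n => ⟨N, n.removeNth x⟩

/-- A (measurable) Markovian policy: a map from states to the set of (positions of) jobs that are
served simultaneously, whose total requirement is at most `1` for each resource. -/
structure Policy (d : ℕ) where
  serve : (x : State d) → Finset (Fin x.1)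
  feasible : ∀ (x : State d) (l : Fin d), ∑ n ∈ serve x, (x.2 n).1 l ≤ 1
  measurable_serve : ∀ (N : ℕ) (s : Finset (Fin N)),
    MeasurableSet {x : Fin N → Req d | serve ⟨N, x⟩ = s}

theorem measurable_of_sigma {ι α : Type*} {β : ι → Type*} [∀ i, MeasurableSpace (β i)]
    [MeasurableSpace α] {g : (Σ i, β i) → α} (h : ∀ i, Measurable fun y => g ⟨i, y⟩) :
    Measurable g := by
  intro s hs
  exact MeasurableSpace.measurableSet_iInf.2 fun i => h i hs

theorem measurable_sigma_mk {ι : Type*} {β : ι → Type*} [∀ i, MeasurableSpace (β i)] (i : ι) :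
    Measurable (Sigma.mk i : β i → Σ i, β i) := by
  intro s hs
  exact MeasurableSpace.measurableSet_iInf.1 hs i

theorem measurable_arrive {d : ℕ} :
    Measurable fun p : State d × Req d => arrive p.1 p.2 := by
  have h : Measurable fun p : Req d × State d => arrive p.2 p.1 := by
    intro s hs
    have : (fun p : Req d × State d => arrive p.2 p.1) ⁻¹' s =
        ⋃ N : ℕ, (fun q : Req d × (Fin N → Req d) => (q.1, (⟨N, q.2⟩ : State d))) ''
          ((fun q : Req d × (Fin N → Req d) =>
            (⟨N + 1, Fin.snoc q.2 q.1⟩ : State d)) ⁻¹' s) := by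
      ext ⟨v, ⟨N, x⟩⟩
      simp only [Set.mem_preimage, Set.mem_iUnion, Set.mem_image, Prod.mk.injEq, Prod.exists]
      constructor
      · intro hx
        exact ⟨N, v, x, hx, rfl, rfl⟩
      · rintro ⟨M, w, y, hy, rfl, hxy⟩
        cases hxy
        exact hy
    rw [this]
    refine MeasurableSet.iUnion fun N => ?_
    have hm : Measurable fun q : Req d × (Fin N → Req d) =>
        (⟨N + 1, Fin.snoc q.2 q.1⟩ : State d) := by
      refine (measurable_sigma_mk (N + 1)).comp (measurable_pi_lambda _ fun n => ?_)
      refine Fin.lastCases ?_ (fun m => ?_) n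
      · simpa using measurable_fst
      · simpa [Function.comp_def] using (measurable_pi_apply m).comp
          (measurable_snd (α := Req d) (β := Fin N → Req d))
    have hinj : Function.Injective (fun x : Fin N → Req d => (⟨N, x⟩ : State d)) :=
      fun _ _ h => eq_of_heq (Sigma.mk.inj h).2
    have he : MeasurableEmbedding (fun x : Fin N → Req d => (⟨N, x⟩ : State d)) := by
      refine ⟨hinj, measurable_sigma_mk N, fun t ht => ?_⟩
      refine MeasurableSpace.measurableSet_iInf.2 fun M => ?_
      change MeasurableSet ((fun x : Fin M → Req d => (⟨M, x⟩ : State d)) ⁻¹'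
        ((fun x : Fin N → Req d => (⟨N, x⟩ : State d)) '' t))
      by_cases hMN : M = N
      · subst hMN
        rwa [Set.preimage_image_eq _ hinj]
      · convert MeasurableSet.empty
        ext y
        simp only [Set.mem_preimage, Set.mem_image, Set.mem_empty_iff_false, iff_false]
        rintro ⟨z, -, hz⟩
        exact hMN (congrArg Sigma.fst hz).symm
    exact (MeasurableEmbedding.id.prodMap he).measurableSet_image.2 (hm hs)
  exact h.comp measurable_swap

theorem measurable_depart {d N : ℕ} (n : Fin N) :
    Measurable fun x : Fin N → Req d => depart ⟨N, x⟩ n := by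
  cases N with
  | zero => exact n.elim0
  | succ N =>
    exact (measurable_sigma_mk N).comp (measurable_pi_lambda _ fun m => measurable_pi_apply _)

theorem measurable_finset_sum_measure {α β ι : Type*} [MeasurableSpace α] [MeasurableSpace β]
    (s : Finset ι) {g : ι → α → Measure β} (h : ∀ i ∈ s, Measurable (g i)) :
    Measurable fun x => ∑ i ∈ s, g i x := by
  classical
  induction s using Finset.induction_on with
  | empty => simp
  | insert a s ha ih =>
    simp only [Finset.sum_insert ha]
    exact (h a (Finset.mem_insert_self a s)).add
      (ih fun i hi => h i (Finset.mem_insert_of_mem hi))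

theorem measurable_smul_map {α β γ : Type*} [MeasurableSpace α] [MeasurableSpace β]
    [MeasurableSpace γ] (c : ℝ≥0∞) (μ : Measure β) [SFinite μ] {g : α × β → γ}
    (hg : Measurable g) : Measurable fun x => c • μ.map fun v => g (x, v) := by
  refine Measure.measurable_of_measurable_coe _ fun s hs => ?_
  simp only [Measure.smul_apply, smul_eq_mul]
  refine Measurable.const_mul ?_ c
  have : ∀ x, μ.map (fun v => g (x, v)) s = μ (Prod.mk x ⁻¹' (g ⁻¹' s)) := fun x =>
    Measure.map_apply (hg.comp measurable_prodMk_left) hs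
  simp only [this]
  exact measurable_measure_prodMk_left (hg hs)

open Classical in
/-- Transition rates of the system with Poisson arrivals of rate `lam`, i.i.d. requirements of
law `μ` and i.i.d. `Exp(1)` durations, under the policy `π`: a new job arrives at rate `lam`, and
each job in service is completed at rate `1`. -/
def mrjRates {d : ℕ} (lam : ℝ) (μ : Measure (Req d)) [SFinite μ] (π : Policy d) :
    Kernel (State d) (State d) where
  toFun x := ENNReal.ofReal lam • μ.map (fun v => arrive x v)
    + ∑ n ∈ π.serve x, Measure.dirac (depart x n)
  measurable' := by
    refine (measurable_smul_map _ μ measurable_arrive).add (measurable_of_sigma fun N => ?_)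
    have : ∀ x : Fin N → Req d,
        ∑ n ∈ π.serve ⟨N, x⟩, Measure.dirac (depart ⟨N, x⟩ n) =
          ∑ s : Finset (Fin N), if π.serve ⟨N, x⟩ = s then
            ∑ n ∈ s, Measure.dirac (depart ⟨N, x⟩ n) else 0 := by
      intro x
      rw [Finset.sum_ite_eq]
      simp
    simp only [this]
    refine measurable_finset_sum_measure _ fun s _ => ?_
    exact Measurable.ite (π.measurable_serve N s)
      (measurable_finset_sum_measure _ fun n _ =>
        Measure.measurable_dirac.comp (measurable_depart n)) measurable_const

/-- The policy `π` stabilizes the system: the empty state is positive recurrent. -/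
def Stable {d : ℕ} (lam : ℝ) (μ : Measure (Req d)) [SFinite μ] (π : Policy d) : Prop :=
  PositiveRecurrent (mrjRates lam μ π) (emptyState d)

/-! ### Discretization -/

/-- A job type under the discretization by `K = (K₁,…,K_d)`. -/
abbrev JobType (d : ℕ) : Type := Fin d → ℕ

/-- A service option, as an unordered list of job types with repetitions;
`M.count i` is the number of type-`i` jobs in `M`. -/
abbrev ServiceOption (d : ℕ) : Type := Multiset (JobType d)

instance (d : ℕ) : MeasurableSpace (ServiceOption d) := ⊤

instance (d : ℕ) : DiscreteMeasurableSpace (ServiceOption d) := ⟨fun _ => trivial⟩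

/-- The set `Γ_K` of job types. -/
def jobTypes {d : ℕ} (K : Fin d → ℕ) : Finset (JobType d) := Finset.Icc 1 K

/-- The type `(⌈K₁v₁⌉,…,⌈K_dv_d⌉)` of a job with requirement `v`. -/
def typeOf {d : ℕ} (K : Fin d → ℕ) (v : Req d) : JobType d := fun l => ⌈(K l : ℝ) * v.1 l⌉₊

/-- `queue K x i` is the number of type-`i` jobs in the state `x`. -/
def queue {d : ℕ} (K : Fin d → ℕ) (x : State d) (i : JobType d) : ℕ :=
  (Finset.univ.filter fun n => typeOf K (x.2 n) = i).card

/-- The inner product `⟨M, q⟩` of a service option and a queue-length vector. -/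
def weight {d : ℕ} (M : ServiceOption d) (q : JobType d → ℕ) : ℕ := (M.map q).sum

/-- The 2-Job efficient set: all options `{j}` for a boundary type `j` (one with `j_l = K_l` for
some `l`), and all options `{j, K - j}` for a non-boundary type `j`. -/
def twoJobSet {d : ℕ} (K : Fin d → ℕ) : Set (ServiceOption d) :=
  {M | ∃ j ∈ jobTypes K, (∃ l, j l = K l) ∧ M = {j}} ∪
  {M | ∃ j ∈ jobTypes K, (∀ l, j l ≠ K l) ∧ M = {j, K - j}}

/-! ### Efficient MaxWeight -/

/-- `π` is a `K`-discretized efficient MaxWeight policy with efficient set `E`: in each state `x`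
it picks some `M ∈ E` maximizing `⟨M, q(x)⟩` and serves `M.count i` jobs of each type `i`, or all of
them if fewer are present. Ties may be broken, and the jobs within a type chosen, arbitrarily. -/
def IsEMW {d : ℕ} (K : Fin d → ℕ) (E : Set (ServiceOption d)) (π : Policy d) : Prop :=
  ∀ x : State d, ∃ M ∈ E, (∀ M' ∈ E, weight M' (queue K x) ≤ weight M (queue K x)) ∧
    ∀ i : JobType d, ((π.serve x).filter fun n => typeOf K (x.2 n) = i).card =
      min (M.count i) (queue K x i)

/-- `2J K-EMW` stabilizes the system: the policy exists, and however it breaks ties, the system is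
stable under it. -/
def TwoJobEMWStabilizes {d : ℕ} (lam : ℝ) (μ : Measure (Req d)) [SFinite μ]
    (K : Fin d → ℕ) : Prop :=
  (∃ π : Policy d, IsEMW K (twoJobSet K) π) ∧
    ∀ π : Policy d, IsEMW K (twoJobSet K) π → Stable lam μ π

/-! ### Efficient nonpreemptive Markovian service rate policies

The modulating process has working states, one for each option in a finite set, and switching
states. Its state is a pair `(u, T)` of the service slots `u` currently provided and the target
option `T`; it is a working state if `u = T`. In the working state `(M, M)` the process decides at
rate `rate M M'` to switch to `M'`. Since jobs may not be preempted, it then keeps the slots of `M`,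
and takes away a type-`i` slot only at the moment when that slot completes (each slot completes at
rate `1`, whether it is occupied or idle) and only while there are more type-`i` slots than in `M'`.
As soon as the remaining slots are part of `M'` it enters the working state `(M', M')`. The
modulating process does not depend on the queue lengths. -/

/-- The data of a `K`-discretized nMSR policy whose working states are options from `E`. -/
structure NMSR {d : ℕ} (K : Fin d → ℕ) (E : Set (ServiceOption d)) where
  working : Finset (ServiceOption d)
  nonempty : working.Nonempty
  subset : ∀ M ∈ working, M ∈ E
  card_le : working.card ≤ (jobTypes K).card
  rate : ServiceOption d → ServiceOption d → ℝ
  rate_nonneg : ∀ M M', 0 ≤ rate M M'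
  irreducible : ∀ M ∈ working, ∀ M' ∈ working,
    Relation.ReflTransGen (fun A B => A ∈ working ∧ B ∈ working ∧ A ≠ B ∧ 0 < rate A B) M M'

/-- A state `(u, T)` of the modulating process: current slots and target option. -/
abbrev Mode (d : ℕ) : Type := ServiceOption d × ServiceOption d

/-- Start working on the target as soon as the current slots are part of it. -/
def settle {d : ℕ} (u T : ServiceOption d) : Mode d := if u ≤ T then (T, T) else (u, T)

/-- The mode after the completion of a type-`i` slot in the mode `(u, T)`. -/
def release {d : ℕ} (m : Mode d) (i : JobType d) : Mode d :=
  if m.2.count i < m.1.count i then settle (m.1.erase i) m.2 else m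

/-- The jobs in service when the slots are `u`: for each type `i`, the `u.count i` earliest
type-`i` jobs, or all of them if fewer are present. (A job that enters service by this rule stays
in service until it is completed, because a slot is taken away only when it completes.) -/
def slotServe {d : ℕ} (K : Fin d → ℕ) (u : ServiceOption d) (x : State d) : Finset (Fin x.1) :=
  Finset.univ.filter fun n =>
    (Finset.univ.filter fun m => m < n ∧ typeOf K (x.2 m) = typeOf K (x.2 n)).card <
      u.count (typeOf K (x.2 n))

theorem measurable_typeOf {d : ℕ} (K : Fin d → ℕ) : Measurable (typeOf K) := by
  refine measurable_pi_lambda _ fun l => ?_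
  exact Nat.measurable_ceil.comp
    (((measurable_pi_apply l).comp measurable_subtype_coe).const_mul _)

theorem measurable_types {d N : ℕ} (K : Fin d → ℕ) :
    Measurable fun (x : Fin N → Req d) (n : Fin N) => typeOf K (x n) :=
  measurable_pi_lambda _ fun n => (measurable_typeOf K).comp (measurable_pi_apply n)

open Classical in
/-- Transition rates of the system under the nMSR policy `P`: arrivals at rate `lam`; completion
of each job in service at rate `1`; completion of each idle slot of a type of which there are more
slots than in the target, at rate `1` (the completion of any other idle slot has no effect); in a
working state, a decision to switch. -/
def nmsrRates {d : ℕ} {K : Fin d → ℕ} {E : Set (ServiceOption d)} (lam : ℝ) (μ : Measure (Req d))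
    [SFinite μ] (P : NMSR K E) : Kernel (State d × Mode d) (State d × Mode d) where
  toFun z := ENNReal.ofReal lam • μ.map (fun v => (arrive z.1 v, z.2))
    + ∑ n ∈ slotServe K z.2.1 z.1,
        Measure.dirac (depart z.1 n, release z.2 (typeOf K (z.1.2 n)))
    + ∑ i ∈ jobTypes K, (if z.2.2.count i < z.2.1.count i then
        ((z.2.1.count i - min (z.2.1.count i) (queue K z.1 i) : ℕ) : ℝ≥0∞) •
          Measure.dirac (z.1, release z.2 i) else 0)
    + (if z.2.1 = z.2.2 then ∑ M ∈ P.working.erase z.2.1,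
        ENNReal.ofReal (P.rate z.2.1 M) • Measure.dirac (z.1, settle z.2.1 M) else 0)
  measurable' := by
    refine Measurable.add (Measurable.add (Measurable.add ?_ ?_) ?_) ?_
    · refine measurable_smul_map (g := fun p : (State d × Mode d) × Req d =>
        (arrive p.1.1 p.2, p.1.2)) _ μ ?_
      exact (measurable_arrive.comp ((measurable_fst.comp measurable_fst).prodMk
        measurable_snd)).prodMk (measurable_snd.comp measurable_fst)
    · refine measurable_from_prod_countable_left fun m => measurable_of_sigma fun N => ?_
      have h1 : ∀ x : Fin N → Req d,
          ∑ n ∈ slotServe K m.1 ⟨N, x⟩,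
            Measure.dirac (depart ⟨N, x⟩ n, release m (typeOf K (x n))) =
          ∑ n : Fin N, if (Finset.univ.filter fun k =>
              k < n ∧ typeOf K (x k) = typeOf K (x n)).card < m.1.count (typeOf K (x n)) then
            Measure.dirac (depart ⟨N, x⟩ n, release m (typeOf K (x n))) else 0 := by
        intro x
        rw [slotServe, Finset.sum_filter]
      simp only [h1]
      refine measurable_finset_sum_measure _ fun n _ => Measurable.ite ?_ ?_ measurable_const
      · have hs : MeasurableSet {t : Fin N → JobType d |
            (Finset.univ.filter fun k => k < n ∧ t k = t n).card < m.1.count (t n)} :=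
          (Set.to_countable _).measurableSet
        exact measurable_types K hs
      · refine Measure.measurable_dirac.comp ((measurable_depart n).prodMk ?_)
        exact (measurable_of_countable (release m)).comp
          ((measurable_typeOf K).comp (measurable_pi_apply n))
    · refine measurable_finset_sum_measure _ fun i _ => ?_
      refine measurable_from_prod_countable_left fun m => measurable_of_sigma fun N => ?_
      dsimp only
      split_ifs
      · refine Measure.measurable_of_measurable_coe _ fun s hs => ?_
        simp only [Measure.smul_apply, smul_eq_mul]
        refine Measurable.mul ?_ ?_
        · exact (measurable_of_countable fun t : Fin N → JobType d =>
            ((m.1.count i - min (m.1.count i) (Finset.univ.filter fun n => t n = i).card : ℕ) :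
              ℝ≥0∞)).comp (measurable_types K)
        · exact (Measure.measurable_coe hs).comp (Measure.measurable_dirac.comp
            ((measurable_sigma_mk N).prodMk measurable_const))
      · exact measurable_const
    · refine measurable_from_prod_countable_left fun m => ?_
      dsimp only
      split_ifs
      · refine measurable_finset_sum_measure _ fun M _ => ?_
        refine Measure.measurable_of_measurable_coe _ fun s hs => ?_
        simp only [Measure.smul_apply, smul_eq_mul]
        exact ((Measure.measurable_coe hs).comp (Measure.measurable_dirac.comp
            (measurable_id.prodMk measurable_const))).const_mul _
      · exact measurable_const

/-- The nMSR policy `P` stabilizes the system: the empty system, in any working state of the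
modulating process, is positive recurrent. -/
def NMSR.Stable {d : ℕ} {K : Fin d → ℕ} {E : Set (ServiceOption d)} (lam : ℝ)
    (μ : Measure (Req d)) [SFinite μ] (P : NMSR K E) : Prop :=
  ∀ M ∈ P.working, PositiveRecurrent (nmsrRates lam μ P) (emptyState d, (M, M))

/-- `2J K-EnMSR` stabilizes the system: for a suitable (precomputed) modulating process with
working states in the 2-Job efficient set, the resulting nMSR policy is stable. -/
def TwoJobEnMSRStabilizes {d : ℕ} (lam : ℝ) (μ : Measure (Req d)) [SFinite μ]
    (K : Fin d → ℕ) : Prop :=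
  ∃ P : NMSR K (twoJobSet K), P.Stable lam μ

/-! ### Throughput-optimality -/

/-- A family of policies indexed by the discretization parameter `K ∈ {1, 2, …}^d` is
throughput-optimal for the requirement distribution `μ`: for each arrival rate at which some
Markovian policy stabilizes the system, some member of the family stabilizes it. -/
def ThroughputOptimal {d : ℕ} (μ : Measure (Req d)) [SFinite μ]
    (stabilizes : ℝ → (Fin d → ℕ) → Prop) : Prop :=
  ∀ lam : ℝ, 0 < lam → (∃ π : Policy d, Stable lam μ π) →
    ∃ K : Fin d → ℕ, (∀ l, 1 ≤ K l) ∧ stabilizes lam K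

end

end MRJ

/-! Why 2 is the threshold: by central symmetry every resource has mean requirement 1/2, so work for
a fixed resource arrives at rate λ/2, while a feasible policy removes at most 1 per unit of time. If
λ ≥ 2, the workload has nonnegative drift away from the empty state, and this excludes a finite mean
return time (`lt_two_of_stable`, from `not_positiveRecurrent_of_drift`).

Why every λ < 2 is reached: the cells of the types j and K - j are almost mirror images. The point
reflection of the cell of j about the centre of the cube is the cell of K - j shifted by one mesh
width, so for a Lipschitz density their probabilities differ by at most C/k times the cell volume
(`typeProb_sub_le`). Interior types can therefore be served in pairs at almost no loss. Only
boundary types need an option of their own, and they fill at most d/k of the volume. A mixture of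
options with total weight at most (λ/2)(1 + Fd/k + C/k), where F bounds the density, thus covers all
arrival rates. If this is less than 1, the remainder is a uniform slack η (`exists_capacity`,
`capacity_of_lipschitz`). The object `Capacity` is all that both stability proofs know about the
distribution.

For MaxWeight the Lyapunov function is the sum of squared queue lengths: the chosen option has at
least the weight of the mixture, so the drift is at most a constant minus 2η times the number of
jobs.

For the nonpreemptive policy the option is redrawn from the mixture at a small rate ε. The momentary
service rate is then unrelated to the queues, and the quadratic function is corrected by a term
linear in the queues, `modeBonus`. Its part (2 - count)/ε turns the momentary service rate into the
averaged one. Its part proportional to the excess slots pays for the time spent on switching, which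
for small ε costs less than the slack.

A negative drift far out controls the return only to a bounded region. To reach one prescribed
state, `positiveRecurrent_of_lyapunov` adds a large multiple of a bounded concave function of a
distance to that state which decreases at a rate bounded below. This reduces recurrence to the
Foster criterion `positiveRecurrent_of_drift`. -/

namespace MRJ

noncomputable section

/-! ### Drift criteria for and against positive recurrence of jump processes -/

section JumpProcess

variable {S : Type*} [MeasurableSpace S]

instance (Q : Kernel S S) (x₀ : S) : IsProbabilityMeasure (jumpChainLaw Q x₀) := by
  unfold jumpChainLaw
  infer_instance

theorem jumpChainLaw_map_zero (Q : Kernel S S) (x₀ : S) :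
    (jumpChainLaw Q x₀).map (fun y => y 0) = Measure.dirac x₀ := by
  have h : (jumpChainLaw Q x₀).map (Preorder.frestrictLe (π := fun _ => S) 0) =
      (Measure.dirac x₀).map
        (MeasurableEquiv.piUnique (fun _ : Finset.Iic 0 => S)).symm := by
    unfold jumpChainLaw Kernel.trajMeasure
    rw [Measure.map_comp _ _ (by fun_prop), Kernel.traj_map_frestrictLe,
      Kernel.partialTraj_self, Measure.id_comp]
  have h2 : (fun y : ℕ → S => y 0) =
      (fun h : Finset.Iic 0 → S => h ⟨0, Finset.mem_Iic.2 le_rfl⟩) ∘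
        Preorder.frestrictLe (π := fun _ => S) 0 := rfl
  rw [h2, ← Measure.map_map (by fun_prop) (by fun_prop), h, Measure.map_map (by fun_prop)
    (by fun_prop)]
  exact Measure.map_id

/-- The paths which do not visit `x₀` at any of the times `1, …, k`. -/
def noReturn {T : Type*} (x₀ : T) (k : ℕ) : Set (ℕ → T) := {y | ∀ j, 1 ≤ j → j ≤ k → y j ≠ x₀}

theorem noReturn_zero {T : Type*} (x₀ : T) : noReturn x₀ 0 = Set.univ := by
  ext y
  simp only [noReturn, Set.mem_ofPred_eq, Set.mem_univ, iff_true]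
  omega

theorem noReturn_anti {T : Type*} (x₀ : T) {k l : ℕ} (h : k ≤ l) : noReturn x₀ l ⊆ noReturn x₀ k :=
  fun _ hy j h1 h2 => hy j h1 (h2.trans h)

theorem measurableSet_noReturn [MeasurableSingletonClass S] (x₀ : S) (k : ℕ) :
    MeasurableSet (noReturn x₀ k) := by
  have : noReturn x₀ k = ⋂ (j : ℕ) (_ : 1 ≤ j) (_ : j ≤ k), (fun y : ℕ → S => y j) ⁻¹' {x₀}ᶜ := by
    ext y; simp [noReturn]
  rw [this]
  refine MeasurableSet.iInter fun j => MeasurableSet.iInter fun _ => MeasurableSet.iInter fun _ => ?_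
  exact measurable_pi_apply j (measurableSet_singleton x₀).compl

/-- The Markov property of the jump chain. -/
theorem lintegral_jumpChainLaw_succ (Q : Kernel S S) (x₀ : S) (n : ℕ)
    {F : (Finset.Iic n → S) × S → ℝ≥0∞} (hF : Measurable F) :
    ∫⁻ y, F (fun i => y i, y (n + 1)) ∂jumpChainLaw Q x₀ =
      ∫⁻ y, ∫⁻ s, F (fun i => y i, s) ∂jumpKernel Q (y n) ∂jumpChainLaw Q x₀ := by
  have h := Kernel.map_frestrictLe_trajMeasure_compProd_eq_map_trajMeasure
    (X := fun _ => S) (μ₀ := Measure.dirac x₀)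
    (κ := fun n => (jumpKernel Q).comap (fun h : (Finset.Iic n → S) => h ⟨n, Finset.mem_Iic.2 le_rfl⟩)
      (measurable_pi_apply _)) (a := n)
  have h2 : ∫⁻ p, F p ∂_ = ∫⁻ p, F p ∂_ := congrArg (fun m => ∫⁻ p, F p ∂m) h
  rw [lintegral_map hF (by fun_prop), Measure.lintegral_compProd hF, lintegral_map] at h2
  · exact h2.symm
  · exact Measurable.lintegral_kernel_prod_right' hF
  · fun_prop

/-- Not having returned by time n is an event of the first n coordinates, so its indicator can be
absorbed into the test function of the Markov property. -/
theorem lintegral_noReturn_succ [MeasurableSingletonClass S] (Q : Kernel S S) (x₀ : S) (n : ℕ)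
    {G : S × S → ℝ≥0∞} (hG : Measurable G) :
    ∫⁻ y in noReturn x₀ n, G (y n, y (n + 1)) ∂jumpChainLaw Q x₀ =
      ∫⁻ y in noReturn x₀ n, ∫⁻ s, G (y n, s) ∂jumpKernel Q (y n) ∂jumpChainLaw Q x₀ := by
  let B : Set (Finset.Iic n → S) := {h | ∀ j : Finset.Iic n, 1 ≤ j.1 → h j ≠ x₀}
  have hB : MeasurableSet B := by
    have : B = ⋂ (j : Finset.Iic n) (_ : 1 ≤ j.1), (fun y : Finset.Iic n → S => y j) ⁻¹' {x₀}ᶜ := by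
      ext y; simp [B]
    rw [this]
    refine MeasurableSet.iInter fun j => MeasurableSet.iInter fun _ => ?_
    exact measurable_pi_apply j (measurableSet_singleton x₀).compl
  have hmem : ∀ y : ℕ → S, (fun i : Finset.Iic n => y i) ∈ B ↔ y ∈ noReturn x₀ n := by
    intro y
    simp [B, noReturn]
    exact ⟨fun h j h1 h2 => h j h2 h1, fun h j h1 h2 => h j h2 h1⟩
  have hF : Measurable fun p : (Finset.Iic n → S) × S =>
      (B ×ˢ Set.univ).indicator (fun p => G (p.1 ⟨n, Finset.mem_Iic.2 le_rfl⟩, p.2)) p :=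
    Measurable.indicator (by fun_prop) (hB.prod MeasurableSet.univ)
  have h := lintegral_jumpChainLaw_succ Q x₀ n hF
  rw [← lintegral_indicator (measurableSet_noReturn x₀ n),
    ← lintegral_indicator (measurableSet_noReturn x₀ n)]
  convert h using 2
  · ext y
    by_cases hy : y ∈ noReturn x₀ n
    · rw [Set.indicator_of_mem hy, Set.indicator_of_mem]
      exact ⟨(hmem y).2 hy, trivial⟩
    · rw [Set.indicator_of_notMem hy, Set.indicator_of_notMem]
      exact fun h => hy ((hmem y).1 h.1)
  · ext y
    by_cases hy : y ∈ noReturn x₀ n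
    · rw [Set.indicator_of_mem hy]
      refine lintegral_congr fun s => ?_
      rw [Set.indicator_of_mem]
      exact ⟨(hmem y).2 hy, trivial⟩
    · rw [Set.indicator_of_notMem hy]
      symm
      rw [lintegral_eq_zero_iff' (by fun_prop)]
      filter_upwards with s
      rw [Set.indicator_of_notMem]
      · rfl
      · exact fun h => hy ((hmem y).1 h.1)

theorem lintegral_jumpKernel (Q : Kernel S S) {x : S} (h0 : exitRate Q x ≠ 0)
    (h1 : exitRate Q x ≠ ∞) (g : S → ℝ≥0∞) :
    ∫⁻ y, g y ∂jumpKernel Q x = (exitRate Q x)⁻¹ * ∫⁻ y, g y ∂Q x := by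
  have : jumpKernel Q x = (exitRate Q x)⁻¹ • Q x := by
    change (if _ then _ else _) = _
    rw [if_neg (by tauto)]
  rw [this, lintegral_smul_measure, smul_eq_mul]

/-- Multiplying the Exp(1) density by x gives the Gamma(2,1) density, whose total mass is 1. -/
theorem lintegral_ofReal_expMeasure_one : ∫⁻ x, ENNReal.ofReal x ∂expMeasure 1 = 1 := by
  have hm : Measurable (gammaPDF 1 1) := (measurable_gammaPDFReal 1 1).ennreal_ofReal
  rw [expMeasure, gammaMeasure, lintegral_withDensity_eq_lintegral_mul _ hm (by fun_prop),
    ← lintegral_gammaPDF_eq_one (a := 2) (r := 1) two_pos one_pos]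
  refine lintegral_congr fun x => ?_
  change gammaPDF 1 1 x * _ = _
  rcases lt_or_ge x 0 with hx | hx
  · rw [gammaPDF_of_neg hx, gammaPDF_of_neg hx, zero_mul]
  · rw [gammaPDF_of_nonneg hx, gammaPDF_of_nonneg hx, ← ENNReal.ofReal_mul (by positivity)]
    congr 1
    norm_num
    ring

theorem lintegral_clock (k : ℕ) :
    ∫⁻ e, ENNReal.ofReal (e k) ∂(Measure.infinitePi fun _ : ℕ => expMeasure 1) = 1 := by
  have := isProbabilityMeasure_expMeasure one_pos
  have h := (measurePreserving_eval_infinitePi (fun _ : ℕ => expMeasure 1) k).lintegral_comp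
    (f := fun x => ENNReal.ofReal x) (by fun_prop)
  rw [← lintegral_ofReal_expMeasure_one, ← h]

/-- The expected time spent in the state after the `k`-th jump, if this is before the return. -/
def meanStay (Q : Kernel S S) (x₀ : S) (k : ℕ) : ℝ≥0∞ :=
  ∫⁻ y in noReturn x₀ k, (exitRate Q (y k))⁻¹ ∂jumpChainLaw Q x₀

theorem lintegral_stay [MeasurableSingletonClass S] (Q : Kernel S S) (x₀ : S) (k : ℕ) :
    ∫⁻ ω, (noReturn x₀ k).indicator (fun y => (exitRate Q (y k))⁻¹) ω.1 *
      ENNReal.ofReal (ω.2 k) ∂pathLaw Q x₀ = meanStay Q x₀ k := by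
  have := isProbabilityMeasure_expMeasure one_pos
  have hq := measurable_exitRate Q
  rw [pathLaw, lintegral_prod_mul
    (f := fun y => (noReturn x₀ k).indicator (fun y => (exitRate Q (y k))⁻¹) y)
    (g := fun e : ℕ → ℝ => ENNReal.ofReal (e k)), lintegral_clock, mul_one,
    lintegral_indicator (measurableSet_noReturn x₀ k), meanStay]
  · exact (Measurable.indicator (by fun_prop) (measurableSet_noReturn x₀ k)).aemeasurable
  · exact Measurable.aemeasurable (by fun_prop)

theorem measurable_stay [MeasurableSingletonClass S] (Q : Kernel S S) (x₀ : S) (k : ℕ) :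
    Measurable fun ω : (ℕ → S) × (ℕ → ℝ) =>
      (noReturn x₀ k).indicator (fun y => (exitRate Q (y k))⁻¹) ω.1 * ENNReal.ofReal (ω.2 k) := by
  have hq := measurable_exitRate Q
  have : Measurable ((noReturn x₀ k).indicator (fun y => (exitRate Q (y k))⁻¹)) :=
    Measurable.indicator (by fun_prop) (measurableSet_noReturn x₀ k)
  fun_prop

/-- The return time is at least the sum of the stays before the first return. This holds also on
paths that never return, where it is infinite; hence no recurrence assumption is needed in this
direction, unlike in `lintegral_returnTime_le`. -/
theorem tsum_meanStay_le [MeasurableSingletonClass S] (Q : Kernel S S) (x₀ : S) :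
    ∑' k, meanStay Q x₀ k ≤ ∫⁻ ω, returnTime Q x₀ ω ∂pathLaw Q x₀ := by
  simp_rw [← lintegral_stay]
  rw [← lintegral_tsum fun k => (measurable_stay Q x₀ k).aemeasurable]
  refine lintegral_mono fun ω => ?_
  refine le_iInf₂ fun n hn => ?_
  rw [tsum_eq_sum (s := Finset.range n), jumpTime]
  · refine Finset.sum_le_sum fun k _ => ?_
    rw [ENNReal.div_eq_inv_mul]
    gcongr
    exact Set.indicator_le_self _ _ _
  · intro k hk
    rw [Set.indicator_of_notMem, zero_mul]
    intro h
    exact h n hn.1 (by simpa using hk) hn.2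

theorem lintegral_returnTime_le [MeasurableSingletonClass S] (Q : Kernel S S) (x₀ : S)
    (h : ∀ᵐ y ∂jumpChainLaw Q x₀, ∃ n, 1 ≤ n ∧ y n = x₀) :
    ∫⁻ ω, returnTime Q x₀ ω ∂pathLaw Q x₀ ≤ ∑' k, meanStay Q x₀ k := by
  classical
  have := isProbabilityMeasure_expMeasure one_pos
  simp_rw [← lintegral_stay]
  rw [← lintegral_tsum fun k => (measurable_stay Q x₀ k).aemeasurable]
  refine lintegral_mono_ae ?_
  have h' : ∀ᵐ ω ∂pathLaw Q x₀, ∃ n, 1 ≤ n ∧ ω.1 n = x₀ :=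
    Measure.quasiMeasurePreserving_fst.ae h
  filter_upwards [h'] with ω hω
  refine (iInf₂_le (Nat.find hω) (Nat.find_spec hω)).trans ?_
  rw [jumpTime]
  refine le_trans (Finset.sum_le_sum fun k hk => ?_) (ENNReal.sum_le_tsum _)
  rw [Set.indicator_of_mem, ENNReal.div_eq_inv_mul]
  intro j h1 h2 hj
  exact Nat.find_min hω (h2.trans_lt (Finset.mem_range.1 hk)) ⟨h1, hj⟩

theorem ae_return_of_tsum_ne_top [MeasurableSingletonClass S] (Q : Kernel S S) (x₀ : S)
    (h : ∑' k, jumpChainLaw Q x₀ (noReturn x₀ k) ≠ ∞) :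
    ∀ᵐ y ∂jumpChainLaw Q x₀, ∃ n, 1 ≤ n ∧ y n = x₀ := by
  have h0 := ENNReal.tendsto_atTop_zero_of_tsum_ne_top h
  rw [ae_iff]
  refine le_antisymm (ge_of_tendsto' h0 fun k => measure_mono fun y hy => ?_) zero_le
  intro j h1 h2 hj
  exact hy ⟨j, h1, hj⟩

/-- A drift criterion for positive recurrence: on a closed set of states with bounded exit rates,
the function `V` has drift at most `-1` except in `x₀`. -/
theorem positiveRecurrent_of_drift [MeasurableSingletonClass S] (Q : Kernel S S) (x₀ : S)
    {R : Set S} (hR : MeasurableSet R) (hx₀ : x₀ ∈ R) (hclosed : ∀ x ∈ R, Q x Rᶜ = 0)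
    {r : ℝ≥0∞} (hr : r ≠ ∞) (hle : ∀ x ∈ R, exitRate Q x ≤ r) (hne : ∀ x ∈ R, exitRate Q x ≠ 0)
    {V : S → ℝ≥0∞} (hV : Measurable V) (hV₀ : ∫⁻ y, V y ∂Q x₀ ≠ ∞)
    (hdrift : ∀ x ∈ R, x ≠ x₀ → ∫⁻ y, V y ∂Q x + 1 ≤ exitRate Q x * V x) :
    PositiveRecurrent Q x₀ := by
  have htop : ∀ x ∈ R, exitRate Q x ≠ ∞ := fun x hx => ne_top_of_le_ne_top hr (hle x hx)
  have hmap : ∀ {g : S → ℝ≥0∞}, Measurable g → ∫⁻ y, g (y 0) ∂jumpChainLaw Q x₀ = g x₀ := by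
    intro g hg
    rw [← lintegral_map (f := g) (g := fun y : ℕ → S => y 0) hg (by fun_prop),
      jumpChainLaw_map_zero, lintegral_dirac' _ hg]
  have hRm : ∀ k, Measurable fun y : ℕ → S => Rᶜ.indicator (1 : S → ℝ≥0∞) (y k) := fun k =>
    (measurable_one.indicator hR.compl).comp (measurable_pi_apply k)
  have hmem : ∀ k, ∀ᵐ y ∂jumpChainLaw Q x₀, y k ∈ R := by
    intro k
    induction k with
    | zero =>
      have := hmap (g := Rᶜ.indicator 1) (measurable_one.indicator hR.compl)
      rw [Set.indicator_of_notMem (by simpa using hx₀), lintegral_eq_zero_iff (hRm 0)] at this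
      filter_upwards [this] with y hy
      by_contra hc
      rw [Pi.zero_apply, Set.indicator_of_mem (by simpa using hc)] at hy
      exact one_ne_zero hy
    | succ k ih =>
      have hm : Measurable fun p : (Finset.Iic k → S) × S => Rᶜ.indicator (1 : S → ℝ≥0∞) p.2 :=
        (measurable_one.indicator hR.compl).comp measurable_snd
      have h := lintegral_jumpChainLaw_succ Q x₀ k hm
      have h2 : ∫⁻ y, ∫⁻ s, Rᶜ.indicator (1 : S → ℝ≥0∞) s ∂jumpKernel Q (y k)
          ∂jumpChainLaw Q x₀ = ∫⁻ y, 0 ∂jumpChainLaw Q x₀ := by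
        refine lintegral_congr_ae ?_
        filter_upwards [ih] with y hy
        rw [lintegral_jumpKernel Q (hne _ hy) (htop _ hy), lintegral_indicator_one hR.compl,
          hclosed _ hy, mul_zero]
      simp only at h
      rw [h2, lintegral_zero, lintegral_eq_zero_iff (hRm (k + 1))] at h
      filter_upwards [h] with y hy
      by_contra hc
      rw [Pi.zero_apply, Set.indicator_of_mem (by simpa using hc)] at hy
      exact one_ne_zero hy
  let v : ℕ → ℝ≥0∞ := fun k => ∫⁻ y in noReturn x₀ k, V (y k) ∂jumpChainLaw Q x₀
  have hPm : Measurable fun x => ∫⁻ s, V s ∂jumpKernel Q x := hV.lintegral_kernel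
  have hPm' : ∀ k, Measurable fun y : ℕ → S => ∫⁻ s, V s ∂jumpKernel Q (y k) := fun k =>
    hPm.comp (measurable_pi_apply k)
  have hle_succ : ∀ k, v (k + 1) ≤
      ∫⁻ y in noReturn x₀ k, ∫⁻ s, V s ∂jumpKernel Q (y k) ∂jumpChainLaw Q x₀ := by
    intro k
    have h := lintegral_noReturn_succ Q x₀ k (G := fun p => V p.2) (by fun_prop)
    rw [← h]
    exact lintegral_mono_set (noReturn_anti x₀ (Nat.le_succ k))
  have hq := measurable_exitRate Q
  have hQk : ∀ k, Measurable fun y : ℕ → S => (exitRate Q (y k))⁻¹ := fun k =>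
    hq.inv.comp (measurable_pi_apply k)
  -- The drift bound divided by the exit rate: one step of the chain killed at its return lowers the
  -- mean of `V` by at least the mean holding time. The index starts at 1 because the drift bound is
  -- not available in `x₀`.
  have hstep : ∀ k, v (k + 2) + meanStay Q x₀ (k + 1) ≤ v (k + 1) := by
    intro k
    refine (add_le_add_left (hle_succ (k + 1)) _).trans ?_
    rw [meanStay, ← lintegral_add_left (hPm' (k + 1))]
    refine setLIntegral_mono_ae (hV.comp (measurable_pi_apply _)).aemeasurable ?_
    filter_upwards [hmem (k + 1)] with y hy hy'
    have hyne : y (k + 1) ≠ x₀ := hy' (k + 1) (by omega) le_rfl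
    rw [lintegral_jumpKernel Q (hne _ hy) (htop _ hy)]
    calc _ = (exitRate Q (y (k + 1)))⁻¹ * (∫⁻ s, V s ∂Q (y (k + 1)) + 1) := by ring
      _ ≤ (exitRate Q (y (k + 1)))⁻¹ * (exitRate Q (y (k + 1)) * V (y (k + 1))) := by
        gcongr; exact hdrift _ hy hyne
      _ = _ := by rw [← mul_assoc, ENNReal.inv_mul_cancel (hne _ hy) (htop _ hy), one_mul]
  have hv1 : v 1 ≠ ∞ := by
    refine ne_top_of_le_ne_top ?_ (hle_succ 0)
    rw [noReturn_zero, Measure.restrict_univ, hmap hPm,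
      lintegral_jumpKernel Q (hne _ hx₀) (htop _ hx₀)]
    exact ENNReal.mul_ne_top (ENNReal.inv_ne_top.2 (hne _ hx₀)) hV₀
  have hsum : ∀ n, v (n + 1) + ∑ k ∈ Finset.range n, meanStay Q x₀ (k + 1) ≤ v 1 := by
    intro n
    induction n with
    | zero => simp
    | succ n ih =>
      rw [Finset.sum_range_succ, add_comm (∑ k ∈ _, _), ← add_assoc]
      exact (add_le_add_left (hstep n) _).trans ih
  have h0 : meanStay Q x₀ 0 = (exitRate Q x₀)⁻¹ := by
    rw [meanStay, noReturn_zero, Measure.restrict_univ]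
    exact hmap hq.inv
  have htot : ∑' k, meanStay Q x₀ k ≠ ∞ := by
    rw [tsum_eq_zero_add' ENNReal.summable, h0]
    refine ENNReal.add_ne_top.2 ⟨ENNReal.inv_ne_top.2 (hne _ hx₀), ne_top_of_le_ne_top hv1 ?_⟩
    refine ENNReal.tsum_le_of_sum_range_le fun n => le_trans ?_ (hsum n)
    exact le_add_self
  -- Exit rates are at most r, so each jump takes mean time at least 1/r. A finite total time thus
  -- means a finite mean number of jumps before the return, and the return is almost sure.
  have hret : ∑' k, jumpChainLaw Q x₀ (noReturn x₀ k) ≠ ∞ := by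
    refine ne_top_of_le_ne_top (ENNReal.mul_ne_top hr htot) ?_
    rw [← ENNReal.tsum_mul_left]
    refine ENNReal.tsum_le_tsum fun k => ?_
    have hr0 : r ≠ 0 := fun h => hne _ hx₀ (le_antisymm (h ▸ hle _ hx₀) zero_le)
    rw [meanStay, ← lintegral_const_mul _ (hQk k), ← setLIntegral_one]
    refine setLIntegral_mono_ae ((hQk k).const_mul _).aemeasurable ?_
    filter_upwards [hmem k] with y hy _
    rw [← ENNReal.mul_inv_cancel hr0 hr]
    gcongr
    exact hle _ hy
  exact (lintegral_returnTime_le Q x₀ (ae_return_of_tsum_ne_top Q x₀ hret)).trans_lt htot.lt_top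

/-- A criterion against positive recurrence: the function `W` has nonnegative drift except in
`x₀`, and it is dominated by a function whose mean upward displacement rate is bounded. -/
theorem not_positiveRecurrent_of_drift [MeasurableSingletonClass S] (Q : Kernel S S) (x₀ : S)
    (htop : ∀ x, exitRate Q x ≠ ∞) (hne : ∀ x, exitRate Q x ≠ 0)
    {W : S → ℝ≥0∞} (hW : Measurable W) {n : S → ℕ} (hn : Measurable n) (hWn : ∀ x, W x ≤ n x)
    (hn₀ : n x₀ = 0) (hW₀ : ∫⁻ y, W y ∂Q x₀ ≠ 0)
    (hdrift : ∀ x, x ≠ x₀ → exitRate Q x * W x ≤ ∫⁻ y, W y ∂Q x)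
    {b : ℝ≥0∞} (hb : b ≠ ∞) (hup : ∀ x, ∫⁻ y, ((n y - n x : ℕ) : ℝ≥0∞) ∂Q x ≤ b) :
    ¬ PositiveRecurrent Q x₀ := by
  intro hpr
  have hsum : ∑' k, meanStay Q x₀ k ≠ ∞ :=
    ne_top_of_le_ne_top hpr.ne (tsum_meanStay_le Q x₀)
  -- Without a return the infimum defining the return time is over the empty set and equals ∞, so an
  -- integrable return time leaves such paths null.
  have hret : ∀ᵐ y ∂jumpChainLaw Q x₀, ∃ k, 1 ≤ k ∧ y k = x₀ := by
    have := isProbabilityMeasure_expMeasure one_pos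
    have hN : MeasurableSet (⋂ k, noReturn x₀ k) :=
      MeasurableSet.iInter fun k => measurableSet_noReturn x₀ k
    have h1 : ∞ * pathLaw Q x₀ (Prod.fst ⁻¹' (⋂ k, noReturn x₀ k)) ≤
        ∫⁻ ω, returnTime Q x₀ ω ∂pathLaw Q x₀ := by
      rw [← lintegral_indicator_const (measurable_fst hN)]
      refine lintegral_mono fun ω => ?_
      by_cases hω : ω ∈ Prod.fst ⁻¹' (⋂ k, noReturn x₀ k)
      · refine le_iInf₂ fun m hm => ?_
        exact absurd hm.2 (Set.mem_iInter.1 hω m m hm.1 le_rfl)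
      · rw [Set.indicator_of_notMem hω]
        exact zero_le
    have h2 : pathLaw Q x₀ (Prod.fst ⁻¹' (⋂ k, noReturn x₀ k)) = 0 := by
      by_contra hc
      rw [ENNReal.top_mul hc] at h1
      exact hpr.ne (top_le_iff.1 h1)
    rw [← Set.prod_univ, pathLaw, Measure.prod_prod, measure_univ, mul_one] at h2
    rw [ae_iff]
    refine measure_mono_null (fun y hy => ?_) h2
    exact Set.mem_iInter.2 fun k j h1 _ h3 => hy ⟨j, h1, h3⟩
  have hWx₀ : W x₀ = 0 := le_antisymm (by simpa [hn₀] using hWn x₀) zero_le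
  have hmap : ∀ {g : S → ℝ≥0∞}, Measurable g → ∫⁻ y, g (y 0) ∂jumpChainLaw Q x₀ = g x₀ := by
    intro g hg
    rw [← lintegral_map (f := g) (g := fun y : ℕ → S => y 0) hg (by fun_prop),
      jumpChainLaw_map_zero, lintegral_dirac' _ hg]
  have hnn : Measurable fun p : S × S => ((n p.2 - n p.1 : ℕ) : ℝ≥0∞) :=
    (measurable_of_countable (fun q : ℕ × ℕ => ((q.2 - q.1 : ℕ) : ℝ≥0∞))).comp
      ((hn.comp measurable_fst).prodMk (hn.comp measurable_snd))
  have hnny : ∀ k, Measurable fun y : ℕ → S => ((n (y (k + 1)) - n (y k) : ℕ) : ℝ≥0∞) := fun k =>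
    hnn.comp (g := fun p : S × S => ((n p.2 - n p.1 : ℕ) : ℝ≥0∞))
      (f := fun y : ℕ → S => (y k, y (k + 1)))
      ((measurable_pi_apply k).prodMk (measurable_pi_apply (k + 1)))
  let w : ℕ → ℝ≥0∞ := fun k => ∫⁻ y in noReturn x₀ k, W (y k) ∂jumpChainLaw Q x₀
  -- An equality: the paths killed at this step sit in `x₀`, where `W` vanishes. Together with the
  -- nonnegative drift, the killed means of `W` cannot decrease.
  have hsucc : ∀ k, w (k + 1) =
      ∫⁻ y in noReturn x₀ k, ∫⁻ s, W s ∂jumpKernel Q (y k) ∂jumpChainLaw Q x₀ := by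
    intro k
    have h := lintegral_noReturn_succ Q x₀ k (G := fun p => W p.2) (by fun_prop)
    rw [← h]
    simp only [w]
    rw [← lintegral_indicator (measurableSet_noReturn x₀ _),
      ← lintegral_indicator (measurableSet_noReturn x₀ _)]
    congr 1
    ext y
    by_cases h1 : y ∈ noReturn x₀ (k + 1)
    · rw [Set.indicator_of_mem h1, Set.indicator_of_mem (noReturn_anti x₀ (Nat.le_succ k) h1)]
    · rw [Set.indicator_of_notMem h1]
      by_cases h2 : y ∈ noReturn x₀ k
      · rw [Set.indicator_of_mem h2]
        have : y (k + 1) = x₀ := by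
          by_contra hc
          refine h1 fun j hj1 hj2 => ?_
          rcases Nat.lt_or_ge k j with hkj | hkj
          · obtain rfl : j = k + 1 := by omega
            exact hc
          · exact h2 j hj1 hkj
        rw [this, hWx₀]
      · rw [Set.indicator_of_notMem h2]
  have hmono : ∀ k, w 1 ≤ w (k + 1) := by
    intro k
    induction k with
    | zero => exact le_rfl
    | succ k ih =>
      refine ih.trans ?_
      rw [hsucc (k + 1)]
      refine setLIntegral_mono' (measurableSet_noReturn x₀ _) fun y hy => ?_
      have hyne : y (k + 1) ≠ x₀ := hy (k + 1) (by omega) le_rfl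
      rw [lintegral_jumpKernel Q (hne _) (htop _)]
      calc W (y (k + 1)) = (exitRate Q (y (k + 1)))⁻¹ * (exitRate Q (y (k + 1)) * W (y (k + 1))) := by
            rw [← mul_assoc, ENNReal.inv_mul_cancel (hne _) (htop _), one_mul]
        _ ≤ _ := by gcongr; exact hdrift _ hyne
  have hw1 : w 1 ≠ 0 := by
    rw [hsucc 0, noReturn_zero, Measure.restrict_univ, hmap hW.lintegral_kernel,
      lintegral_jumpKernel Q (hne _) (htop _)]
    exact mul_ne_zero (ENNReal.inv_ne_zero.2 (htop _)) hW₀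
  -- The sum of all upward moves of `n` before the return dominates `W` along the killed path. Its
  -- mean is at most b times the sum of the mean stays, hence finite.
  let G : (ℕ → S) → ℝ≥0∞ := fun y => n (y 0) +
    ∑' k, (noReturn x₀ k).indicator (fun y => ((n (y (k + 1)) - n (y k) : ℕ) : ℝ≥0∞)) y
  have hGk : ∀ k, Measurable
      ((noReturn x₀ k).indicator fun y : ℕ → S => ((n (y (k + 1)) - n (y k) : ℕ) : ℝ≥0∞)) :=
    fun k => (hnny k).indicator (measurableSet_noReturn x₀ k)
  have hn' : Measurable fun x => (n x : ℝ≥0∞) := (measurable_of_countable _).comp hn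
  have hGint : ∫⁻ y, G y ∂jumpChainLaw Q x₀ ≠ ∞ := by
    simp only [G]
    have hn0 : Measurable fun y : ℕ → S => (n (y 0) : ℝ≥0∞) := hn'.comp (measurable_pi_apply 0)
    rw [lintegral_add_left hn0, hmap hn', hn₀,
      lintegral_tsum fun k => (hGk k).aemeasurable]
    refine ENNReal.add_ne_top.2 ⟨by simp, ne_top_of_le_ne_top (ENNReal.mul_ne_top hb hsum) ?_⟩
    rw [← ENNReal.tsum_mul_left]
    refine ENNReal.tsum_le_tsum fun k => ?_
    rw [lintegral_indicator (measurableSet_noReturn x₀ k), lintegral_noReturn_succ Q x₀ k hnn,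
      meanStay, ← lintegral_const_mul' _ _ hb]
    refine lintegral_mono fun y => ?_
    simp only
    rw [lintegral_jumpKernel Q (hne _) (htop _), mul_comm]
    gcongr
    exact hup _
  have hle : ∀ k y, (noReturn x₀ k).indicator (fun y => W (y k)) y ≤ G y := by
    intro k y
    by_cases hy : y ∈ noReturn x₀ k
    · rw [Set.indicator_of_mem hy]
      refine (hWn _).trans ?_
      have h1 : n (y k) ≤ n (y 0) + ∑ j ∈ Finset.range k, (n (y (j + 1)) - n (y j)) := by
        clear hy
        induction k with
        | zero => simp
        | succ k ih => rw [Finset.sum_range_succ]; omega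
      have h2 : (n (y k) : ℝ≥0∞) ≤
          n (y 0) + ∑ j ∈ Finset.range k, ((n (y (j + 1)) - n (y j) : ℕ) : ℝ≥0∞) := by
        exact_mod_cast h1
      refine h2.trans (add_le_add le_rfl (le_trans (Finset.sum_le_sum fun j hj => ?_)
        (ENNReal.sum_le_tsum (Finset.range k))))
      rw [Set.indicator_of_mem (noReturn_anti x₀ (Finset.mem_range.1 hj).le hy)]
    · rw [Set.indicator_of_notMem hy]
      exact zero_le
  -- Almost every path is eventually killed, so dominated convergence sends the means to 0, against
  -- their monotonicity and `hw1`.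
  have hlim : Filter.Tendsto w Filter.atTop (nhds 0) := by
    have hWm : ∀ k, Measurable fun y : ℕ → S => W (y k) := fun k =>
      hW.comp (measurable_pi_apply k)
    have := tendsto_lintegral_of_dominated_convergence (μ := jumpChainLaw Q x₀)
      (F := fun k => (noReturn x₀ k).indicator fun y => W (y k)) (f := fun _ => 0) G
      (fun k => (hWm k).indicator (measurableSet_noReturn x₀ k))
      (fun k => Filter.Eventually.of_forall (hle k)) hGint ?_
    · simpa [lintegral_indicator (measurableSet_noReturn x₀ _)] using this
    · filter_upwards [hret] with y ⟨m, hm1, hm2⟩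
      refine tendsto_const_nhds.congr' ?_
      filter_upwards [Filter.eventually_ge_atTop m] with k hk
      rw [Set.indicator_of_notMem]
      exact fun h => h m hm1 hk hm2
  refine hw1 (le_antisymm (ge_of_tendsto hlim ?_) zero_le)
  filter_upwards [Filter.eventually_ge_atTop 1] with k hk
  obtain ⟨j, rfl⟩ := Nat.exists_eq_add_of_le' hk
  exact hmono j

/-- A drift criterion for positive recurrence: `L` has drift at most `-δ N + C`, and from each state
other than `x₀` the process moves at rate at least `κ` to states with a smaller distance `D`, which
is bounded in terms of `N`. -/
theorem positiveRecurrent_of_lyapunov [MeasurableSingletonClass S] (Q : Kernel S S) (x₀ : S)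
    {R : Set S} (hR : MeasurableSet R) (hx₀ : x₀ ∈ R) (hclosed : ∀ x ∈ R, Q x Rᶜ = 0)
    {r : ℝ} (hr : 0 < r) (hle : ∀ x ∈ R, exitRate Q x ≤ ENNReal.ofReal r)
    (hne : ∀ x ∈ R, exitRate Q x ≠ 0)
    {L : S → ℝ} (hL : Measurable L) (N D : S → ℕ) (hD : Measurable D)
    {δ C κ : ℝ} (hδ : 0 < δ) (hC : 0 ≤ C) (hκ : 0 < κ) {a b : ℕ} (hDN : ∀ x ∈ R, D x ≤ a * N x + b)
    (hdrift : ∀ x ∈ R, ∫⁻ y, ENNReal.ofReal (L y) ∂Q x + ENNReal.ofReal (δ * N x) ≤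
      exitRate Q x * ENNReal.ofReal (L x) + ENNReal.ofReal C)
    (hstep : ∀ x ∈ R, x ≠ x₀ → ENNReal.ofReal κ ≤ Q x {y | D y < D x}) :
    PositiveRecurrent Q x₀ := by
  have htop : ∀ x ∈ R, exitRate Q x ≠ ∞ := fun x hx =>
    ne_top_of_le_ne_top ENNReal.ofReal_ne_top (hle x hx)
  -- From distance m + 1, a step down lowers g by at least θ^m, and any step up raises it by at most
  -- the whole remaining tail θ^m · θ/(1 - θ). The choice of θ makes upward moves at total rate r
  -- consume at most half of the gain κ θ^m.
  obtain ⟨θ, hθ0, hθ1, hθr⟩ : ∃ θ : ℝ, 0 < θ ∧ θ < 1 ∧ r * (θ / (1 - θ)) = κ / 2 := by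
    refine ⟨κ / (κ + 2 * r), by positivity, (div_lt_one (by positivity)).2 (by linarith), ?_⟩
    have h1 : 1 - κ / (κ + 2 * r) = 2 * r / (κ + 2 * r) := by field_simp; ring
    rw [h1]
    field_simp
  have h1θ : 0 < 1 - θ := by linarith
  let g : ℕ → ℝ := fun m => (1 - θ ^ m) / (1 - θ)
  have hgnn : ∀ m, 0 ≤ g m := fun m =>
    div_nonneg (sub_nonneg.2 (pow_le_one₀ hθ0.le hθ1.le)) h1θ.le
  have hgtop : ∀ m, g m ≤ 1 / (1 - θ) := fun m => by
    have : 0 ≤ θ ^ m := by positivity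
    simp only [g]; gcongr; linarith
  have hgm : Measurable fun x => g (D x) := (measurable_of_countable g).comp hD
  -- the displacement of `g` from a state with distance `m + 1`
  have hgdisp : ∀ m l : ℕ, g l ≤ g (m + 1) + θ ^ m * (θ / (1 - θ)) := fun m l => by
    refine (hgtop l).trans_eq ?_
    simp only [g]; field_simp; ring
  have hgdown : ∀ m l : ℕ, l < m + 1 → g l + θ ^ m ≤ g (m + 1) := fun m l hl => by
    have : θ ^ m ≤ θ ^ l := pow_le_pow_of_le_one hθ0.le hθ1.le (by omega)
    have h2 : g l = (1 - θ ^ l) / (1 - θ) := rfl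
    have h3 : g (m + 1) = (1 - θ ^ m) / (1 - θ) + θ ^ m := by
      simp only [g]; field_simp; ring
    rw [h2, h3]
    gcongr
  have hgdrift : ∀ x ∈ R, x ≠ x₀ → ∃ m, D x = m + 1 ∧
      ∫⁻ y, ENNReal.ofReal (g (D y)) ∂Q x + ENNReal.ofReal (θ ^ m * (κ / 2)) ≤
        exitRate Q x * ENNReal.ofReal (g (D x)) := by
    intro x hx hxne
    have hpos : D x ≠ 0 := by
      intro h0
      have := hstep x hx hxne
      simp only [h0, Nat.not_lt_zero, Set.ofPred_false, measure_empty, nonpos_iff_eq_zero,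
        ENNReal.ofReal_eq_zero] at this
      linarith
    obtain ⟨m, hm⟩ := Nat.exists_eq_succ_of_ne_zero hpos
    refine ⟨m, hm, ?_⟩
    have hmeas : MeasurableSet {y | D y < D x} := measurableSet_lt hD measurable_const
    have hpt : ∀ y, ENNReal.ofReal (g (D y)) +
        {y | D y < D x}.indicator (fun _ => ENNReal.ofReal (θ ^ m)) y ≤
          ENNReal.ofReal (g (D x) + θ ^ m * (θ / (1 - θ))) := by
      intro y
      by_cases hy : D y < D x
      · rw [Set.indicator_of_mem (show y ∈ {y | D y < D x} from hy),
          ← ENNReal.ofReal_add (hgnn _) (by positivity)]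
        refine ENNReal.ofReal_le_ofReal ?_
        rw [hm] at hy ⊢
        refine (hgdown m _ hy).trans (le_add_of_nonneg_right ?_)
        positivity
      · rw [Set.indicator_of_notMem (show y ∉ {y | D y < D x} from hy), add_zero, hm]
        exact ENNReal.ofReal_le_ofReal (hgdisp m _)
    have hint := lintegral_mono (μ := Q x) hpt
    rw [lintegral_add_left hgm.ennreal_ofReal, lintegral_indicator_const hmeas, lintegral_const,
      ENNReal.ofReal_add (hgnn _) (by positivity), add_mul] at hint
    have hκ2 : ENNReal.ofReal (θ ^ m * κ) ≤ ENNReal.ofReal (θ ^ m) * Q x {y | D y < D x} := by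
      rw [ENNReal.ofReal_mul (by positivity)]
      gcongr
      exact hstep x hx hxne
    have hr2 : ENNReal.ofReal (θ ^ m * (θ / (1 - θ))) * Q x Set.univ ≤
        ENNReal.ofReal (θ ^ m * (κ / 2)) := by
      refine (mul_le_mul_right (hle x hx) _).trans ?_
      rw [← ENNReal.ofReal_mul (by positivity)]
      refine ENNReal.ofReal_le_ofReal (le_of_eq ?_)
      rw [← hθr]; ring
    have hsplit : ENNReal.ofReal (θ ^ m * κ) =
        ENNReal.ofReal (θ ^ m * (κ / 2)) + ENNReal.ofReal (θ ^ m * (κ / 2)) := by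
      rw [← ENNReal.ofReal_add (by positivity) (by positivity)]
      congr 1; ring
    have hfin : ENNReal.ofReal (θ ^ m * (κ / 2)) ≠ ∞ := ENNReal.ofReal_ne_top
    rw [← ENNReal.add_le_add_iff_right hfin, add_assoc, ← hsplit]
    calc _ ≤ _ := add_le_add_right hκ2 _
      _ ≤ _ := hint
      _ ≤ _ := by
        rw [mul_comm (exitRate Q x)]
        exact add_le_add_right hr2 _
  -- If N ≥ B, the term -δN beats C + 1 by itself. If N < B, the distance is at most E = aB + b, and
  -- A is chosen so that A times the smallest drift of g on that range, θ^E κ/2, equals C + 1.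
  obtain ⟨B, hB⟩ := exists_nat_gt ((C + 1) / δ)
  let E : ℕ := a * B + b
  let A : ℝ := (C + 1) / (θ ^ E * (κ / 2))
  have hA : 0 < A := by positivity
  refine positiveRecurrent_of_drift Q x₀ hR hx₀ hclosed ENNReal.ofReal_ne_top hle hne
    (V := fun x => ENNReal.ofReal (L x) + ENNReal.ofReal A * ENNReal.ofReal (g (D x)))
    (hL.ennreal_ofReal.add (hgm.ennreal_ofReal.const_mul _)) ?_ ?_
  · rw [lintegral_add_left hL.ennreal_ofReal, lintegral_const_mul _ hgm.ennreal_ofReal]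
    refine ENNReal.add_ne_top.2 ⟨?_, ENNReal.mul_ne_top ENNReal.ofReal_ne_top ?_⟩
    · refine ne_top_of_le_ne_top ?_ (le_self_add.trans (hdrift x₀ hx₀))
      exact ENNReal.add_ne_top.2 ⟨ENNReal.mul_ne_top (htop _ hx₀) ENNReal.ofReal_ne_top,
        ENNReal.ofReal_ne_top⟩
    · refine ne_top_of_le_ne_top ?_ (lintegral_mono fun y => ENNReal.ofReal_le_ofReal (hgtop (D y)))
      rw [lintegral_const]
      exact ENNReal.mul_ne_top ENNReal.ofReal_ne_top (htop _ hx₀)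
  · intro x hx hxne
    obtain ⟨m, hm, hg⟩ := hgdrift x hx hxne
    rw [lintegral_add_left hL.ennreal_ofReal, lintegral_const_mul _ hgm.ennreal_ofReal]
    have hC1 : ENNReal.ofReal C + 1 = ENNReal.ofReal (C + 1) := by
      rw [ENNReal.ofReal_add hC zero_le_one, ENNReal.ofReal_one]
    have hkey : ENNReal.ofReal (C + 1) ≤ ENNReal.ofReal (δ * N x) +
        ENNReal.ofReal A * ENNReal.ofReal (θ ^ m * (κ / 2)) := by
      rw [← ENNReal.ofReal_mul hA.le, ← ENNReal.ofReal_add (by positivity) (by positivity)]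
      refine ENNReal.ofReal_le_ofReal ?_
      rcases le_or_gt (B : ℕ) (N x) with hNB | hNB
      · have h1 : (C + 1) / δ < N x := hB.trans_le (by exact_mod_cast hNB)
        have h2 : C + 1 < δ * N x := by rwa [div_lt_iff₀' hδ] at h1
        have : 0 ≤ A * (θ ^ m * (κ / 2)) := by positivity
        linarith
      · have hmE : m ≤ E := by
          have h1 := hDN x hx
          have h2 : a * N x ≤ a * B := Nat.mul_le_mul_left a hNB.le
          simp only [E]; omega
        have h1 : θ ^ E * (κ / 2) ≤ θ ^ m * (κ / 2) := by
          gcongr ?_ * _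
          exact pow_le_pow_of_le_one hθ0.le hθ1.le hmE
        have h2 : A * (θ ^ E * (κ / 2)) = C + 1 := div_mul_cancel₀ _ (by positivity)
        have h3 := mul_le_mul_of_nonneg_left h1 hA.le
        have : 0 ≤ δ * N x := by positivity
        linarith
    rw [← ENNReal.add_le_add_iff_right (ENNReal.ofReal_ne_top (r := C))]
    calc _ = ∫⁻ y, ENNReal.ofReal (L y) ∂Q x +
          ENNReal.ofReal A * ∫⁻ y, ENNReal.ofReal (g (D y)) ∂Q x + ENNReal.ofReal (C + 1) := by
            rw [← hC1]; ring
      _ ≤ ∫⁻ y, ENNReal.ofReal (L y) ∂Q x + ENNReal.ofReal A *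
            ∫⁻ y, ENNReal.ofReal (g (D y)) ∂Q x + (ENNReal.ofReal (δ * N x) +
              ENNReal.ofReal A * ENNReal.ofReal (θ ^ m * (κ / 2))) := by gcongr
      _ = (∫⁻ y, ENNReal.ofReal (L y) ∂Q x + ENNReal.ofReal (δ * N x)) + ENNReal.ofReal A *
            (∫⁻ y, ENNReal.ofReal (g (D y)) ∂Q x + ENNReal.ofReal (θ ^ m * (κ / 2))) := by ring
      _ ≤ (exitRate Q x * ENNReal.ofReal (L x) + ENNReal.ofReal C) + ENNReal.ofReal A *
            (exitRate Q x * ENNReal.ofReal (g (D x))) := by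
        exact add_le_add (hdrift x hx) (mul_le_mul_right hg _)
      _ = _ := by ring

end JumpProcess

/-! ### Job types, 2-Job options and the capacity condition -/

section Types

variable {d : ℕ}

theorem mem_jobTypes {K : Fin d → ℕ} {i : JobType d} :
    i ∈ jobTypes K ↔ ∀ l, 1 ≤ i l ∧ i l ≤ K l := by
  simp only [jobTypes, Finset.mem_Icc, Pi.le_def, Pi.one_apply, forall_and]

theorem typeOf_mem_jobTypes {K : Fin d → ℕ} (hK : ∀ l, 1 ≤ K l) (v : Req d) :
    typeOf K v ∈ jobTypes K := by
  refine mem_jobTypes.2 fun l => ?_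
  have hv := v.2 l (Set.mem_univ l)
  have hKl : (1 : ℝ) ≤ K l := by exact_mod_cast hK l
  constructor
  · exact Nat.one_le_iff_ne_zero.2 (Nat.ceil_pos.2 (by have := hv.1; positivity)).ne'
  · refine Nat.ceil_le.2 ?_
    have := hv.2
    nlinarith

/-- The probability of the type `i`. -/
def typeProb (μ : Measure (Req d)) (K : Fin d → ℕ) (i : JobType d) : ℝ :=
  μ.real {v | typeOf K v = i}

theorem typeProb_nonneg (μ : Measure (Req d)) (K : Fin d → ℕ) (i : JobType d) :
    0 ≤ typeProb μ K i := measureReal_nonneg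

theorem measurableSet_typeOf_eq (K : Fin d → ℕ) (i : JobType d) :
    MeasurableSet {v | typeOf K v = i} :=
  measurable_typeOf K (measurableSet_singleton i)

theorem lintegral_typeOf (μ : Measure (Req d)) [IsProbabilityMeasure μ] {K : Fin d → ℕ}
    (hK : ∀ l, 1 ≤ K l) (G : JobType d → ℝ) (hG : ∀ i ∈ jobTypes K, 0 ≤ G i) :
    ∫⁻ v, ENNReal.ofReal (G (typeOf K v)) ∂μ =
      ENNReal.ofReal (∑ i ∈ jobTypes K, typeProb μ K i * G i) := by
  have h1 : ∀ v, ENNReal.ofReal (G (typeOf K v)) = ∑ i ∈ jobTypes K,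
      {v | typeOf K v = i}.indicator (fun _ => ENNReal.ofReal (G i)) v := by
    intro v
    rw [Finset.sum_eq_single (typeOf K v)]
    · rw [Set.indicator_of_mem (by simp)]
    · intro i _ hi
      rw [Set.indicator_of_notMem]
      exact fun h => hi h.symm
    · intro h
      exact absurd (typeOf_mem_jobTypes hK v) h
  simp_rw [h1]
  rw [lintegral_finsetSum _ fun i _ => measurable_const.indicator (measurableSet_typeOf_eq K i),
    ENNReal.ofReal_sum_of_nonneg fun i hi => mul_nonneg (typeProb_nonneg μ K i) (hG i hi)]
  refine Finset.sum_congr rfl fun i hi => ?_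
  rw [lintegral_indicator_const (measurableSet_typeOf_eq K i),
    ENNReal.ofReal_mul (typeProb_nonneg μ K i), typeProb, ofReal_measureReal, mul_comm]

theorem sum_typeProb (μ : Measure (Req d)) [IsProbabilityMeasure μ] {K : Fin d → ℕ}
    (hK : ∀ l, 1 ≤ K l) : ∑ i ∈ jobTypes K, typeProb μ K i = 1 := by
  have h := lintegral_typeOf μ hK (fun _ => 1) (fun _ _ => zero_le_one)
  simp only [ENNReal.ofReal_one, lintegral_const, measure_univ, mul_one] at h
  exact (ENNReal.ofReal_eq_one.1 h.symm)

open Classical in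
/-- The option of the 2-Job efficient set which is determined by the type `j`. -/
def twoJobOption (K : Fin d → ℕ) (j : JobType d) : ServiceOption d :=
  if ∃ l, j l = K l then {j} else {j, K - j}

theorem twoJobSet_eq_image (K : Fin d → ℕ) :
    twoJobSet K = twoJobOption K '' (jobTypes K : Set (JobType d)) := by
  ext M
  simp only [twoJobSet, Set.mem_union, Set.mem_image, Finset.mem_coe]
  constructor
  · rintro (⟨j, hj, hl, rfl⟩ | ⟨j, hj, hl, rfl⟩)
    · exact ⟨j, hj, if_pos hl⟩
    · exact ⟨j, hj, if_neg (by simpa using hl)⟩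
  · rintro ⟨j, hj, rfl⟩
    by_cases hl : ∃ l, j l = K l
    · exact Or.inl ⟨j, hj, hl, if_pos hl⟩
    · exact Or.inr ⟨j, hj, by simpa using hl, if_neg hl⟩

theorem twoJobOption_mem {K : Fin d → ℕ} {j : JobType d} (hj : j ∈ jobTypes K) :
    twoJobOption K j ∈ twoJobSet K := by
  rw [twoJobSet_eq_image]
  exact ⟨j, hj, rfl⟩

theorem mem_twoJobOption (K : Fin d → ℕ) (j : JobType d) : j ∈ twoJobOption K j := by
  unfold twoJobOption
  split_ifs <;> simp

theorem card_twoJobOption_le (K : Fin d → ℕ) (j : JobType d) :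
    (twoJobOption K j).card ≤ 2 := by
  unfold twoJobOption
  split_ifs <;> simp

theorem sub_mem_jobTypes {K : Fin d → ℕ} {j : JobType d} (hj : j ∈ jobTypes K)
    (hb : ¬ ∃ l, j l = K l) : K - j ∈ jobTypes K ∧ ¬ ∃ l, (K - j) l = K l := by
  rw [mem_jobTypes] at hj
  push Not at hb
  constructor
  · refine mem_jobTypes.2 fun l => ?_
    have := hj l
    have := hb l
    simp only [Pi.sub_apply]
    omega
  · rintro ⟨l, hl⟩
    have := hj l
    simp only [Pi.sub_apply] at hl
    omega

theorem sub_sub_of_mem_jobTypes {K : Fin d → ℕ} {j : JobType d} (hj : j ∈ jobTypes K) :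
    K - (K - j) = j := by
  ext l
  have := mem_jobTypes.1 hj l
  simp only [Pi.sub_apply]
  omega

theorem mem_jobTypes_of_mem {K : Fin d → ℕ} {M : ServiceOption d} (hM : M ∈ twoJobSet K)
    {i : JobType d} (hi : i ∈ M) : i ∈ jobTypes K := by
  rw [twoJobSet_eq_image] at hM
  obtain ⟨j, hj, rfl⟩ := hM
  unfold twoJobOption at hi
  split_ifs at hi with hb
  · rwa [Multiset.mem_singleton.1 hi]
  · rcases Multiset.mem_cons.1 hi with rfl | h
    · exact hj
    · rw [Multiset.mem_singleton.1 h]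
      exact (sub_mem_jobTypes hj hb).1

theorem sum_twoJobSet_le {K : Fin d → ℕ} {M : ServiceOption d} (hM : M ∈ twoJobSet K)
    (l : Fin d) : (M.map fun i => i l).sum ≤ K l := by
  rw [twoJobSet_eq_image] at hM
  obtain ⟨j, hj, rfl⟩ := hM
  have := mem_jobTypes.1 hj l
  unfold twoJobOption
  split_ifs with hb
  · simpa using this.2
  · simp
    omega

theorem card_twoJobSet_le {K : Fin d → ℕ} {M : ServiceOption d} (hM : M ∈ twoJobSet K) :
    M.card ≤ 2 := by
  rw [twoJobSet_eq_image] at hM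
  obtain ⟨j, hj, rfl⟩ := hM
  exact card_twoJobOption_le K j

/-- A convex combination of options of the 2-Job efficient set which serves each type `i` at a
rate greater than `a i`. -/
structure Capacity (K : Fin d → ℕ) (a : JobType d → ℝ) where
  w : JobType d → ℝ
  η : ℝ
  w_pos : ∀ j ∈ jobTypes K, 0 < w j
  sum_w : ∑ j ∈ jobTypes K, w j = 1
  η_pos : 0 < η
  le_service : ∀ i ∈ jobTypes K, a i + η ≤ ∑ j ∈ jobTypes K, w j * (twoJobOption K j).count i

-- An interior pair is listed twice, under j and under K - j, so each listing needs only half of the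
-- larger of the two rates; a boundary type needs its full rate. The missing mass up to 1 is spread
-- evenly as η over all types, which also makes every weight positive.
open Classical in
theorem exists_capacity {K : Fin d → ℕ} (hK : ∀ l, 1 ≤ K l) {a : JobType d → ℝ}
    (ha : ∀ i, 0 ≤ a i)
    (hσ : ∑ j ∈ jobTypes K, (if ∃ l, j l = K l then a j else max (a j) (a (K - j)) / 2) < 1) :
    Nonempty (Capacity K a) := by
  set b : JobType d → ℝ := fun j => if ∃ l, j l = K l then a j else max (a j) (a (K - j)) / 2
    with hb
  have hne : (jobTypes K).Nonempty := ⟨K, mem_jobTypes.2 fun l => ⟨hK l, le_rfl⟩⟩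
  have hcard : (0 : ℝ) < (jobTypes K).card := by exact_mod_cast hne.card_pos
  set η : ℝ := (1 - ∑ j ∈ jobTypes K, b j) / (jobTypes K).card with hη
  have hη0 : 0 < η := div_pos (by linarith) hcard
  have hb0 : ∀ j, 0 ≤ b j := by
    intro j
    simp only [hb]
    split_ifs
    · exact ha j
    · have := le_max_of_le_left (c := a (K - j)) (ha j); positivity
  refine ⟨⟨fun j => b j + η, η, fun j _ => by have := hb0 j; linarith, ?_, hη0, ?_⟩⟩
  · rw [Finset.sum_add_distrib, Finset.sum_const, nsmul_eq_mul, hη, mul_div_cancel₀ _ hcard.ne']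
    ring
  · intro i hi
    have hnn : ∀ j ∈ jobTypes K, 0 ≤ (b j + η) * ((twoJobOption K j).count i : ℝ) := fun j _ => by
      have := hb0 j; positivity
    by_cases hbi : ∃ l, i l = K l
    · have h1 : (b i + η) * ((twoJobOption K i).count i : ℝ) = a i + η := by
        simp [b, twoJobOption, hbi]
      rw [← h1]
      exact Finset.single_le_sum hnn hi
    · have h2 : b i = max (a i) (a (K - i)) / 2 := by simp only [hb, if_neg hbi]
      have hm : a i ≤ max (a i) (a (K - i)) := le_max_left _ _
      -- A self-paired type is listed only once, but its option contains it twice.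
      by_cases hself : K - i = i
      · have h1 : (b i + η) * ((twoJobOption K i).count i : ℝ) ≥ a i + η := by
          rw [h2, twoJobOption, if_neg hbi, hself]
          simp
          linarith [le_refl (a i)]
        exact h1.le.trans (Finset.single_le_sum hnn hi)
      · obtain ⟨hm1, hm2⟩ := sub_mem_jobTypes hi hbi
        have h3 : ∑ j ∈ ({i, K - i} : Finset (JobType d)),
            (b j + η) * ((twoJobOption K j).count i : ℝ) ≥ a i + η := by
          rw [Finset.sum_pair (Ne.symm hself)]
          have h4 : b (K - i) = max (a i) (a (K - i)) / 2 := by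
            simp only [hb, if_neg hm2, sub_sub_of_mem_jobTypes hi, max_comm]
          rw [h2, h4, twoJobOption, twoJobOption, if_neg hbi, if_neg hm2,
            sub_sub_of_mem_jobTypes hi]
          simp [Ne.symm hself]
          linarith
        refine h3.le.trans (Finset.sum_le_sum_of_subset_of_nonneg ?_ fun j hj _ => hnn j hj)
        intro j hj
        rcases Finset.mem_insert.1 hj with rfl | hj
        · exact hi
        · rw [Finset.mem_singleton.1 hj]; exact hm1

end Types

/-! ### Cell probabilities under a symmetric Lipschitz density -/

section Density

variable {d : ℕ}

theorem measurableSet_cube (d : ℕ) : MeasurableSet (cube d) :=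
  MeasurableSet.univ_pi fun _ => measurableSet_Ioc

open Classical in
/-- The extension of a density by zero. -/
def extendDensity (f : Req d → ℝ) (v : Fin d → ℝ) : ℝ≥0∞ :=
  if h : v ∈ cube d then ENNReal.ofReal (f ⟨v, h⟩) else 0

theorem extendDensity_of_mem (f : Req d → ℝ) {v : Fin d → ℝ} (h : v ∈ cube d) :
    extendDensity f v = ENNReal.ofReal (f ⟨v, h⟩) := dif_pos h

theorem measurable_extendDensity {f : Req d → ℝ} (hf : Measurable f) :
    Measurable (extendDensity f) := by
  classical
  unfold extendDensity
  exact Measurable.dite hf.ennreal_ofReal measurable_const (measurableSet_cube d)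

theorem lintegral_req {f : Req d → ℝ} {μ : Measure (Req d)} (hf : IsPDF f μ)
    {g : (Fin d → ℝ) → ℝ≥0∞} (hg : Measurable g) :
    ∫⁻ v, g v.1 ∂μ = ∫⁻ v in cube d, extendDensity f v * g v := by
  have hg' : Measurable fun v : Req d => g v.1 := hg.comp measurable_subtype_coe
  rw [hf.2.2, lintegral_withDensity_eq_lintegral_mul _ hf.1.ennreal_ofReal hg', cubeVolume,
    ← lintegral_subtype_comap (measurableSet_cube d)]
  refine lintegral_congr fun v => ?_
  rw [extendDensity_of_mem f v.2]
  rfl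

/-- The open box with corners `a` and `b`. -/
def openBox (a b : Fin d → ℝ) : Set (Fin d → ℝ) := Set.pi Set.univ fun l => Set.Ioo (a l) (b l)

theorem measurableSet_openBox (a b : Fin d → ℝ) : MeasurableSet (openBox a b) :=
  MeasurableSet.univ_pi fun _ => measurableSet_Ioo

/-- Reflection exchanges the open and the closed faces of a half-open box. Passing to open boxes, at
the cost of a null set, makes the family invariant. -/
theorem openBox_ae_eq (a b : Fin d → ℝ) :
    openBox a b =ᵐ[volume] Set.pi Set.univ fun l => Set.Ioc (a l) (b l) :=
  (Measure.univ_pi_Ioo_ae_eq_Icc (μ := fun _ : Fin d => (volume : Measure ℝ))).trans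
    (Measure.univ_pi_Ioc_ae_eq_Icc (μ := fun _ : Fin d => (volume : Measure ℝ))).symm

/-- Reflection of an integral over a box. -/
theorem lintegral_openBox_reflect (a b c : Fin d → ℝ) {g : (Fin d → ℝ) → ℝ≥0∞}
    (hg : Measurable g) :
    ∫⁻ v in openBox (c - b) (c - a), g v = ∫⁻ v in openBox a b, g (c - v) := by
  have h := (Measure.measurePreserving_sub_left (volume : Measure (Fin d → ℝ)) c).setLIntegral_comp_preimage
    (measurableSet_openBox (c - b) (c - a)) hg
  rw [← h]
  congr 2
  ext v
  simp only [openBox, Set.mem_preimage, Set.mem_univ_pi, Pi.sub_apply, Set.mem_Ioo]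
  refine forall_congr' fun l => ?_
  constructor <;> rintro ⟨h1, h2⟩ <;> constructor <;> linarith

theorem extendDensity_reflect {f : Req d → ℝ} (hs : IsCentrallySymmetric f) {v : Fin d → ℝ}
    (hv : v ∈ openBox (0 : Fin d → ℝ) 1) : extendDensity f (1 - v) = extendDensity f v := by
  have h1 : v ∈ cube d := fun l hl => ⟨(hv l hl).1, (hv l hl).2.le⟩
  have h2 : 1 - v ∈ cube d := fun l hl => by
    have := hv l hl
    simp only [Pi.zero_apply, Pi.one_apply, Set.mem_Ioo] at this
    simp only [Pi.sub_apply, Pi.one_apply, Set.mem_Ioc]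
    constructor <;> linarith
  rw [extendDensity_of_mem f h1, extendDensity_of_mem f h2]
  rw [hs ⟨v, h1⟩ ⟨1 - v, h2⟩ fun l => rfl]

/-- The mean requirement of each resource is `1/2`. -/
theorem lintegral_coord {f : Req d → ℝ} {μ : Measure (Req d)} [IsProbabilityMeasure μ]
    (hf : IsPDF f μ) (hs : IsCentrallySymmetric f) (l : Fin d) :
    ∫⁻ v, ENNReal.ofReal (v.1 l) ∂μ = ENNReal.ofReal (1 / 2) := by
  have hbox : (cube d : Set (Fin d → ℝ)) =ᵐ[volume] openBox (0 : Fin d → ℝ) 1 :=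
    (openBox_ae_eq _ _).symm
  have hm := measurable_extendDensity hf.1
  -- By symmetry the coordinate and one minus the coordinate have the same mean; these means add up
  -- to 1.
  have h1 : ∫⁻ v, ENNReal.ofReal (v.1 l) ∂μ = ∫⁻ v, ENNReal.ofReal (1 - v.1 l) ∂μ := by
    have e0 := lintegral_openBox_reflect (0 : Fin d → ℝ) 1 1
      (g := fun v => extendDensity f v * ENNReal.ofReal (v l)) (by fun_prop)
    rw [lintegral_req hf (g := fun v => ENNReal.ofReal (v l)) (by fun_prop),
      lintegral_req hf (g := fun v => ENNReal.ofReal (1 - v l)) (by fun_prop),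
      setLIntegral_congr hbox, setLIntegral_congr hbox]
    simp only [sub_self, sub_zero] at e0
    rw [e0]
    refine setLIntegral_congr_fun (measurableSet_openBox _ _) fun v hv => ?_
    rw [extendDensity_reflect hs hv]
    rfl
  have h2 : ∫⁻ v, ENNReal.ofReal (v.1 l) ∂μ + ∫⁻ v, ENNReal.ofReal (1 - v.1 l) ∂μ = 1 := by
    rw [← lintegral_add_left (f := fun v : Req d => ENNReal.ofReal (v.1 l))
      ((measurable_pi_apply l).comp measurable_subtype_coe).ennreal_ofReal]
    have : ∀ v : Req d, ENNReal.ofReal (v.1 l) + ENNReal.ofReal (1 - v.1 l) = 1 := fun v => by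
      have hv := v.2 l (Set.mem_univ l)
      rw [← ENNReal.ofReal_add hv.1.le (by linarith [hv.2])]
      simp
    simp [this]
  rw [← h1, ← two_mul] at h2
  rw [one_div, ENNReal.ofReal_inv_of_pos two_pos, ENNReal.ofReal_ofNat]
  exact ENNReal.eq_inv_of_mul_eq_one_left (by rwa [mul_comm])

/-- The set of the requirements of type `i`, as a half-open box. -/
theorem typeOf_eq_iff {K : Fin d → ℕ} (hK : ∀ l, 1 ≤ K l) {i : JobType d} (hi : i ∈ jobTypes K)
    (v : Req d) : typeOf K v = i ↔
      v.1 ∈ Set.pi Set.univ fun l => Set.Ioc (((i l : ℝ) - 1) / K l) ((i l : ℝ) / K l) := by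
  rw [funext_iff, Set.mem_univ_pi]
  refine forall_congr' fun l => ?_
  have hKl : (0 : ℝ) < K l := by exact_mod_cast hK l
  have hil := (mem_jobTypes.1 hi l).1
  rw [typeOf, Nat.ceil_eq_iff (by omega), Set.mem_Ioc, div_lt_iff₀' hKl, le_div_iff₀' hKl]
  push_cast [hil]
  rfl

theorem typeBox_subset {K : Fin d → ℕ} (hK : ∀ l, 1 ≤ K l) {i : JobType d}
    (hi : i ∈ jobTypes K) :
    (Set.pi Set.univ fun l => Set.Ioc (((i l : ℝ) - 1) / K l) ((i l : ℝ) / K l)) ⊆ cube d := by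
  intro v hv l hl
  have h := hv l hl
  have hKl : (0 : ℝ) < K l := by exact_mod_cast hK l
  have h1 : (1 : ℝ) ≤ i l := by exact_mod_cast (mem_jobTypes.1 hi l).1
  have h2 : (i l : ℝ) ≤ K l := by exact_mod_cast (mem_jobTypes.1 hi l).2
  refine ⟨lt_of_le_of_lt (div_nonneg (by linarith) hKl.le) h.1, h.2.trans ?_⟩
  rwa [div_le_one hKl]

theorem measure_typeOf_eq {f : Req d → ℝ} {μ : Measure (Req d)} (hf : IsPDF f μ)
    {K : Fin d → ℕ} (hK : ∀ l, 1 ≤ K l) {i : JobType d} (hi : i ∈ jobTypes K) :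
    μ {v | typeOf K v = i} =
      ∫⁻ v in openBox (fun l => ((i l : ℝ) - 1) / K l) (fun l => (i l : ℝ) / K l),
        extendDensity f v := by
  set B : Set (Fin d → ℝ) :=
    Set.pi Set.univ fun l => Set.Ioc (((i l : ℝ) - 1) / K l) ((i l : ℝ) / K l)
  have hB : MeasurableSet B := MeasurableSet.univ_pi fun _ => measurableSet_Ioc
  have h1 : {v : Req d | typeOf K v = i} = Subtype.val ⁻¹' B := by
    ext v
    exact typeOf_eq_iff hK hi v
  have h2 := lintegral_req hf (g := B.indicator 1) (measurable_one.indicator hB)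
  have h3 : ∫⁻ v : Req d, B.indicator 1 v.1 ∂μ = μ (Subtype.val ⁻¹' B) := by
    rw [← lintegral_indicator_one (measurable_subtype_coe hB)]
    rfl
  rw [h1, ← h3, h2, setLIntegral_congr (openBox_ae_eq _ _)]
  have h4 : ∀ v, extendDensity f v * B.indicator 1 v = B.indicator (extendDensity f) v := by
    intro v
    by_cases hv : v ∈ B <;> simp [hv]
  simp_rw [h4]
  rw [lintegral_indicator hB, Measure.restrict_restrict hB,
    Set.inter_eq_left.2 (typeBox_subset hK hi)]

theorem volume_typeBox (K : Fin d → ℕ) (i : JobType d) :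
    volume (openBox (fun l => ((i l : ℝ) - 1) / K l) (fun l => (i l : ℝ) / K l)) =
      ENNReal.ofReal (∏ l, (1 / (K l : ℝ))) := by
  rw [measure_congr (openBox_ae_eq _ _), volume_pi_pi,
    ENNReal.ofReal_prod_of_nonneg fun l _ => by positivity]
  refine Finset.prod_congr rfl fun l _ => ?_
  rw [Real.volume_Ioc]
  congr 1
  ring

theorem typeProb_le {f : Req d → ℝ} {μ : Measure (Req d)} [IsProbabilityMeasure μ]
    (hf : IsPDF f μ) {F : ℝ} (hF : ∀ v, f v ≤ F) (hF0 : 0 ≤ F) {K : Fin d → ℕ}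
    (hK : ∀ l, 1 ≤ K l) {i : JobType d} (hi : i ∈ jobTypes K) :
    typeProb μ K i ≤ F * ∏ l, (1 / (K l : ℝ)) := by
  have h0 : (0 : ℝ) ≤ ∏ l, (1 / (K l : ℝ)) := Finset.prod_nonneg fun l _ => by positivity
  refine ENNReal.toReal_le_of_le_ofReal (by positivity) ?_
  rw [measure_typeOf_eq hf hK hi, ENNReal.ofReal_mul hF0, ← volume_typeBox K i,
    ← setLIntegral_const]
  refine lintegral_mono fun v => ?_
  unfold extendDensity
  split_ifs with h
  · exact ENNReal.ofReal_le_ofReal (hF _)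
  · exact zero_le

/-- The map v ↦ 1 - 1/K - v, taken coordinatewise, carries the cell of j onto the cell of K - j. It
is the central reflection of v + 1/K, so the density at the image equals the density at v + 1/K,
which is within C/k of that at v because the shift has sup norm at most 1/k. Integration over a cell
gives the bound. -/
theorem typeProb_sub_le {f : Req d → ℝ} {μ : Measure (Req d)} [IsProbabilityMeasure μ]
    (hf : IsPDF f μ) (hs : IsCentrallySymmetric f) {C : NNReal} (hC : LipschitzWith C f)
    {k : ℕ} (hk : 0 < k) {K : Fin d → ℕ} (hK : ∀ l, k ≤ K l) {j : JobType d}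
    (hj : j ∈ jobTypes K) (hb : ¬ ∃ l, j l = K l) :
    typeProb μ K (K - j) ≤ typeProb μ K j + C / k * ∏ l, (1 / (K l : ℝ)) := by
  have h0 : (0 : ℝ) ≤ ∏ l, (1 / (K l : ℝ)) := Finset.prod_nonneg fun l _ => by positivity
  have hK1 : ∀ l, 1 ≤ K l := fun l => le_trans hk (hK l)
  have hm := measurable_extendDensity hf.1
  refine ENNReal.toReal_le_of_le_ofReal
    (add_nonneg (typeProb_nonneg _ _ _) (mul_nonneg (by positivity) h0)) ?_
  rw [ENNReal.ofReal_add (typeProb_nonneg _ _ _) (mul_nonneg (by positivity) h0), typeProb,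
    ofReal_measureReal, measure_typeOf_eq hf hK1 hj,
    measure_typeOf_eq hf hK1 (sub_mem_jobTypes hj hb).1]
  have hbox := lintegral_openBox_reflect (fun l => ((j l : ℝ) - 1) / K l)
    (fun l => (j l : ℝ) / K l) (fun l => 1 - 1 / (K l : ℝ)) hm
  have hKr : ∀ l, (0 : ℝ) < K l := fun l => by exact_mod_cast hK1 l
  have hjK : ∀ l, j l ≤ K l := fun l => (mem_jobTypes.1 hj l).2
  have e1 : ((fun l => 1 - 1 / (K l : ℝ)) - fun l => (j l : ℝ) / K l) =
      fun l => (((K - j) l : ℕ) - 1 : ℝ) / K l := by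
    ext l
    have := (hKr l).ne'
    simp only [Pi.sub_apply]
    rw [Nat.cast_sub (hjK l)]
    field_simp
    ring
  have e2 : ((fun l => 1 - 1 / (K l : ℝ)) - fun l => ((j l : ℝ) - 1) / K l) =
      fun l => (((K - j) l : ℕ) : ℝ) / K l := by
    ext l
    have := (hKr l).ne'
    simp only [Pi.sub_apply]
    rw [Nat.cast_sub (hjK l)]
    field_simp
    ring
  rw [e1, e2] at hbox
  rw [hbox, ENNReal.ofReal_mul (by positivity), ← volume_typeBox K j, ← setLIntegral_const,
    ← lintegral_add_left hm]
  refine setLIntegral_mono' (measurableSet_openBox _ _) fun v hv => ?_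
  have hv1 : v ∈ cube d := typeBox_subset hK1 hj fun l hl => ⟨(hv l hl).1, (hv l hl).2.le⟩
  -- The shifted point stays in the open cube because j is not a boundary type: j_l + 1 ≤ K_l.
  have hv2 : v + (fun l => 1 / (K l : ℝ)) ∈ openBox (0 : Fin d → ℝ) 1 := by
    intro l hl
    have h1 := hv l hl
    have h2 : j l + 1 ≤ K l := by
      have := hjK l
      push Not at hb
      have := hb l
      omega
    have h3 : (j l : ℝ) + 1 ≤ K l := by exact_mod_cast h2
    have h4 : (0 : ℝ) < 1 / K l := one_div_pos.2 (hKr l)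
    have h5 : (j l : ℝ) / K l + 1 / K l ≤ 1 := by
      rw [← add_div, div_le_one (hKr l)]; exact h3
    have h6 := (hv1 l hl).1
    simp only [Pi.zero_apply, Pi.one_apply, Pi.add_apply, Set.mem_Ioo] at h1 ⊢
    constructor <;> linarith [h1.2]
  have e3 : (fun l => 1 - 1 / (K l : ℝ)) - v = 1 - (v + fun l => 1 / (K l : ℝ)) := by
    ext l
    simp only [Pi.sub_apply, Pi.one_apply, Pi.add_apply]
    ring
  have hv3 : v + (fun l => 1 / (K l : ℝ)) ∈ cube d := fun l hl => ⟨(hv2 l hl).1, (hv2 l hl).2.le⟩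
  rw [e3, extendDensity_reflect hs hv2, extendDensity_of_mem f hv1, extendDensity_of_mem f hv3,
    ← ENNReal.ofReal_add (hf.2.1 _) (by positivity)]
  refine ENNReal.ofReal_le_ofReal ?_
  have h7 := hC.dist_le_mul ⟨_, hv3⟩ ⟨v, hv1⟩
  have h8 : dist (⟨_, hv3⟩ : Req d) ⟨v, hv1⟩ ≤ 1 / k := by
    change dist (v + (fun l => 1 / (K l : ℝ))) v ≤ 1 / k
    rw [dist_eq_norm, add_sub_cancel_left]
    refine (pi_norm_le_iff_of_nonneg (by positivity)).2 fun l => ?_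
    rw [Real.norm_of_nonneg (by positivity)]
    have : (k : ℝ) ≤ K l := by exact_mod_cast hK l
    gcongr
  have h9 := (le_abs_self _).trans h7
  have h10 := mul_le_mul_of_nonneg_left h8 C.coe_nonneg
  have h11 : (C : ℝ) * (1 / k) = C / k := by ring
  linarith

-- With p the total probability of the boundary types, the weight required by `exists_capacity` is
-- at most λp + (λ/2)(1 - p + C/k) = (λ/2)(1 + p + C/k), and p ≤ Fd/k. The hypothesis `hlk` says
-- exactly that (λ/2)(1 + Fd/k + C/k) < 1.
open Classical in
theorem capacity_of_lipschitz {f : Req d → ℝ} {μ : Measure (Req d)} [IsProbabilityMeasure μ]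
    (hf : IsPDF f μ) (hs : IsCentrallySymmetric f) {C : NNReal} (hC : LipschitzWith C f)
    {F : ℝ} (hF : ∀ v, f v ≤ F) (hF0 : 0 ≤ F) {k : ℕ} (hk : 0 < k) {K : Fin d → ℕ}
    (hK : ∀ l, k ≤ K l) {lam : ℝ} (hlam : 0 < lam) (hlk : lam * (F * d + C) < (2 - lam) * k) :
    Nonempty (Capacity K fun i => lam * typeProb μ K i) := by
  have hK1 : ∀ l, 1 ≤ K l := fun l => le_trans hk (hK l)
  have hKr : ∀ l, (0 : ℝ) < K l := fun l => by exact_mod_cast hK1 l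
  have hkr : (0 : ℝ) < k := by exact_mod_cast hk
  refine exists_capacity hK1 (fun i => mul_nonneg hlam.le (typeProb_nonneg μ K i)) ?_
  set c : ℝ := ∏ l, (1 / (K l : ℝ)) with hc
  have hc0 : 0 ≤ c := Finset.prod_nonneg fun l _ => by positivity
  set B := (jobTypes K).filter fun j => ∃ l, j l = K l with hB
  set I := (jobTypes K).filter fun j => ¬ ∃ l, j l = K l with hI
  -- Here c is the volume of a cell, so cardinalities times c are volumes: the interior cells form a
  -- box with K_l - 1 cells in direction l.
  have hcI : (I.card : ℝ) * c = ∏ l, (1 - 1 / (K l : ℝ)) := by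
    have : I = Fintype.piFinset fun l => Finset.Icc 1 (K l - 1) := by
      ext j
      simp only [hI, Finset.mem_filter, mem_jobTypes, Fintype.mem_piFinset, Finset.mem_Icc,
        not_exists, ← forall_and]
      refine forall_congr' fun l => ?_
      have := hK1 l
      omega
    rw [this, Fintype.card_piFinset, Nat.cast_prod, hc, ← Finset.prod_mul_distrib]
    refine Finset.prod_congr rfl fun l _ => ?_
    have := (hKr l).ne'
    rw [Nat.card_Icc, Nat.sub_add_cancel (hK1 l), Nat.cast_sub (hK1 l)]
    field_simp
    push_cast
    ring
  have hcT : ((jobTypes K).card : ℝ) * c = 1 := by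
    have : jobTypes K = Fintype.piFinset fun l => Finset.Icc 1 (K l) := by
      ext j
      simp only [mem_jobTypes, Fintype.mem_piFinset, Finset.mem_Icc]
    rw [this, Fintype.card_piFinset, Nat.cast_prod, hc, ← Finset.prod_mul_distrib]
    refine Finset.prod_eq_one fun l _ => ?_
    have := (hKr l).ne'
    rw [Nat.card_Icc, Nat.add_sub_cancel]
    field_simp
  have hcard : (B.card : ℝ) + I.card = (jobTypes K).card := by
    exact_mod_cast Finset.card_filter_add_card_filter_not (s := jobTypes K)
      (fun j => ∃ l, j l = K l)
  -- Bernoulli's inequality for (1 - 1/k)^d; it bounds the volume of the boundary cells by d/k.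
  have hρ : 1 - (d : ℝ) / k ≤ ∏ l, (1 - 1 / (K l : ℝ)) := by
    have h1 : (1 - 1 / (k : ℝ)) ^ d ≤ ∏ l, (1 - 1 / (K l : ℝ)) := by
      have h1k : 1 / (k : ℝ) ≤ 1 := by
        rw [div_le_one hkr]; exact_mod_cast hk
      calc (1 - 1 / (k : ℝ)) ^ d = ∏ _l : Fin d, (1 - 1 / (k : ℝ)) := by simp
        _ ≤ _ := Finset.prod_le_prod (fun _ _ => by linarith) fun l _ => by
          have : (k : ℝ) ≤ K l := by exact_mod_cast hK l
          gcongr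
    have h2 := one_add_mul_le_pow (a := -(1 / (k : ℝ))) (by
      have h1k : 1 / (k : ℝ) ≤ 1 := by
        rw [div_le_one hkr]; exact_mod_cast hk
      linarith) d
    have h3 : 1 + (d : ℝ) * -(1 / (k : ℝ)) = 1 - d / k := by ring
    rw [h3, ← sub_eq_add_neg] at h2
    exact h2.trans h1
  rw [Finset.sum_ite]
  have hIle : ∑ j ∈ I, max (lam * typeProb μ K j) (lam * typeProb μ K (K - j)) / 2 ≤
      ∑ j ∈ I, lam / 2 * (typeProb μ K j + C / k * c) := by
    refine Finset.sum_le_sum fun j hj => ?_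
    obtain ⟨hj1, hj2⟩ := Finset.mem_filter.1 hj
    have h1 := typeProb_sub_le hf hs hC hk hK hj1 hj2
    have h2 : 0 ≤ (C : ℝ) / k * c := by positivity
    rw [← mul_max_of_nonneg _ _ hlam.le]
    have h3 : max (typeProb μ K j) (typeProb μ K (K - j)) ≤ typeProb μ K j + C / k * c :=
      max_le (by linarith) h1
    nlinarith
  have hBle : ∑ j ∈ B, typeProb μ K j ≤ B.card * (F * c) := by
    rw [← nsmul_eq_mul, ← Finset.sum_const]
    exact Finset.sum_le_sum fun j hj => typeProb_le hf hF hF0 hK1 (Finset.mem_filter.1 hj).1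
  have hsum : ∑ j ∈ B, typeProb μ K j + ∑ j ∈ I, typeProb μ K j = 1 := by
    rw [← sum_typeProb μ hK1]
    exact Finset.sum_filter_add_sum_filter_not _ _ _
  rw [← Finset.mul_sum] at hIle ⊢
  rw [Finset.sum_add_distrib, Finset.sum_const, nsmul_eq_mul] at hIle
  have hBc : (B.card : ℝ) * c ≤ d / k := by
    have : (B.card : ℝ) * c = 1 - I.card * c := by rw [← hcT, ← hcard]; ring
    linarith
  have hIc : (I.card : ℝ) * c ≤ 1 := by
    have : 0 ≤ (B.card : ℝ) * c := by positivity
    nlinarith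
  have h1 : (B.card : ℝ) * (F * c) ≤ F * d / k := by
    calc (B.card : ℝ) * (F * c) = F * (B.card * c) := by ring
      _ ≤ F * (d / k) := by gcongr
      _ = _ := by ring
  have h2 : (I.card : ℝ) * (C / k * c) ≤ C / k := by
    calc (I.card : ℝ) * (C / k * c) = C / k * (I.card * c) := by ring
      _ ≤ C / k * 1 := by gcongr
      _ = _ := by ring
  have h3 : lam / 2 * (1 + F * d / k + C / k) < 1 := by
    have : lam / 2 * (1 + F * d / k + C / k) = lam / 2 + lam * (F * d + C) / (2 * k) := by
      field_simp
      ring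
    rw [this]
    have : lam * (F * d + C) / (2 * k) < (2 - lam) / 2 := by
      rw [div_lt_div_iff₀ (by positivity) two_pos]
      linarith
    linarith
  have h4 : lam * ∑ j ∈ B, typeProb μ K j + lam / 2 * (∑ j ∈ I, typeProb μ K j + C / k) ≤
      lam / 2 * (1 + F * d / k + C / k) := by
    have : ∑ j ∈ I, typeProb μ K j = 1 - ∑ j ∈ B, typeProb μ K j := by linarith
    rw [this]
    nlinarith
  have h5 : lam / 2 * (∑ j ∈ I, typeProb μ K j + I.card * (C / k * c)) ≤
      lam / 2 * (∑ j ∈ I, typeProb μ K j + C / k) := by gcongr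
  linarith

end Density

/-! ### Queue lengths and their quadratic form -/

section Queues

variable {d : ℕ}

instance (d : ℕ) : MeasurableSingletonClass (State d) where
  measurableSet_singleton x := by
    refine MeasurableSpace.measurableSet_iInf.2 fun N => ?_
    change MeasurableSet ((fun y : Fin N → Req d => (⟨N, y⟩ : State d)) ⁻¹' {x})
    refine Set.Subsingleton.measurableSet fun y hy z hz => ?_
    have hy' : (⟨N, y⟩ : State d) = x := hy
    have hz' : (⟨N, z⟩ : State d) = x := hz
    exact eq_of_heq (Sigma.mk.inj (hy'.trans hz'.symm)).2

theorem arrive_fst (x : State d) (v : Req d) : (arrive x v).1 = x.1 + 1 := rfl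

theorem depart_fst : ∀ (x : State d) (n : Fin x.1), (depart x n).1 + 1 = x.1
  | ⟨0, _⟩, n => n.elim0
  | ⟨_ + 1, _⟩, _ => rfl

theorem eq_emptyState {x : State d} (h : x.1 = 0) : x = emptyState d := by
  obtain ⟨N, x⟩ := x
  obtain rfl : N = 0 := h
  simp only [emptyState, Sigma.mk.injEq, heq_eq_eq, true_and]
  exact Subsingleton.elim _ _

theorem queue_eq_sum (K : Fin d → ℕ) (x : State d) (i : JobType d) :
    queue K x i = ∑ n, if typeOf K (x.2 n) = i then 1 else 0 := by
  rw [queue, Finset.card_filter]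

theorem queue_arrive (K : Fin d → ℕ) (x : State d) (v : Req d) (i : JobType d) :
    queue K (arrive x v) i = queue K x i + if typeOf K v = i then 1 else 0 := by
  rw [queue_eq_sum, queue_eq_sum]
  change ∑ n : Fin (x.1 + 1), (if typeOf K (Fin.snoc (α := fun _ => Req d) x.2 v n) = i
    then 1 else 0) = _
  rw [Fin.sum_univ_castSucc]
  simp

theorem queue_depart (K : Fin d → ℕ) : ∀ (x : State d) (n : Fin x.1) (i : JobType d),
    queue K x i = queue K (depart x n) i + if typeOf K (x.2 n) = i then 1 else 0
  | ⟨0, _⟩, n, _ => n.elim0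
  | ⟨N + 1, x⟩, n, i => by
    rw [queue_eq_sum, queue_eq_sum, Fin.sum_univ_succAbove _ n, add_comm]
    rfl

theorem queue_pos (K : Fin d → ℕ) (x : State d) (n : Fin x.1) :
    0 < queue K x (typeOf K (x.2 n)) :=
  Finset.card_pos.2 ⟨n, by simp⟩

theorem sum_queue {K : Fin d → ℕ} (hK : ∀ l, 1 ≤ K l) (x : State d) :
    ∑ i ∈ jobTypes K, queue K x i = x.1 := by
  have h := Finset.card_eq_sum_card_fiberwise (s := (Finset.univ : Finset (Fin x.1)))
    (f := fun n => typeOf K (x.2 n)) (t := jobTypes K)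
    (fun n _ => typeOf_mem_jobTypes hK _)
  rw [Finset.card_univ, Fintype.card_fin] at h
  exact h.symm

/-- A sum over a set of jobs of a function of their types. -/
theorem sum_jobs_eq {K : Fin d → ℕ} (hK : ∀ l, 1 ≤ K l) (x : State d) (s : Finset (Fin x.1))
    (G : JobType d → ℝ) : ∑ n ∈ s, G (typeOf K (x.2 n)) =
      ∑ i ∈ jobTypes K, ((s.filter fun n => typeOf K (x.2 n) = i).card : ℝ) * G i := by
  rw [← Finset.sum_fiberwise_of_maps_to (g := fun n => typeOf K (x.2 n)) (t := jobTypes K)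
    (fun n _ => typeOf_mem_jobTypes hK _)]
  refine Finset.sum_congr rfl fun i _ => ?_
  rw [Finset.sum_congr rfl (g := fun _ => G i) fun n hn => by rw [(Finset.mem_filter.1 hn).2],
    Finset.sum_const, nsmul_eq_mul]

theorem measurable_queue (K : Fin d → ℕ) (i : JobType d) :
    Measurable fun x : State d => queue K x i := by
  refine measurable_of_sigma fun N => ?_
  exact (measurable_of_countable fun t : Fin N → JobType d =>
    (Finset.univ.filter fun n => t n = i).card).comp (measurable_types K)

theorem measurable_card (d : ℕ) : Measurable fun x : State d => x.1 :=
  measurable_of_sigma fun _ => measurable_const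

/-- Adding a new maximum leaves all earlier ranks unchanged, and its own rank is the old
cardinality. -/
theorem card_filter_rank_lt {α : Type*} [LinearOrder α] (A : Finset α) (c : ℕ) :
    (A.filter fun n => (A.filter fun m => m < n).card < c).card = min c A.card := by
  induction A using Finset.induction_on_max with
  | empty => simp
  | insert a s hs ih =>
    have ha : a ∉ s := fun h => lt_irrefl _ (hs a h)
    have h1 : (insert a s).filter (fun m => m < a) = s := by
      ext m
      simp only [Finset.mem_filter, Finset.mem_insert]
      constructor
      · rintro ⟨rfl | h, h2⟩
        · exact absurd h2 (lt_irrefl _)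
        · exact h
      · exact fun h => ⟨Or.inr h, hs m h⟩
    have h2 : ∀ n ∈ s, (insert a s).filter (fun m => m < n) = s.filter (fun m => m < n) := by
      intro n hn
      rw [Finset.filter_insert, if_neg (hs n hn).le.not_gt]
    have h3 : s.filter (fun n => ((insert a s).filter fun m => m < n).card < c) =
        s.filter (fun n => (s.filter fun m => m < n).card < c) :=
      Finset.filter_congr fun n hn => by rw [h2 n hn]
    rw [Finset.filter_insert, h1, h3, Finset.card_insert_of_notMem ha]
    split_ifs with hc
    · rw [Finset.card_insert_of_notMem fun h => ha (Finset.mem_filter.1 h).1, ih]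
      omega
    · rw [ih]
      omega

/-- Within a type, `slotServe` selects by rank. The count is the one demanded by `IsEMW`, so the
first-come rule also serves as the witness that MaxWeight policies exist. -/
theorem card_slotServe_filter (K : Fin d → ℕ) (u : ServiceOption d) (x : State d)
    (i : JobType d) : ((slotServe K u x).filter fun n => typeOf K (x.2 n) = i).card =
      min (u.count i) (queue K x i) := by
  rw [queue, ← card_filter_rank_lt, slotServe, Finset.filter_filter, Finset.filter_filter]
  congr 1
  refine Finset.filter_congr fun n _ => ?_
  rw [and_comm]
  refine and_congr_right fun h => ?_
  rw [h, Finset.filter_filter]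
  simp only [and_comm]

theorem sum_map_twoJobSet {K : Fin d → ℕ} {M : ServiceOption d} (hM : M ∈ twoJobSet K)
    (q : JobType d → ℕ) : (M.map q).sum = ∑ i ∈ jobTypes K, M.count i * q i := by
  classical
  rw [Finset.sum_multiset_map_count]
  simp only [smul_eq_mul]
  refine Finset.sum_subset (fun i hi => mem_jobTypes_of_mem hM (Multiset.mem_toFinset.1 hi)) ?_
  intro i _ hi
  rw [Multiset.count_eq_zero.2 fun h => hi (Multiset.mem_toFinset.2 h), zero_mul]

theorem weight_eq {K : Fin d → ℕ} {M : ServiceOption d} (hM : M ∈ twoJobSet K)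
    (q : JobType d → ℕ) : weight M q = ∑ i ∈ jobTypes K, M.count i * q i :=
  sum_map_twoJobSet hM q

theorem count_le_two {K : Fin d → ℕ} {M : ServiceOption d} (hM : M ∈ twoJobSet K)
    (i : JobType d) : M.count i ≤ 2 := (M.count_le_card i).trans (card_twoJobSet_le hM)

/-- The sum of the squared queue lengths. -/
def sqSum (K : Fin d → ℕ) (x : State d) : ℝ := ∑ i ∈ jobTypes K, (queue K x i : ℝ) ^ 2

theorem sqSum_nonneg (K : Fin d → ℕ) (x : State d) : 0 ≤ sqSum K x :=
  Finset.sum_nonneg fun _ _ => sq_nonneg _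

theorem measurable_sqSum (K : Fin d → ℕ) : Measurable (sqSum K) := by
  refine Finset.measurable_sum _ fun i _ => ?_
  exact ((measurable_of_countable fun n : ℕ => (n : ℝ)).comp (measurable_queue K i)).pow_const 2

theorem sqSum_arrive {K : Fin d → ℕ} (hK : ∀ l, 1 ≤ K l) (x : State d) (v : Req d) :
    sqSum K (arrive x v) = sqSum K x + (2 * queue K x (typeOf K v) + 1) := by
  have h : ∀ i, ((queue K (arrive x v) i : ℕ) : ℝ) ^ 2 = (queue K x i : ℝ) ^ 2 +
      if typeOf K v = i then 2 * (queue K x i : ℝ) + 1 else 0 := by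
    intro i
    rw [queue_arrive]
    split_ifs <;> push_cast <;> ring
  unfold sqSum
  simp_rw [h]
  rw [Finset.sum_add_distrib, Finset.sum_ite_eq, if_pos (typeOf_mem_jobTypes hK v)]

theorem sqSum_depart {K : Fin d → ℕ} (hK : ∀ l, 1 ≤ K l) (x : State d) (n : Fin x.1) :
    sqSum K (depart x n) = sqSum K x + (1 - 2 * queue K x (typeOf K (x.2 n))) := by
  have h : ∀ i, ((queue K (depart x n) i : ℕ) : ℝ) ^ 2 = (queue K x i : ℝ) ^ 2 +
      if typeOf K (x.2 n) = i then 1 - 2 * (queue K x i : ℝ) else 0 := by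
    intro i
    rw [queue_depart K x n i]
    split_ifs <;> push_cast <;> ring
  unfold sqSum
  simp_rw [h]
  rw [Finset.sum_add_distrib, Finset.sum_ite_eq, if_pos (typeOf_mem_jobTypes hK _)]

end Queues

/-! ### Existence and stability of MaxWeight -/

section MaxWeight

variable {d : ℕ}

theorem lintegral_mrjRates (lam : ℝ) (μ : Measure (Req d)) [SFinite μ] (π : Policy d)
    (x : State d) {g : State d → ℝ≥0∞} (hg : Measurable g) :
    ∫⁻ y, g y ∂mrjRates lam μ π x = ENNReal.ofReal lam * ∫⁻ v, g (arrive x v) ∂μ +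
      ∑ n ∈ π.serve x, g (depart x n) := by
  change ∫⁻ y, g y ∂(ENNReal.ofReal lam • μ.map (fun v => arrive x v)
    + ∑ n ∈ π.serve x, Measure.dirac (depart x n)) = _
  have ha : Measurable fun v => arrive x v := measurable_arrive.comp measurable_prodMk_left
  rw [lintegral_add_measure, lintegral_smul_measure, lintegral_map hg ha,
    lintegral_finsetSum_measure, smul_eq_mul]
  simp_rw [lintegral_dirac' _ hg]

theorem exitRate_mrjRates (lam : ℝ) (μ : Measure (Req d)) [IsProbabilityMeasure μ] (π : Policy d)
    (x : State d) : exitRate (mrjRates lam μ π) x = ENNReal.ofReal lam + (π.serve x).card := by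
  have h := lintegral_mrjRates lam μ π x (g := fun _ => 1) measurable_const
  simpa [exitRate] using h

theorem exists_weight_maximal {K : Fin d → ℕ} (hK : ∀ l, 1 ≤ K l) (q : JobType d → ℕ) :
    ∃ M ∈ twoJobSet K, ∀ M' ∈ twoJobSet K, weight M' q ≤ weight M q := by
  obtain ⟨j, hj, hmax⟩ := Finset.exists_max_image (jobTypes K)
    (fun j => weight (twoJobOption K j) q) ⟨K, mem_jobTypes.2 fun l => ⟨hK l, le_rfl⟩⟩
  refine ⟨_, twoJobOption_mem hj, ?_⟩
  rw [twoJobSet_eq_image]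
  rintro _ ⟨j', hj', rfl⟩
  exact hmax j' hj'

/-- Types round requirements up, v_l ≤ i_l / K_l, and the types in an option add up to at most K_l
in each coordinate. -/
theorem slotServe_feasible {K : Fin d → ℕ} (hK : ∀ l, 1 ≤ K l) {M : ServiceOption d}
    (hM : M ∈ twoJobSet K) (x : State d) (l : Fin d) :
    ∑ n ∈ slotServe K M x, (x.2 n).1 l ≤ 1 := by
  have hKl : (0 : ℝ) < K l := by exact_mod_cast hK l
  calc ∑ n ∈ slotServe K M x, (x.2 n).1 l
      ≤ ∑ n ∈ slotServe K M x, (typeOf K (x.2 n) l : ℝ) / K l := by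
        refine Finset.sum_le_sum fun n _ => ?_
        rw [le_div_iff₀' hKl]
        exact Nat.le_ceil _
    _ = ∑ i ∈ jobTypes K, ((min (M.count i) (queue K x i) : ℕ) : ℝ) * ((i l : ℝ) / K l) := by
        rw [sum_jobs_eq hK x _ fun i => (i l : ℝ) / K l]
        simp_rw [card_slotServe_filter]
    _ ≤ ∑ i ∈ jobTypes K, (M.count i : ℝ) * ((i l : ℝ) / K l) := by
        gcongr
        exact min_le_left _ _
    _ = (∑ i ∈ jobTypes K, M.count i * i l : ℕ) / K l := by
        push_cast
        rw [Finset.sum_div]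
        exact Finset.sum_congr rfl fun i _ => by ring
    _ ≤ 1 := by
        rw [div_le_one hKl, ← sum_map_twoJobSet hM fun i => i l]
        exact_mod_cast sum_twoJobSet_le hM l

theorem exists_isEMW {K : Fin d → ℕ} (hK : ∀ l, 1 ≤ K l) :
    ∃ π : Policy d, IsEMW K (twoJobSet K) π := by
  choose M hM hmax using fun q : JobType d → ℕ => exists_weight_maximal hK q
  refine ⟨⟨fun x => slotServe K (M (queue K x)) x, fun x l => slotServe_feasible hK (hM _) x l,
    fun N s => ?_⟩, fun x => ⟨M (queue K x), hM _, hmax _, card_slotServe_filter K _ x⟩⟩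
  -- The choice of the option depends on the state only through its vector of types, which lives in
  -- a countable space, so an arbitrary choice function is measurable.
  have hs : MeasurableSet {t : Fin N → JobType d | (Finset.univ.filter fun n =>
      (Finset.univ.filter fun m => m < n ∧ t m = t n).card <
        (M fun i => (Finset.univ.filter fun n => t n = i).card).count (t n)) = s} :=
    (Set.to_countable _).measurableSet
  exact measurable_types K hs

/-- Slots idle only if q < M ≤ 2, when q itself is tiny. The drift lost to idle slots is therefore a
constant per type. -/
theorem mul_le_min_mul_add_one {M : ℕ} (hM : M ≤ 2) (q : ℕ) : M * q ≤ min M q * q + 1 := by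
  rcases le_or_gt M q with h | h
  · rw [min_eq_left h]; omega
  · rw [min_eq_right h.le]
    interval_cases M <;> interval_cases q <;> simp

/-- A convex combination of options is dominated by the option of maximal weight. -/
theorem Capacity.le_weight {K : Fin d → ℕ} {a : JobType d → ℝ}
    (c : Capacity K a) {M : ServiceOption d} (q : JobType d → ℕ)
    (hmax : ∀ M' ∈ twoJobSet K, weight M' q ≤ weight M q) :
    ∑ i ∈ jobTypes K, (a i + c.η) * q i ≤ weight M q := by
  calc ∑ i ∈ jobTypes K, (a i + c.η) * q i
      ≤ ∑ i ∈ jobTypes K, (∑ j ∈ jobTypes K, c.w j * (twoJobOption K j).count i) * q i :=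
        Finset.sum_le_sum fun i hi => mul_le_mul_of_nonneg_right (c.le_service i hi) (by positivity)
    _ = ∑ j ∈ jobTypes K, c.w j * (weight (twoJobOption K j) q : ℝ) := by
        simp_rw [Finset.sum_mul]
        rw [Finset.sum_comm]
        refine Finset.sum_congr rfl fun j hj => ?_
        rw [weight_eq (twoJobOption_mem hj)]
        push_cast
        rw [Finset.mul_sum]
        exact Finset.sum_congr rfl fun i _ => by ring
    _ ≤ ∑ j ∈ jobTypes K, c.w j * (weight M q : ℝ) := by
        refine Finset.sum_le_sum fun j hj => mul_le_mul_of_nonneg_left ?_ (c.w_pos j hj).le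
        exact_mod_cast hmax _ (twoJobOption_mem hj)
    _ = weight M q := by rw [← Finset.sum_mul, c.sum_w, one_mul]

/-- In the drift of `sqSum` the linear terms are 2Σ λp_i q_i from arrivals and -2 times the maximal
weight from service, together at most -2η times the number of jobs. The constant 4T, with T the
number of types, has two parts per type: at most 2 from the squares of unit steps, and 2 from idle
slots. The number of jobs serves as the distance. -/
theorem stable_of_isEMW {K : Fin d → ℕ} (hK : ∀ l, 1 ≤ K l) (μ : Measure (Req d))
    [IsProbabilityMeasure μ] {lam : ℝ} (hlam : 0 < lam)
    (c : Capacity K fun i => lam * typeProb μ K i) {π : Policy d}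
    (hπ : IsEMW K (twoJobSet K) π) : Stable lam μ π := by
  set T : ℝ := ((jobTypes K).card : ℝ) with hT
  have hT0 : 0 ≤ T := Nat.cast_nonneg _
  have hcardle : ∀ x, ((π.serve x).card : ℝ) ≤ 2 * T := by
    intro x
    obtain ⟨M, hM, -, hserve⟩ := hπ x
    have h := sum_jobs_eq hK x (π.serve x) fun _ => 1
    simp only [Finset.sum_const, nsmul_eq_mul, mul_one] at h
    rw [h]
    calc _ ≤ ∑ i ∈ jobTypes K, (2 : ℝ) := by
          refine Finset.sum_le_sum fun i _ => ?_
          rw [hserve i]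
          exact_mod_cast (min_le_left _ _).trans (count_le_two hM i)
      _ = 2 * T := by rw [Finset.sum_const, nsmul_eq_mul, mul_comm]
  have hrate : ∀ x, exitRate (mrjRates lam μ π) x =
      ENNReal.ofReal (lam + (π.serve x).card) := fun x => by
    rw [exitRate_mrjRates, ENNReal.ofReal_add hlam.le (by positivity), ENNReal.ofReal_natCast]
  refine positiveRecurrent_of_lyapunov (mrjRates lam μ π) (emptyState d) MeasurableSet.univ trivial
    (fun x _ => by simp) (r := lam + 2 * T) (by positivity) ?_ ?_ (measurable_sqSum K)
    (fun x => x.1) (fun x => x.1) (measurable_card d) (δ := 2 * c.η) (C := lam + 4 * T) (κ := 1)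
    (by have := c.η_pos; positivity) (by positivity) one_pos (a := 1) (b := 0) (fun x _ => by simp)
    ?_ ?_
  · intro x _
    rw [hrate]
    exact ENNReal.ofReal_le_ofReal (by linarith [hcardle x])
  · intro x _
    rw [hrate]
    exact (ENNReal.ofReal_pos.2 (by positivity)).ne'
  · intro x _
    obtain ⟨M, hM, hmax, hserve⟩ := hπ x
    have hη := c.η_pos
    have hq := sqSum_nonneg K x
    rw [lintegral_mrjRates _ _ _ _ (measurable_sqSum K).ennreal_ofReal, hrate]
    simp_rw [sqSum_arrive hK]
    rw [lintegral_typeOf μ hK (fun i => sqSum K x + (2 * queue K x i + 1))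
      fun i _ => by positivity, ← ENNReal.ofReal_mul hlam.le,
      ← ENNReal.ofReal_sum_of_nonneg fun n _ => sqSum_nonneg K _,
      ← ENNReal.ofReal_add (mul_nonneg hlam.le (Finset.sum_nonneg fun i _ =>
        mul_nonneg (typeProb_nonneg μ K i) (by positivity)))
        (Finset.sum_nonneg fun n _ => sqSum_nonneg K _),
      ← ENNReal.ofReal_add (add_nonneg (mul_nonneg hlam.le (Finset.sum_nonneg fun i _ =>
        mul_nonneg (typeProb_nonneg μ K i) (by positivity)))
        (Finset.sum_nonneg fun n _ => sqSum_nonneg K _)) (by positivity),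
      ← ENNReal.ofReal_mul (by positivity), ← ENNReal.ofReal_add (by positivity) (by positivity)]
    refine ENNReal.ofReal_le_ofReal ?_
    simp_rw [sqSum_depart hK]
    rw [Finset.sum_add_distrib, Finset.sum_const, nsmul_eq_mul,
      sum_jobs_eq hK x (π.serve x) fun i => 1 - 2 * (queue K x i : ℝ)]
    have h1 : ∑ i ∈ jobTypes K, typeProb μ K i * (sqSum K x + (2 * queue K x i + 1)) =
        sqSum K x + 1 + 2 * ∑ i ∈ jobTypes K, typeProb μ K i * queue K x i := by
      have : ∀ i, typeProb μ K i * (sqSum K x + (2 * queue K x i + 1)) =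
          typeProb μ K i * (sqSum K x + 1) + 2 * (typeProb μ K i * queue K x i) := fun i => by ring
      simp_rw [this]
      rw [Finset.sum_add_distrib, ← Finset.sum_mul, sum_typeProb μ hK, ← Finset.mul_sum]
      ring
    have h2 : ∑ i ∈ jobTypes K, (((π.serve x).filter fun n => typeOf K (x.2 n) = i).card : ℝ) *
        (1 - 2 * (queue K x i : ℝ)) ≤ 4 * T - 2 * weight M (queue K x) := by
      rw [weight_eq hM]
      push_cast
      rw [Finset.mul_sum, mul_comm 4 T, hT, ← nsmul_eq_mul, ← Finset.sum_const,
        ← Finset.sum_sub_distrib]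
      refine Finset.sum_le_sum fun i _ => ?_
      rw [hserve i]
      have h3 : ((M.count i * queue K x i : ℕ) : ℝ) ≤
          (min (M.count i) (queue K x i) * queue K x i + 1 : ℕ) :=
        Nat.cast_le.2 (mul_le_min_mul_add_one (count_le_two hM i) (queue K x i))
      have h4 : ((min (M.count i) (queue K x i) : ℕ) : ℝ) ≤ 2 := by
        exact_mod_cast (min_le_left _ _).trans (count_le_two hM i)
      rw [Nat.cast_mul, Nat.cast_add, Nat.cast_mul, Nat.cast_one] at h3
      linarith
    have h5 := c.le_weight (queue K x) hmax
    have h6 : ∑ i ∈ jobTypes K, (lam * typeProb μ K i + c.η) * queue K x i =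
        lam * ∑ i ∈ jobTypes K, typeProb μ K i * queue K x i + c.η * x.1 := by
      have h7 : (x.1 : ℝ) = ∑ i ∈ jobTypes K, (queue K x i : ℝ) := by
        rw [← sum_queue hK x]; push_cast; rfl
      rw [h7, Finset.mul_sum, Finset.mul_sum, ← Finset.sum_add_distrib]
      exact Finset.sum_congr rfl fun i _ => by ring
    rw [h1]
    linarith
  · intro x _ hx
    obtain ⟨M, hM, hmax, hserve⟩ := hπ x
    have hpos : 0 < x.1 := Nat.pos_of_ne_zero fun h => hx (eq_emptyState h)
    set n : Fin x.1 := ⟨0, hpos⟩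
    have hn := queue_pos K x n
    -- The option belonging to the type of any present job has positive weight, hence so has the
    -- chosen one. It contains a type with waiting jobs, so at least one job is served.
    have hw : 0 < weight M (queue K x) := by
      have hj := typeOf_mem_jobTypes hK (x.2 n)
      refine lt_of_lt_of_le ?_ (hmax _ (twoJobOption_mem hj))
      rw [weight_eq (twoJobOption_mem hj)]
      refine lt_of_lt_of_le (Nat.mul_pos (Multiset.count_pos.2 (mem_twoJobOption K _)) hn)
        (Finset.single_le_sum (f := fun i => (twoJobOption K (typeOf K (x.2 n))).count i *
          queue K x i) (fun i _ => Nat.zero_le _) hj)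
    rw [weight_eq hM] at hw
    obtain ⟨i, -, hi⟩ := Finset.exists_ne_zero_of_sum_ne_zero hw.ne'
    have hne : (π.serve x).Nonempty := by
      have : 0 < ((π.serve x).filter fun n => typeOf K (x.2 n) = i).card := by
        rw [hserve i]
        have := Nat.pos_of_ne_zero (left_ne_zero_of_mul hi)
        have := Nat.pos_of_ne_zero (right_ne_zero_of_mul hi)
        omega
      exact (Finset.card_pos.1 this).mono (Finset.filter_subset _ _)
    obtain ⟨m, hm⟩ := hne
    have hmeas : MeasurableSet {y : State d | y.1 < x.1} :=
      measurableSet_lt (measurable_card d) measurable_const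
    rw [← lintegral_indicator_one hmeas, lintegral_mrjRates _ _ _ _ (measurable_one.indicator hmeas)]
    refine le_add_left (le_trans ?_ (Finset.single_le_sum (fun _ _ => zero_le) hm))
    rw [Set.indicator_of_mem]
    · simp
    · have := depart_fst x m
      simp only [Set.mem_ofPred_eq]
      omega

end MaxWeight

/-! ### Modes of the modulating process -/

section Modes

variable {d : ℕ}

/-- The number of slots which have to be released before the target can be worked on. -/
def excess (m : Mode d) : ℕ := (m.1 - m.2).card

/-- The modes in which the process can be. -/
def IsProperMode (K : Fin d → ℕ) (m : Mode d) : Prop :=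
  m.2 ∈ twoJobSet K ∧ (∀ i ∈ m.1, i ∈ jobTypes K) ∧ m.1.card ≤ 2 ∧ (m.1 ≤ m.2 → m.1 = m.2)

theorem settle_snd (u T : ServiceOption d) : (settle u T).2 = T := by
  unfold settle
  split_ifs <;> rfl

theorem excess_settle (u T : ServiceOption d) : excess (settle u T) = (u - T).card := by
  unfold settle excess
  split_ifs with h
  · simp [tsub_eq_zero_of_le h]
  · rfl

theorem release_snd (m : Mode d) (i : JobType d) : (release m i).2 = m.2 := by
  unfold release
  split_ifs
  · exact settle_snd _ _
  · rfl

theorem release_of_le {m : Mode d} {i : JobType d} (h : ¬ m.2.count i < m.1.count i) :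
    release m i = m := if_neg h

/-- The released type lies in the multiset difference, so erasing before or after subtracting the
target is the same. -/
theorem excess_release {m : Mode d} {i : JobType d} (h : m.2.count i < m.1.count i) :
    excess (release m i) + 1 = excess m := by
  have hmem : i ∈ m.1 - m.2 := by
    rw [← Multiset.count_pos, Multiset.count_sub]
    omega
  have h1 : m.1.erase i - m.2 = (m.1 - m.2).erase i := by
    ext k
    rcases eq_or_ne k i with rfl | hk
    · simp only [Multiset.count_sub, Multiset.count_erase_self]
      omega
    · simp only [Multiset.count_sub, Multiset.count_erase_of_ne hk]
  rw [release, if_pos h, excess_settle, h1, excess, Multiset.card_erase_add_one hmem]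

theorem excess_release_le (m : Mode d) (i : JobType d) : excess (release m i) ≤ excess m := by
  by_cases h : m.2.count i < m.1.count i
  · have := excess_release h; omega
  · rw [release_of_le h]

theorem IsProperMode.settle {K : Fin d → ℕ} {u T : ServiceOption d} (hT : T ∈ twoJobSet K)
    (hu : ∀ i ∈ u, i ∈ jobTypes K) (hcard : u.card ≤ 2) : IsProperMode K (settle u T) := by
  unfold MRJ.settle
  split_ifs with h
  · exact ⟨hT, fun i hi => mem_jobTypes_of_mem hT hi, card_twoJobSet_le hT, fun _ => rfl⟩
  · exact ⟨hT, hu, hcard, fun h' => absurd h' h⟩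

theorem IsProperMode.release {K : Fin d → ℕ} {m : Mode d} (hm : IsProperMode K m)
    (i : JobType d) : IsProperMode K (release m i) := by
  unfold MRJ.release
  split_ifs with h
  · exact IsProperMode.settle hm.1 (fun k hk => hm.2.1 k (Multiset.mem_of_mem_erase hk))
      ((Multiset.card_erase_le).trans hm.2.2.1)
  · exact hm

theorem IsProperMode.self {K : Fin d → ℕ} {M : ServiceOption d} (hM : M ∈ twoJobSet K) :
    IsProperMode K (M, M) :=
  ⟨hM, fun _ hi => mem_jobTypes_of_mem hM hi, card_twoJobSet_le hM, fun _ => rfl⟩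

theorem IsProperMode.excess_le {K : Fin d → ℕ} {m : Mode d} (hm : IsProperMode K m) :
    excess m ≤ 2 :=
  (Multiset.card_le_card tsub_le_self).trans hm.2.2.1

theorem IsProperMode.count_le {K : Fin d → ℕ} {m : Mode d} (hm : IsProperMode K m)
    (i : JobType d) : m.1.count i ≤ 2 := (m.1.count_le_card i).trans hm.2.2.1

/-- Switching cannot get stuck: a proper mode whose slots already fit into the target is a working
mode. -/
theorem IsProperMode.exists_excess {K : Fin d → ℕ} {m : Mode d} (hm : IsProperMode K m)
    (h : m.1 ≠ m.2) : ∃ i ∈ jobTypes K, m.2.count i < m.1.count i := by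
  have hle : ¬ m.1 ≤ m.2 := fun h' => h (hm.2.2.2 h')
  rw [Multiset.le_iff_count] at hle
  push Not at hle
  obtain ⟨i, hi⟩ := hle
  exact ⟨i, hm.2.1 i (Multiset.count_pos.1 (by omega)), hi⟩

end Modes

/-! ### Integrals against the rates of the nonpreemptive system -/

section Rates

variable {d : ℕ}

theorem lintegral_nmsrRates {K : Fin d → ℕ} {E : Set (ServiceOption d)} (lam : ℝ)
    (μ : Measure (Req d)) [SFinite μ] (P : NMSR K E) (z : State d × Mode d)
    {g : State d × Mode d → ℝ≥0∞} (hg : Measurable g) :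
    ∫⁻ y, g y ∂nmsrRates lam μ P z = ENNReal.ofReal lam * ∫⁻ v, g (arrive z.1 v, z.2) ∂μ +
      ∑ n ∈ slotServe K z.2.1 z.1, g (depart z.1 n, release z.2 (typeOf K (z.1.2 n))) +
      ∑ i ∈ jobTypes K, (if z.2.2.count i < z.2.1.count i then
        ((z.2.1.count i - min (z.2.1.count i) (queue K z.1 i) : ℕ) : ℝ≥0∞) *
          g (z.1, release z.2 i) else 0) +
      (if z.2.1 = z.2.2 then ∑ M ∈ P.working.erase z.2.1,
        ENNReal.ofReal (P.rate z.2.1 M) * g (z.1, settle z.2.1 M) else 0) := by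
  change ∫⁻ y, g y ∂(ENNReal.ofReal lam • μ.map (fun v => (arrive z.1 v, z.2))
    + ∑ n ∈ slotServe K z.2.1 z.1,
        Measure.dirac (depart z.1 n, release z.2 (typeOf K (z.1.2 n)))
    + ∑ i ∈ jobTypes K, (if z.2.2.count i < z.2.1.count i then
        ((z.2.1.count i - min (z.2.1.count i) (queue K z.1 i) : ℕ) : ℝ≥0∞) •
          Measure.dirac (z.1, release z.2 i) else 0)
    + (if z.2.1 = z.2.2 then ∑ M ∈ P.working.erase z.2.1,
        ENNReal.ofReal (P.rate z.2.1 M) • Measure.dirac (z.1, settle z.2.1 M) else 0)) = _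
  have ha : Measurable fun v : Req d => (arrive z.1 v, z.2) :=
    (measurable_arrive.comp measurable_prodMk_left).prodMk measurable_const
  rw [lintegral_add_measure, lintegral_add_measure, lintegral_add_measure,
    lintegral_smul_measure, lintegral_map hg ha, lintegral_finsetSum_measure,
    lintegral_finsetSum_measure, smul_eq_mul]
  simp_rw [lintegral_dirac' _ hg]
  congr 1
  · congr 1
    refine Finset.sum_congr rfl fun i _ => ?_
    split_ifs
    · rw [lintegral_smul_measure, lintegral_dirac' _ hg, smul_eq_mul]
    · exact lintegral_zero_measure _
  · split_ifs
    · rw [lintegral_finsetSum_measure]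
      simp_rw [lintegral_smul_measure, lintegral_dirac' _ hg, smul_eq_mul]
    · exact lintegral_zero_measure _

/-- The rate of the moves of the process which are not arrivals, weighted by `g`. -/
def moveSum {K : Fin d → ℕ} {E : Set (ServiceOption d)} (P : NMSR K E) (z : State d × Mode d)
    (g : State d × Mode d → ℝ) : ℝ :=
  ∑ n ∈ slotServe K z.2.1 z.1, g (depart z.1 n, release z.2 (typeOf K (z.1.2 n))) +
      ∑ i ∈ jobTypes K, (if z.2.2.count i < z.2.1.count i then
        ((z.2.1.count i - min (z.2.1.count i) (queue K z.1 i) : ℕ) : ℝ) *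
          g (z.1, release z.2 i) else 0) +
      (if z.2.1 = z.2.2 then ∑ M ∈ P.working.erase z.2.1,
        P.rate z.2.1 M * g (z.1, settle z.2.1 M) else 0)

theorem moveSum_nonneg {K : Fin d → ℕ} {E : Set (ServiceOption d)} (P : NMSR K E)
    (z : State d × Mode d) {g : State d × Mode d → ℝ} (hg : ∀ y, 0 ≤ g y) :
    0 ≤ moveSum P z g := by
  refine add_nonneg (add_nonneg (Finset.sum_nonneg fun _ _ => hg _)
    (Finset.sum_nonneg fun i _ => ?_)) ?_
  · split_ifs
    · exact mul_nonneg (Nat.cast_nonneg _) (hg _)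
    · exact le_rfl
  · split_ifs
    · exact Finset.sum_nonneg fun M _ => mul_nonneg (P.rate_nonneg _ _) (hg _)
    · exact le_rfl

theorem lintegral_ofReal_nmsrRates {K : Fin d → ℕ} {E : Set (ServiceOption d)} (lam : ℝ)
    (μ : Measure (Req d)) [SFinite μ] (P : NMSR K E) (z : State d × Mode d)
    {g : State d × Mode d → ℝ} (hg : Measurable g) (hg0 : ∀ y, 0 ≤ g y) :
    ∫⁻ y, ENNReal.ofReal (g y) ∂nmsrRates lam μ P z =
      ENNReal.ofReal lam * ∫⁻ v, ENNReal.ofReal (g (arrive z.1 v, z.2)) ∂μ +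
        ENNReal.ofReal (moveSum P z g) := by
  have h2 : ∀ i, 0 ≤ (if z.2.2.count i < z.2.1.count i then
        ((z.2.1.count i - min (z.2.1.count i) (queue K z.1 i) : ℕ) : ℝ) *
          g (z.1, release z.2 i) else 0) := fun i => by
    split_ifs
    · exact mul_nonneg (Nat.cast_nonneg _) (hg0 _)
    · exact le_rfl
  have h3 : 0 ≤ (if z.2.1 = z.2.2 then ∑ M ∈ P.working.erase z.2.1,
        P.rate z.2.1 M * g (z.1, settle z.2.1 M) else 0) := by
    split_ifs
    · exact Finset.sum_nonneg fun M _ => mul_nonneg (P.rate_nonneg _ _) (hg0 _)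
    · exact le_rfl
  rw [lintegral_nmsrRates lam μ P z hg.ennreal_ofReal, moveSum,
    ENNReal.ofReal_add (add_nonneg (Finset.sum_nonneg fun _ _ => hg0 _)
      (Finset.sum_nonneg fun i _ => h2 i)) h3,
    ENNReal.ofReal_add (Finset.sum_nonneg fun _ _ => hg0 _) (Finset.sum_nonneg fun i _ => h2 i),
    ENNReal.ofReal_sum_of_nonneg fun _ _ => hg0 _, ENNReal.ofReal_sum_of_nonneg fun i _ => h2 i,
    add_assoc, add_assoc, ← add_assoc (∑ n ∈ slotServe K z.2.1 z.1, _)]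
  congr 3
  · refine Finset.sum_congr rfl fun i _ => ?_
    split_ifs
    · rw [ENNReal.ofReal_mul (Nat.cast_nonneg _), ENNReal.ofReal_natCast]
    · exact ENNReal.ofReal_zero.symm
  · split_ifs
    · rw [ENNReal.ofReal_sum_of_nonneg fun M _ => mul_nonneg (P.rate_nonneg _ _) (hg0 _)]
      exact Finset.sum_congr rfl fun M _ => (ENNReal.ofReal_mul (P.rate_nonneg _ _)).symm
    · exact ENNReal.ofReal_zero.symm

theorem exitRate_nmsrRates {K : Fin d → ℕ} {E : Set (ServiceOption d)} {lam : ℝ}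
    (hlam : 0 ≤ lam) (μ : Measure (Req d)) [IsProbabilityMeasure μ] (P : NMSR K E)
    (z : State d × Mode d) :
    exitRate (nmsrRates lam μ P) z = ENNReal.ofReal (lam + moveSum P z fun _ => 1) := by
  have h := lintegral_ofReal_nmsrRates lam μ P z (g := fun _ => 1) measurable_const
    fun _ => zero_le_one
  rw [ENNReal.ofReal_add hlam (moveSum_nonneg P z fun _ => zero_le_one)]
  simpa [exitRate] using h

theorem moveSum_le_of_measurableSet {K : Fin d → ℕ} {E : Set (ServiceOption d)} (lam : ℝ)
    (μ : Measure (Req d)) [SFinite μ] (P : NMSR K E) (z : State d × Mode d)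
    {s : Set (State d × Mode d)} (hs : MeasurableSet s) :
    ENNReal.ofReal (moveSum P z (s.indicator 1)) ≤ nmsrRates lam μ P z s := by
  have h := lintegral_ofReal_nmsrRates lam μ P z (g := s.indicator 1)
    (measurable_one.indicator hs) fun y => Set.indicator_nonneg (fun _ _ => zero_le_one) y
  have h2 : ∀ y, ENNReal.ofReal (s.indicator (1 : State d × Mode d → ℝ) y) =
      s.indicator 1 y := fun y => by
    by_cases hy : y ∈ s <;> simp [hy]
  rw [← lintegral_indicator_one hs]
  simp_rw [← h2]
  rw [h]
  exact le_add_self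

end Rates

/-! ### The redrawing policy -/

section Switching

variable {d : ℕ} {K : Fin d → ℕ} {a : JobType d → ℝ}

/-- The total weight of an option. -/
def Capacity.optionWeight (c : Capacity K a) (M : ServiceOption d) : ℝ :=
  ∑ j ∈ (jobTypes K).filter fun j => twoJobOption K j = M, c.w j

theorem Capacity.optionWeight_nonneg (c : Capacity K a) (M : ServiceOption d) :
    0 ≤ c.optionWeight M :=
  Finset.sum_nonneg fun j hj => (c.w_pos j (Finset.mem_filter.1 hj).1).le

theorem Capacity.optionWeight_pos (c : Capacity K a) {M : ServiceOption d}
    (hM : M ∈ (jobTypes K).image (twoJobOption K)) : 0 < c.optionWeight M := by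
  obtain ⟨j, hj, rfl⟩ := Finset.mem_image.1 hM
  exact Finset.sum_pos (fun j hj => c.w_pos j (Finset.mem_filter.1 hj).1)
    ⟨j, Finset.mem_filter.2 ⟨hj, rfl⟩⟩

/-- Several types may determine the same option, as j and K - j do; the weights are collected over
the fibres. -/
theorem Capacity.sum_optionWeight (c : Capacity K a) (G : ServiceOption d → ℝ) :
    ∑ M ∈ (jobTypes K).image (twoJobOption K), c.optionWeight M * G M =
      ∑ j ∈ jobTypes K, c.w j * G (twoJobOption K j) := by
  rw [← Finset.sum_fiberwise_of_maps_to (g := twoJobOption K)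
    (t := (jobTypes K).image (twoJobOption K)) fun j hj => Finset.mem_image_of_mem _ hj]
  refine Finset.sum_congr rfl fun M _ => ?_
  rw [optionWeight, Finset.sum_mul]
  exact Finset.sum_congr rfl fun j hj => by rw [(Finset.mem_filter.1 hj).2]

theorem mem_image_twoJobOption {M : ServiceOption d} :
    M ∈ (jobTypes K).image (twoJobOption K) ↔ M ∈ twoJobSet K := by
  rw [twoJobSet_eq_image, Finset.mem_image]
  rfl

/-- The policy which works on the options of the 2-Job efficient set and which, at rate `ε`, picks
a new option at random according to the weights. -/
def Capacity.nmsr (c : Capacity K a) (hK : ∀ l, 1 ≤ K l) {ε : ℝ} (hε : 0 < ε) :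
    NMSR K (twoJobSet K) where
  working := (jobTypes K).image (twoJobOption K)
  nonempty := Finset.Nonempty.image ⟨K, mem_jobTypes.2 fun l => ⟨hK l, le_rfl⟩⟩ _
  subset _ hM := mem_image_twoJobOption.1 hM
  card_le := Finset.card_image_le
  -- Independent of the current option, so decisions amount to independent draws from the mixture;
  -- drawing the current option again has no effect.
  rate _ M' := ε * c.optionWeight M'
  rate_nonneg _ M' := mul_nonneg hε.le (c.optionWeight_nonneg M')
  irreducible M hM M' hM' := by
    rcases eq_or_ne M M' with rfl | h
    · exact Relation.ReflTransGen.refl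
    · exact Relation.ReflTransGen.single ⟨hM, hM', h, mul_pos hε (c.optionWeight_pos hM')⟩

end Switching

/-! ### Drift of the corrected Lyapunov function -/

section SwitchingDrift

variable {d : ℕ} {K : Fin d → ℕ} {a : JobType d → ℝ}

/-- The correction of the queue length of type `i` in the mode `m`: it compensates the difference
between the momentary and the average service rate. -/
def modeBonus (ε b : ℝ) (m : Mode d) (i : JobType d) : ℝ :=
  ((2 - m.2.count i : ℕ) : ℝ) / ε + b * excess m

theorem modeBonus_nonneg {ε b : ℝ} (hε : 0 < ε) (hb : 0 ≤ b) (m : Mode d) (i : JobType d) :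
    0 ≤ modeBonus ε b m i := by
  unfold modeBonus; positivity

theorem modeBonus_le {ε b : ℝ} (hε : 0 < ε) (hb : 0 ≤ b) {m : Mode d} (hm : IsProperMode K m)
    (i : JobType d) : modeBonus ε b m i ≤ 2 / ε + b * 2 := by
  have h1 : ((2 - m.2.count i : ℕ) : ℝ) ≤ 2 := by exact_mod_cast Nat.sub_le _ _
  have h2 : (excess m : ℝ) ≤ 2 := by exact_mod_cast hm.excess_le
  unfold modeBonus
  gcongr

theorem modeBonus_release (ε b : ℝ) (m : Mode d) (i k : JobType d) :
    modeBonus ε b (release m i) k =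
      modeBonus ε b m k - if m.2.count i < m.1.count i then b else 0 := by
  unfold modeBonus
  rw [release_snd]
  split_ifs with h
  · have h1 : (excess m : ℝ) = excess (release m i) + 1 := by
      exact_mod_cast (excess_release h).symm
    rw [h1]; ring
  · rw [release_of_le h, sub_zero]

/-- The correction of the Lyapunov function. -/
def queueBonus (K : Fin d → ℕ) (ε b : ℝ) (z : State d × Mode d) : ℝ :=
  ∑ i ∈ jobTypes K, (queue K z.1 i : ℝ) * modeBonus ε b z.2 i

/-- The Lyapunov function: the sum of the squared queue lengths with a correction for the mode. -/
def modeLyapunov (K : Fin d → ℕ) (ε b : ℝ) (z : State d × Mode d) : ℝ :=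
  sqSum K z.1 + 2 * queueBonus K ε b z

theorem cast_card_eq (hK : ∀ l, 1 ≤ K l) (x : State d) :
    (x.1 : ℝ) = ∑ i ∈ jobTypes K, (queue K x i : ℝ) := by
  rw [← sum_queue hK x]; push_cast; rfl

theorem modeLyapunov_nonneg {ε b : ℝ} (hε : 0 < ε) (hb : 0 ≤ b) (z : State d × Mode d) :
    0 ≤ modeLyapunov K ε b z := by
  have h1 := sqSum_nonneg K z.1
  have h2 : 0 ≤ queueBonus K ε b z := Finset.sum_nonneg fun i _ =>
    mul_nonneg (Nat.cast_nonneg _) (modeBonus_nonneg hε hb _ _)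
  unfold modeLyapunov
  positivity

theorem measurable_modeLyapunov (K : Fin d → ℕ) (ε b : ℝ) :
    Measurable (modeLyapunov K ε b) := by
  refine ((measurable_sqSum K).comp measurable_fst).add (Measurable.const_mul ?_ 2)
  refine Finset.measurable_sum _ fun i _ => Measurable.mul ?_ ?_
  · exact (measurable_of_countable fun n : ℕ => (n : ℝ)).comp
      ((measurable_queue K i).comp measurable_fst)
  · exact (measurable_of_countable fun m : Mode d => modeBonus ε b m i).comp measurable_snd

theorem modeLyapunov_arrive (hK : ∀ l, 1 ≤ K l) (ε b : ℝ) (x : State d) (m : Mode d)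
    (v : Req d) : modeLyapunov K ε b (arrive x v, m) = modeLyapunov K ε b (x, m) +
      (2 * queue K x (typeOf K v) + 1 + 2 * modeBonus ε b m (typeOf K v)) := by
  have h : ∀ i, (queue K (arrive x v) i : ℝ) * modeBonus ε b m i =
      queue K x i * modeBonus ε b m i + if typeOf K v = i then modeBonus ε b m i else 0 := by
    intro i
    rw [queue_arrive]
    split_ifs <;> push_cast <;> ring
  simp only [modeLyapunov, queueBonus]
  simp_rw [h]
  rw [Finset.sum_add_distrib, Finset.sum_ite_eq, if_pos (typeOf_mem_jobTypes hK v),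
    sqSum_arrive hK]
  ring

/-- Only an upper bound is needed: the bonus is nonnegative, so the departure of a job can only
lower the correction. -/
theorem modeLyapunov_depart_le (hK : ∀ l, 1 ≤ K l) {ε b : ℝ} (hε : 0 < ε) (hb : 0 ≤ b)
    (x : State d) (m : Mode d) (n : Fin x.1) :
    modeLyapunov K ε b (depart x n, m) ≤
      modeLyapunov K ε b (x, m) + (1 - 2 * queue K x (typeOf K (x.2 n))) := by
  have h : queueBonus K ε b (depart x n, m) ≤ queueBonus K ε b (x, m) := by
    refine Finset.sum_le_sum fun i _ => mul_le_mul_of_nonneg_right ?_ (modeBonus_nonneg hε hb _ _)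
    have := queue_depart K x n i
    exact_mod_cast le_of_le_of_eq (Nat.le_add_right _ _) this.symm
  simp only [modeLyapunov]
  rw [sqSum_depart hK]
  linarith

/-- A release keeps the target and lowers the excess by one. The bonus of every type thus drops by
the same b, which multiplies the total number of jobs. -/
theorem modeLyapunov_release (hK : ∀ l, 1 ≤ K l) (ε b : ℝ) (x : State d) (m : Mode d)
    (i : JobType d) : modeLyapunov K ε b (x, release m i) = modeLyapunov K ε b (x, m) -
      if m.2.count i < m.1.count i then 2 * b * x.1 else 0 := by
  simp only [modeLyapunov, queueBonus, modeBonus_release]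
  split_ifs with h
  · simp_rw [mul_sub]
    rw [Finset.sum_sub_distrib, ← Finset.sum_mul, ← cast_card_eq hK x]
    ring
  · simp only [sub_zero]

/-- The moves other than the arrivals: their contribution to the drift. -/
theorem moveSum_modeLyapunov_le (hK : ∀ l, 1 ≤ K l) {E : Set (ServiceOption d)} (P : NMSR K E)
    {ε b : ℝ} (hε : 0 < ε) (hb : 0 ≤ b) (x : State d) (m : Mode d) :
    moveSum P (x, m) (modeLyapunov K ε b) ≤
      moveSum P (x, m) (fun _ => 1) * modeLyapunov K ε b (x, m) +
      ∑ i ∈ jobTypes K, ((min (m.1.count i) (queue K x i) : ℕ) : ℝ) * (1 - 2 * queue K x i) -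
      2 * b * x.1 * ∑ i ∈ jobTypes K, (if m.2.count i < m.1.count i then (m.1.count i : ℝ) else 0) +
      2 * (if m.1 = m.2 then ∑ M ∈ P.working.erase m.1, P.rate m.1 M *
        (queueBonus K ε b (x, settle m.1 M) - queueBonus K ε b (x, m)) else 0) := by
  set L := modeLyapunov K ε b (x, m) with hL
  have h1 : ∑ n ∈ slotServe K m.1 x,
      modeLyapunov K ε b (depart x n, release m (typeOf K (x.2 n))) ≤
      ∑ i ∈ jobTypes K, ((min (m.1.count i) (queue K x i) : ℕ) : ℝ) *
        (L + (1 - 2 * queue K x i) - if m.2.count i < m.1.count i then 2 * b * x.1 else 0) := by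
    have h := sum_jobs_eq hK x (slotServe K m.1 x) fun i =>
      L + (1 - 2 * queue K x i) - if m.2.count i < m.1.count i then 2 * b * x.1 else 0
    simp_rw [card_slotServe_filter] at h
    rw [← h]
    refine Finset.sum_le_sum fun n _ => ?_
    refine (modeLyapunov_depart_le hK hε hb x _ n).trans_eq ?_
    rw [modeLyapunov_release hK]
    ring
  have h2 : (∑ n ∈ slotServe K m.1 x, (1 : ℝ)) =
      ∑ i ∈ jobTypes K, ((min (m.1.count i) (queue K x i) : ℕ) : ℝ) := by
    have h := sum_jobs_eq hK x (slotServe K m.1 x) fun i => (1 : ℝ)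
    simp_rw [card_slotServe_filter] at h
    simpa using h
  have h3 : (if m.1 = m.2 then ∑ M ∈ P.working.erase m.1,
      P.rate m.1 M * modeLyapunov K ε b (x, settle m.1 M) else 0) =
      (if m.1 = m.2 then ∑ M ∈ P.working.erase m.1, P.rate m.1 M * 1 else 0) * L +
      2 * (if m.1 = m.2 then ∑ M ∈ P.working.erase m.1, P.rate m.1 M *
        (queueBonus K ε b (x, settle m.1 M) - queueBonus K ε b (x, m)) else 0) := by
    split_ifs
    · rw [Finset.sum_mul, Finset.mul_sum, ← Finset.sum_add_distrib]
      refine Finset.sum_congr rfl fun M _ => ?_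
      rw [hL]
      simp only [modeLyapunov]
      ring
    · ring
  simp only [moveSum]
  rw [h2, h3, add_mul, add_mul]
  refine le_trans (add_le_add_left (add_le_add_left h1 _) _) (le_of_eq ?_)
  -- Occupied and idle slots are combined: a superfluous type is released at total rate equal to its
  -- number of slots, whatever the queues are.
  have h4 : ∑ i ∈ jobTypes K, ((min (m.1.count i) (queue K x i) : ℕ) : ℝ) *
        (L + (1 - 2 * queue K x i) - if m.2.count i < m.1.count i then 2 * b * x.1 else 0) +
      ∑ i ∈ jobTypes K, (if m.2.count i < m.1.count i then
        ((m.1.count i - min (m.1.count i) (queue K x i) : ℕ) : ℝ) *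
          modeLyapunov K ε b (x, release m i) else 0) =
      (∑ i ∈ jobTypes K, ((min (m.1.count i) (queue K x i) : ℕ) : ℝ)) * L +
      (∑ i ∈ jobTypes K, (if m.2.count i < m.1.count i then
        ((m.1.count i - min (m.1.count i) (queue K x i) : ℕ) : ℝ) * 1 else 0)) * L +
      ∑ i ∈ jobTypes K, ((min (m.1.count i) (queue K x i) : ℕ) : ℝ) * (1 - 2 * queue K x i) -
      2 * b * x.1 *
        ∑ i ∈ jobTypes K, (if m.2.count i < m.1.count i then (m.1.count i : ℝ) else 0) := by
    rw [Finset.sum_mul, Finset.sum_mul, Finset.mul_sum, ← Finset.sum_add_distrib,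
      ← Finset.sum_add_distrib, ← Finset.sum_add_distrib, ← Finset.sum_sub_distrib]
    refine Finset.sum_congr rfl fun i _ => ?_
    rw [modeLyapunov_release hK, ← hL]
    split_ifs
    · rw [Nat.cast_sub (min_le_left _ _)]
      ring
    · ring
  rw [h4]
  ring

theorem sum_min_mul_le (u : ServiceOption d) (hu : ∀ i, u.count i ≤ 2) (q : JobType d → ℕ) :
    ∑ i ∈ jobTypes K, ((min (u.count i) (q i) : ℕ) : ℝ) * (1 - 2 * q i) ≤
      4 * (jobTypes K).card - 2 * ∑ i ∈ jobTypes K, (u.count i : ℝ) * q i := by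
  rw [Finset.mul_sum, mul_comm (4 : ℝ), ← nsmul_eq_mul, ← Finset.sum_const,
    ← Finset.sum_sub_distrib]
  refine Finset.sum_le_sum fun i _ => ?_
  have h3 : ((u.count i * q i : ℕ) : ℝ) ≤ (min (u.count i) (q i) * q i + 1 : ℕ) :=
    Nat.cast_le.2 (mul_le_min_mul_add_one (hu i) (q i))
  have h4 : ((min (u.count i) (q i) : ℕ) : ℝ) ≤ 2 := by
    exact_mod_cast (min_le_left _ _).trans (hu i)
  rw [Nat.cast_mul, Nat.cast_add, Nat.cast_mul, Nat.cast_one] at h3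
  linarith

/-- The drift of the correction in a working mode. -/
theorem sum_switch_le (hK : ∀ l, 1 ≤ K l) (c : Capacity K a) {ε b : ℝ} (hε : 0 < ε)
    (hb : 0 ≤ b) (hεb : 4 * b * ε ≤ c.η) (x : State d) {M : ServiceOption d}
    (hM : M ∈ twoJobSet K) :
    ∑ M' ∈ (c.nmsr hK hε).working.erase M, (c.nmsr hK hε).rate M M' *
        (queueBonus K ε b (x, settle M M') - queueBonus K ε b (x, (M, M))) ≤
      ∑ i ∈ jobTypes K, (queue K x i : ℝ) * (M.count i - a i - c.η / 2) := by
  -- A decision creates an excess of at most 2, hence a bonus of at most 2b per job. At total rate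
  -- at most ε this costs at most 2bε ≤ η/2 per job, half of the slack.
  have hexc : ∀ T, excess (settle M T) ≤ 2 := fun T => by
    rw [excess_settle]
    exact (Multiset.card_le_card tsub_le_self).trans (card_twoJobSet_le hM)
  have hbonus : ∀ M' ∈ twoJobSet K,
      queueBonus K ε b (x, settle M M') - queueBonus K ε b (x, (M, M)) ≤
        ∑ i ∈ jobTypes K, (queue K x i : ℝ) *
          (((M.count i : ℝ) - M'.count i) / ε + 2 * b) := by
    intro M' hM'
    simp only [queueBonus]
    rw [← Finset.sum_sub_distrib]
    refine Finset.sum_le_sum fun i _ => ?_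
    rw [← mul_sub]
    refine mul_le_mul_of_nonneg_left ?_ (Nat.cast_nonneg _)
    have h1 : (excess (settle M M') : ℝ) ≤ 2 := by exact_mod_cast hexc M'
    have h2 := mul_le_mul_of_nonneg_left h1 hb
    have h3 : excess ((M, M) : Mode d) = 0 := by simp [excess]
    simp only [modeBonus, settle_snd, h3]
    rw [Nat.cast_sub (count_le_two hM' i), Nat.cast_sub (count_le_two hM i)]
    have h4 : ((2 : ℕ) - (M'.count i : ℝ)) / ε - ((2 : ℕ) - (M.count i : ℝ)) / ε =
        ((M.count i : ℝ) - M'.count i) / ε := by ring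
    push_cast at h4 ⊢
    linarith
  have hnn : 0 ≤ ∑ i ∈ jobTypes K, (queue K x i : ℝ) *
      (((M.count i : ℝ) - M.count i) / ε + 2 * b) :=
    Finset.sum_nonneg fun i _ => by
      rw [sub_self, zero_div, zero_add]; positivity
  calc _ ≤ ∑ M' ∈ (c.nmsr hK hε).working.erase M, (c.nmsr hK hε).rate M M' *
          ∑ i ∈ jobTypes K, (queue K x i : ℝ) *
            (((M.count i : ℝ) - M'.count i) / ε + 2 * b) := by
        refine Finset.sum_le_sum fun M' hM' => mul_le_mul_of_nonneg_left (hbonus M' ?_)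
          ((c.nmsr hK hε).rate_nonneg _ _)
        exact (c.nmsr hK hε).subset M' (Finset.mem_of_mem_erase hM')
    -- The term of the current option is nonnegative and may be added, which completes the sum to an
    -- average over the whole mixture. The factor ε of the rates then cancels the 1/ε of the bonus.
    _ ≤ ∑ M' ∈ (c.nmsr hK hε).working, (c.nmsr hK hε).rate M M' *
          ∑ i ∈ jobTypes K, (queue K x i : ℝ) *
            (((M.count i : ℝ) - M'.count i) / ε + 2 * b) := by
        rw [← Finset.add_sum_erase (c.nmsr hK hε).working _
          (show M ∈ (c.nmsr hK hε).working from mem_image_twoJobOption.2 hM)]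
        exact le_add_of_nonneg_left (mul_nonneg ((c.nmsr hK hε).rate_nonneg _ _) hnn)
    _ = ε * ∑ j ∈ jobTypes K, c.w j * ∑ i ∈ jobTypes K, (queue K x i : ℝ) *
            (((M.count i : ℝ) - (twoJobOption K j).count i) / ε + 2 * b) := by
        rw [← c.sum_optionWeight fun M' => ∑ i ∈ jobTypes K, (queue K x i : ℝ) *
            (((M.count i : ℝ) - M'.count i) / ε + 2 * b), Finset.mul_sum]
        exact Finset.sum_congr rfl fun M' _ => mul_assoc _ _ _
    _ = ∑ i ∈ jobTypes K, (queue K x i : ℝ) * (M.count i -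
          ∑ j ∈ jobTypes K, c.w j * (twoJobOption K j).count i + 2 * b * ε) := by
        simp_rw [Finset.mul_sum]
        rw [Finset.sum_comm]
        refine Finset.sum_congr rfl fun i _ => ?_
        have h1 : ∀ j, ε * (c.w j * ((queue K x i : ℝ) *
            (((M.count i : ℝ) - (twoJobOption K j).count i) / ε + 2 * b))) =
            c.w j * ((queue K x i : ℝ) * (M.count i + 2 * b * ε)) -
              (queue K x i : ℝ) * (c.w j * (twoJobOption K j).count i) := fun j => by
          field_simp
          ring
        simp_rw [h1]
        rw [Finset.sum_sub_distrib, ← Finset.sum_mul, c.sum_w, ← Finset.mul_sum]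
        ring
    _ ≤ _ := by
        refine Finset.sum_le_sum fun i hi => mul_le_mul_of_nonneg_left ?_ (Nat.cast_nonneg _)
        have := c.le_service i hi
        linarith

/-- The drift of the Lyapunov function in a proper mode. -/
theorem nmsr_drift (hK : ∀ l, 1 ≤ K l) (μ : Measure (Req d)) [IsProbabilityMeasure μ] {lam : ℝ}
    (hlam : 0 < lam) (c : Capacity K fun i => lam * typeProb μ K i) {ε : ℝ} (hε : 0 < ε)
    (hεb : 4 * (lam + c.η) * ε ≤ c.η) (x : State d) {m : Mode d} (hm : IsProperMode K m) :
    lam * ∑ i ∈ jobTypes K, typeProb μ K i * (modeLyapunov K ε (lam + c.η) (x, m) +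
        (2 * queue K x i + 1 + 2 * modeBonus ε (lam + c.η) m i)) +
      moveSum (c.nmsr hK hε) (x, m) (modeLyapunov K ε (lam + c.η)) + c.η * x.1 ≤
      (lam + moveSum (c.nmsr hK hε) (x, m) fun _ => 1) * modeLyapunov K ε (lam + c.η) (x, m) +
        (lam * (1 + 2 * (2 / ε + (lam + c.η) * 2)) + 4 * (jobTypes K).card) := by
  have hη := c.η_pos
  have hb : 0 ≤ lam + c.η := by positivity
  set b := lam + c.η with hbdef
  set L := modeLyapunov K ε b (x, m) with hL
  have hmove := moveSum_modeLyapunov_le hK (c.nmsr hK hε) hε hb x m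
  have hmin := sum_min_mul_le (K := K) m.1 hm.count_le (queue K x)
  have harr : ∑ i ∈ jobTypes K, typeProb μ K i * (L + (2 * queue K x i + 1 +
      2 * modeBonus ε b m i)) ≤ L + (1 + 2 * (2 / ε + b * 2)) +
        2 * ∑ i ∈ jobTypes K, typeProb μ K i * queue K x i := by
    calc _ ≤ ∑ i ∈ jobTypes K, (typeProb μ K i * (L + (1 + 2 * (2 / ε + b * 2))) +
          2 * (typeProb μ K i * queue K x i)) := by
          refine Finset.sum_le_sum fun i _ => ?_
          have h1 := mul_le_mul_of_nonneg_left (modeBonus_le hε hb hm i) (typeProb_nonneg μ K i)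
          linarith
      _ = _ := by
          rw [Finset.sum_add_distrib, ← Finset.sum_mul, sum_typeProb μ hK, ← Finset.mul_sum,
            one_mul]
  have harr' := mul_le_mul_of_nonneg_left harr hlam.le
  have hN := cast_card_eq hK x
  have hN0 : (0 : ℝ) ≤ x.1 := Nat.cast_nonneg _
  have hite : ∀ i, (0 : ℝ) ≤ if m.2.count i < m.1.count i then (m.1.count i : ℝ) else 0 :=
    fun i => by split_ifs <;> positivity
  -- In a working mode the service term -2Σ u_i q_i is cancelled by the correction, which leaves the
  -- averaged service and the slack η. In a switching mode at least one slot is superfluous, so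
  -- releases contribute at most -2(λ + η) times the number of jobs. This outweighs the arrival term
  -- 2λ plus η per job, which is why b = λ + η.
  have hkey : 2 * (lam * ∑ i ∈ jobTypes K, typeProb μ K i * queue K x i) -
      2 * ∑ i ∈ jobTypes K, (m.1.count i : ℝ) * queue K x i -
      2 * b * x.1 *
        ∑ i ∈ jobTypes K, (if m.2.count i < m.1.count i then (m.1.count i : ℝ) else 0) +
      2 * (if m.1 = m.2 then ∑ M ∈ (c.nmsr hK hε).working.erase m.1, (c.nmsr hK hε).rate m.1 M *
        (queueBonus K ε b (x, settle m.1 M) - queueBonus K ε b (x, m)) else 0) +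
      c.η * x.1 ≤ 0 := by
    by_cases h : m.1 = m.2
    · rw [if_pos h]
      obtain ⟨u, T⟩ := m
      obtain rfl : u = T := h
      have h1 := sum_switch_le hK c hε hb hεb x hm.1
      have h2 : 0 ≤ 2 * b * x.1 * ∑ i ∈ jobTypes K,
          (if u.count i < u.count i then (u.count i : ℝ) else 0) :=
        mul_nonneg (by positivity) (Finset.sum_nonneg fun i _ => hite i)
      have h3 : ∑ i ∈ jobTypes K, (queue K x i : ℝ) *
          (u.count i - lam * typeProb μ K i - c.η / 2) =
          ∑ i ∈ jobTypes K, (u.count i : ℝ) * queue K x i -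
            lam * ∑ i ∈ jobTypes K, typeProb μ K i * queue K x i - c.η / 2 * x.1 := by
        rw [hN, Finset.mul_sum, Finset.mul_sum, ← Finset.sum_sub_distrib,
          ← Finset.sum_sub_distrib]
        exact Finset.sum_congr rfl fun i _ => by ring
      rw [h3] at h1
      simp only at h2 ⊢
      linarith
    · rw [if_neg h]
      obtain ⟨i, hi, hex⟩ := hm.exists_excess h
      have h1 : (1 : ℝ) ≤ ∑ i ∈ jobTypes K,
          (if m.2.count i < m.1.count i then (m.1.count i : ℝ) else 0) := by
        refine le_trans ?_ (Finset.single_le_sum (fun i _ => hite i) hi)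
        rw [if_pos hex]
        exact_mod_cast (Nat.zero_le _).trans_lt hex
      have h2 : b * x.1 * 1 ≤ b * x.1 * ∑ i ∈ jobTypes K,
          (if m.2.count i < m.1.count i then (m.1.count i : ℝ) else 0) :=
        mul_le_mul_of_nonneg_left h1 (by positivity)
      have h3 : ∑ i ∈ jobTypes K, typeProb μ K i * queue K x i ≤ x.1 := by
        rw [hN]
        refine Finset.sum_le_sum fun i _ => ?_
        exact mul_le_of_le_one_left (Nat.cast_nonneg _) measureReal_le_one
      have h4 := mul_le_mul_of_nonneg_left h3 hlam.le
      have h5 : 0 ≤ ∑ i ∈ jobTypes K, (m.1.count i : ℝ) * queue K x i :=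
        Finset.sum_nonneg fun i _ => by positivity
      have h6 : b * x.1 = lam * x.1 + c.η * x.1 := by rw [hbdef]; ring
      have h7 : 0 ≤ c.η * x.1 := by positivity
      linarith
  have h8 : (lam + moveSum (c.nmsr hK hε) (x, m) fun _ => 1) * L =
      lam * L + (moveSum (c.nmsr hK hε) (x, m) fun _ => 1) * L := by ring
  rw [h8]
  linarith

theorem moveSum_one_le (hK : ∀ l, 1 ≤ K l) (c : Capacity K a) {ε : ℝ} (hε : 0 < ε) (x : State d)
    {m : Mode d} (hm : IsProperMode K m) :
    (moveSum (c.nmsr hK hε) (x, m) fun _ => 1) ≤ 4 * (jobTypes K).card + ε := by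
  have h1 : (∑ n ∈ slotServe K m.1 x, (1 : ℝ)) ≤ 2 * (jobTypes K).card := by
    have h := sum_jobs_eq hK x (slotServe K m.1 x) fun i => (1 : ℝ)
    rw [h, mul_comm, ← nsmul_eq_mul, ← Finset.sum_const]
    refine Finset.sum_le_sum fun i _ => ?_
    rw [card_slotServe_filter, mul_one]
    exact_mod_cast (min_le_left _ _).trans (hm.count_le i)
  have h2 : ∑ i ∈ jobTypes K, (if m.2.count i < m.1.count i then
      ((m.1.count i - min (m.1.count i) (queue K x i) : ℕ) : ℝ) * 1 else 0) ≤
      2 * (jobTypes K).card := by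
    rw [mul_comm, ← nsmul_eq_mul, ← Finset.sum_const]
    refine Finset.sum_le_sum fun i _ => ?_
    split_ifs
    · rw [mul_one]
      exact_mod_cast (Nat.sub_le _ _).trans (hm.count_le i)
    · exact zero_le_two
  have h3 : (if m.1 = m.2 then ∑ M ∈ (c.nmsr hK hε).working.erase m.1,
      (c.nmsr hK hε).rate m.1 M * 1 else 0) ≤ ε := by
    split_ifs
    · refine (Finset.sum_le_sum_of_subset_of_nonneg (Finset.erase_subset _ _) fun M _ _ =>
        mul_nonneg ((c.nmsr hK hε).rate_nonneg _ _) zero_le_one).trans_eq ?_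
      have h := c.sum_optionWeight fun _ => 1
      simp only [mul_one] at h
      rw [c.sum_w] at h
      calc _ = ε * ∑ M ∈ (jobTypes K).image (twoJobOption K), c.optionWeight M := by
            rw [Finset.mul_sum]
            exact Finset.sum_congr rfl fun M _ => mul_one _
        _ = ε := by rw [h, mul_one]
    · exact hε.le
  simp only [moveSum]
  linarith

end SwitchingDrift

/-! ### Reaching the empty working state, and stability of the policy -/

section SwitchingStability

variable {d : ℕ} {K : Fin d → ℕ} {a : JobType d → ℝ}

/-- The target `T` is useful in the state `x` on the way to the empty state with target `M₀`. -/
def IsUseful (K : Fin d → ℕ) (M₀ : ServiceOption d) (x : State d) (T : ServiceOption d) : Prop :=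
  (x.1 = 0 ∧ T = M₀) ∨ ∃ i ∈ T, 0 < queue K x i

open Classical in
/-- A bound for the number of steps to the empty state with target `M₀`. -/
def modeDistance (K : Fin d → ℕ) (M₀ : ServiceOption d) (z : State d × Mode d) : ℕ :=
  5 * z.1.1 + excess z.2 + if IsUseful K M₀ z.1 z.2.2 then 0 else 4

theorem measurable_modeDistance (K : Fin d → ℕ) (M₀ : ServiceOption d) :
    Measurable (modeDistance K M₀) := by
  classical
  refine measurable_from_prod_countable_left fun m => ?_
  refine Measurable.add (((measurable_card d).const_mul 5).add
    (measurable_const (a := excess m))) (Measurable.ite ?_ measurable_const measurable_const)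
  have : {x : State d | IsUseful K M₀ x m.2} =
      ({x | x.1 = 0} ∩ {_x | m.2 = M₀}) ∪
        ⋃ (i : JobType d) (_ : i ∈ m.2), {x | 0 < queue K x i} := by
    ext x
    simp [IsUseful]
  change MeasurableSet {x : State d | IsUseful K M₀ x m.2}
  rw [this]
  refine MeasurableSet.union (MeasurableSet.inter ?_ (MeasurableSet.const _))
    (MeasurableSet.iUnion fun i => MeasurableSet.iUnion fun _ => ?_)
  · exact measurable_card d (measurableSet_singleton 0)
  · exact measurableSet_lt measurable_const (measurable_queue K i)

/-- A departure may make the target useless, which adds 4, but it removes 5, and the excess does not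
grow. -/
theorem modeDistance_depart_lt (K : Fin d → ℕ) (M₀ : ServiceOption d) (x : State d)
    (n : Fin x.1) (m : Mode d) (i : JobType d) :
    modeDistance K M₀ (depart x n, release m i) < modeDistance K M₀ (x, m) := by
  have h1 := depart_fst x n
  have h2 := excess_release_le m i
  simp only [modeDistance]
  split_ifs <;> omega

theorem exists_mem_slotServe {K : Fin d → ℕ} {u : ServiceOption d} {x : State d} {i : JobType d}
    (hi : i ∈ u) (hq : 0 < queue K x i) : ∃ n ∈ slotServe K u x, typeOf K (x.2 n) = i := by
  have h : 0 < ((slotServe K u x).filter fun n => typeOf K (x.2 n) = i).card := by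
    rw [card_slotServe_filter]
    exact lt_min (Multiset.count_pos.2 hi) hq
  obtain ⟨n, hn⟩ := Finset.card_pos.1 h
  exact ⟨n, (Finset.mem_filter.1 hn).1, (Finset.mem_filter.1 hn).2⟩

theorem exists_isUseful (hK : ∀ l, 1 ≤ K l) {M₀ : ServiceOption d} (hM₀ : M₀ ∈ twoJobSet K)
    (x : State d) : ∃ T ∈ twoJobSet K, IsUseful K M₀ x T := by
  rcases Nat.eq_zero_or_pos x.1 with h | h
  · exact ⟨M₀, hM₀, Or.inl ⟨h, rfl⟩⟩
  · exact ⟨_, twoJobOption_mem (typeOf_mem_jobTypes hK (x.2 ⟨0, h⟩)),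
      Or.inr ⟨_, mem_twoJobOption K _, queue_pos K x ⟨0, h⟩⟩⟩

/-- Outside the empty working state, the distance decreases at a rate bounded from below. -/
theorem le_moveSum_modeDistance (hK : ∀ l, 1 ≤ K l) (c : Capacity K a) {ε : ℝ} (hε : 0 < ε)
    {κ : ℝ} (hκ1 : κ ≤ 1) (hκ : ∀ M ∈ twoJobSet K, κ ≤ ε * c.optionWeight M)
    {M₀ : ServiceOption d} (hM₀ : M₀ ∈ twoJobSet K) (x : State d) {m : Mode d}
    (hm : IsProperMode K m) (hne : (x, m) ≠ (emptyState d, (M₀, M₀))) :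
    κ ≤ moveSum (c.nmsr hK hε) (x, m)
      ({y | modeDistance K M₀ y < modeDistance K M₀ (x, m)}.indicator 1) := by
  classical
  set s := {y | modeDistance K M₀ y < modeDistance K M₀ (x, m)} with hs
  have hs0 : ∀ y, 0 ≤ s.indicator (1 : State d × Mode d → ℝ) y := fun y =>
    Set.indicator_nonneg (fun _ _ => zero_le_one) y
  have hA : ∀ n, 0 ≤ s.indicator (1 : State d × Mode d → ℝ)
      (depart x n, release m (typeOf K (x.2 n))) := fun n => hs0 _
  have hB : ∀ i, 0 ≤ (if m.2.count i < m.1.count i then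
      ((m.1.count i - min (m.1.count i) (queue K x i) : ℕ) : ℝ) *
        s.indicator (1 : State d × Mode d → ℝ) (x, release m i) else 0) := fun i => by
    split_ifs
    · exact mul_nonneg (Nat.cast_nonneg _) (hs0 _)
    · exact le_rfl
  have hC : 0 ≤ (if m.1 = m.2 then ∑ M ∈ (c.nmsr hK hε).working.erase m.1,
      (c.nmsr hK hε).rate m.1 M * s.indicator (1 : State d × Mode d → ℝ)
        (x, settle m.1 M) else 0) := by
    split_ifs
    · exact Finset.sum_nonneg fun M _ => mul_nonneg ((c.nmsr hK hε).rate_nonneg _ _) (hs0 _)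
    · exact le_rfl
  have hA' := Finset.sum_nonneg fun n (_ : n ∈ slotServe K m.1 x) => hA n
  have hB' := Finset.sum_nonneg fun i (_ : i ∈ jobTypes K) => hB i
  have hserve : ∀ i ∈ m.1, 0 < queue K x i → κ ≤ ∑ n ∈ slotServe K m.1 x,
      s.indicator (1 : State d × Mode d → ℝ) (depart x n, release m (typeOf K (x.2 n))) := by
    intro i hi hq
    obtain ⟨n, hn, -⟩ := exists_mem_slotServe hi hq
    refine hκ1.trans (le_trans ?_ (Finset.single_le_sum (fun n _ => hA n) hn))
    rw [Set.indicator_of_mem]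
    · exact le_rfl
    · exact modeDistance_depart_lt K M₀ x n m _
  simp only [moveSum]
  by_cases h : m.1 = m.2
  · by_cases hu : IsUseful K M₀ x m.2
    · rcases hu with ⟨hx, hT⟩ | ⟨i, hi, hq⟩
      · exact absurd (Prod.ext (eq_emptyState hx) (Prod.ext (h.trans hT) hT)) hne
      · have := hserve i (h ▸ hi) hq
        linarith
    -- Switching to a useful target gains 4 and creates an excess of at most 2.
    · obtain ⟨T, hT, hTu⟩ := exists_isUseful hK hM₀ x
      have hTne : T ≠ m.1 := fun hc => hu (h ▸ hc ▸ hTu)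
      have hsw : κ ≤ ∑ M ∈ (c.nmsr hK hε).working.erase m.1,
          (c.nmsr hK hε).rate m.1 M * s.indicator (1 : State d × Mode d → ℝ)
            (x, settle m.1 M) := by
        refine (hκ T hT).trans (le_trans ?_ (Finset.single_le_sum (fun M _ =>
          mul_nonneg ((c.nmsr hK hε).rate_nonneg _ _) (hs0 _))
          (Finset.mem_erase.2 ⟨hTne, mem_image_twoJobOption.2 hT⟩)))
        rw [Set.indicator_of_mem]
        · exact (mul_one _).ge
        · change modeDistance K M₀ _ < modeDistance K M₀ _
          have h2 : (m.1 - T).card ≤ 2 := (Multiset.card_le_card tsub_le_self).trans hm.2.2.1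
          simp only [modeDistance, settle_snd, excess_settle, if_pos hTu, if_neg hu]
          omega
      rw [if_pos h]
      linarith
  -- While switching, some superfluous slot exists. If its type has no jobs, the slot is idle and
  -- its release lowers the excess; otherwise a job of that type is in service and its departure
  -- lowers the distance.
  · obtain ⟨i, hi, hex⟩ := hm.exists_excess h
    rcases Nat.eq_zero_or_pos (queue K x i) with hq | hq
    · have hrel : κ ≤ ∑ i ∈ jobTypes K, (if m.2.count i < m.1.count i then
          ((m.1.count i - min (m.1.count i) (queue K x i) : ℕ) : ℝ) *
            s.indicator (1 : State d × Mode d → ℝ) (x, release m i) else 0) := by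
        refine hκ1.trans (le_trans ?_ (Finset.single_le_sum (fun i _ => hB i) hi))
        rw [if_pos hex, hq, Set.indicator_of_mem, Pi.one_apply, mul_one, Nat.min_zero, Nat.sub_zero]
        · exact_mod_cast (Nat.zero_le _).trans_lt hex
        · change modeDistance K M₀ _ < modeDistance K M₀ _
          have := excess_release hex
          simp only [modeDistance, release_snd]
          omega
      linarith
    · have := hserve i (Multiset.count_pos.1 ((Nat.zero_le _).trans_lt hex)) hq
      linarith

/-- The recurrence criterion is applied on the proper modes only: there at most two slots exist, so
exit rates are bounded. -/
theorem nmsrRates_compl_proper {E : Set (ServiceOption d)} (lam : ℝ) (μ : Measure (Req d))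
    [SFinite μ] (P : NMSR K E) (hP : ∀ M ∈ P.working, M ∈ twoJobSet K)
    {z : State d × Mode d} (hz : IsProperMode K z.2) :
    nmsrRates lam μ P z {y | IsProperMode K y.2}ᶜ = 0 := by
  have hm : MeasurableSet {y : State d × Mode d | IsProperMode K y.2}ᶜ :=
    measurable_snd (Set.to_countable {m : Mode d | IsProperMode K m}ᶜ).measurableSet
  have h0 : ∀ y : State d × Mode d, IsProperMode K y.2 →
      {y : State d × Mode d | IsProperMode K y.2}ᶜ.indicator (1 : State d × Mode d → ℝ≥0∞) y = 0 :=
    fun y hy => Set.indicator_of_notMem (not_not.2 hy) _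
  rw [← lintegral_indicator_one hm, lintegral_nmsrRates _ _ _ _ (measurable_one.indicator hm)]
  have h1 : ∀ v, {y : State d × Mode d | IsProperMode K y.2}ᶜ.indicator
      (1 : State d × Mode d → ℝ≥0∞) (arrive z.1 v, z.2) = 0 := fun v => h0 _ hz
  have h2 : ∀ x i, {y : State d × Mode d | IsProperMode K y.2}ᶜ.indicator
      (1 : State d × Mode d → ℝ≥0∞) (x, release z.2 i) = 0 := fun x i => h0 _ (hz.release i)
  simp only [h1, h2, lintegral_zero, mul_zero, Finset.sum_const_zero, ite_self, zero_add]
  split_ifs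
  · refine Finset.sum_eq_zero fun M hM => ?_
    rw [h0 _ (IsProperMode.settle (hP M (Finset.mem_of_mem_erase hM)) hz.2.1 hz.2.2.1), mul_zero]
  · rfl

theorem stable_nmsr (hK : ∀ l, 1 ≤ K l) (μ : Measure (Req d)) [IsProbabilityMeasure μ] {lam : ℝ}
    (hlam : 0 < lam) (c : Capacity K fun i => lam * typeProb μ K i) {ε : ℝ} (hε : 0 < ε)
    (hεb : 4 * (lam + c.η) * ε ≤ c.η) : (c.nmsr hK hε).Stable lam μ := by
  intro M₀ hM₀
  have hM₀' := (c.nmsr hK hε).subset M₀ hM₀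
  have hη := c.η_pos
  have hb : 0 ≤ lam + c.η := by positivity
  -- The options are finite in number and all have positive weight, so redraws have a positive
  -- minimal rate. The cap 1 is the rate of a slot completion.
  obtain ⟨κ, hκ0, hκ1, hκ⟩ : ∃ κ : ℝ, 0 < κ ∧ κ ≤ 1 ∧
      ∀ M ∈ twoJobSet K, κ ≤ ε * c.optionWeight M := by
    obtain ⟨M, hM, hmin⟩ := Finset.exists_min_image ((jobTypes K).image (twoJobOption K))
      c.optionWeight ⟨M₀, hM₀⟩
    refine ⟨min 1 (ε * c.optionWeight M), lt_min one_pos (mul_pos hε (c.optionWeight_pos hM)),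
      min_le_left _ _, fun M' hM' => (min_le_right _ _).trans ?_⟩
    exact mul_le_mul_of_nonneg_left (hmin M' (mem_image_twoJobOption.2 hM')) hε.le
  have hrate := fun z => exitRate_nmsrRates hlam.le μ (c.nmsr hK hε) z
  have hmove0 := fun z => moveSum_nonneg (c.nmsr hK hε) z (g := fun _ => 1) fun _ => zero_le_one
  have hR : MeasurableSet {y : State d × Mode d | IsProperMode K y.2} :=
    measurable_snd (Set.to_countable {m : Mode d | IsProperMode K m}).measurableSet
  refine positiveRecurrent_of_lyapunov (nmsrRates lam μ (c.nmsr hK hε)) (emptyState d, (M₀, M₀))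
    hR (IsProperMode.self hM₀') (fun z hz => nmsrRates_compl_proper lam μ _
      (fun M hM => (c.nmsr hK hε).subset M hM) hz)
    (r := lam + (4 * (jobTypes K).card + ε)) (by positivity) ?_ ?_
    (measurable_modeLyapunov K ε (lam + c.η)) (fun z => z.1.1) (modeDistance K M₀)
    (measurable_modeDistance K M₀) (δ := c.η)
    (C := lam * (1 + 2 * (2 / ε + (lam + c.η) * 2)) + 4 * (jobTypes K).card) (κ := κ)
    hη (by positivity) hκ0 (a := 5) (b := 6) ?_ ?_ ?_
  · intro z hz
    rw [hrate]
    exact ENNReal.ofReal_le_ofReal (add_le_add_right (moveSum_one_le hK c hε z.1 hz) _)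
  · intro z _
    rw [hrate]
    exact (ENNReal.ofReal_pos.2 (add_pos_of_pos_of_nonneg hlam (hmove0 z))).ne'
  · intro z hz
    have := IsProperMode.excess_le hz
    simp only [modeDistance]
    split_ifs <;> omega
  · rintro ⟨x, m⟩ hz
    have hL0 := modeLyapunov_nonneg (K := K) hε hb
    have hb0 := fun i => modeBonus_nonneg hε hb m i
    rw [lintegral_ofReal_nmsrRates lam μ _ _ (measurable_modeLyapunov K ε _) hL0, hrate]
    simp_rw [modeLyapunov_arrive hK]
    have hG : ∀ i ∈ jobTypes K, 0 ≤ modeLyapunov K ε (lam + c.η) (x, m) +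
        (2 * queue K x i + 1 + 2 * modeBonus ε (lam + c.η) m i) := fun i _ => by
      have := hL0 (x, m)
      have := hb0 i
      positivity
    have hG' : 0 ≤ ∑ i ∈ jobTypes K, typeProb μ K i * (modeLyapunov K ε (lam + c.η) (x, m) +
        (2 * queue K x i + 1 + 2 * modeBonus ε (lam + c.η) m i)) :=
      Finset.sum_nonneg fun i hi => mul_nonneg (typeProb_nonneg μ K i) (hG i hi)
    have hmL := moveSum_nonneg (c.nmsr hK hε) (x, m) hL0
    rw [lintegral_typeOf μ hK (fun i => modeLyapunov K ε (lam + c.η) (x, m) +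
        (2 * queue K x i + 1 + 2 * modeBonus ε (lam + c.η) m i)) hG,
      ← ENNReal.ofReal_mul hlam.le, ← ENNReal.ofReal_add (mul_nonneg hlam.le hG') hmL,
      ← ENNReal.ofReal_add (add_nonneg (mul_nonneg hlam.le hG') hmL) (by positivity),
      ← ENNReal.ofReal_mul (add_nonneg hlam.le (hmove0 _)),
      ← ENNReal.ofReal_add (mul_nonneg (add_nonneg hlam.le (hmove0 _)) (hL0 _)) (by positivity)]
    exact ENNReal.ofReal_le_ofReal (nmsr_drift hK μ hlam c hε hεb x hz)
  · rintro ⟨x, m⟩ hz hne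
    refine le_trans ?_ (moveSum_le_of_measurableSet lam μ (c.nmsr hK hε) (x, m)
      (measurableSet_lt (measurable_modeDistance K M₀) measurable_const))
    exact ENNReal.ofReal_le_ofReal (le_moveSum_modeDistance hK c hε hκ1 hκ hM₀' x hz hne)

theorem twoJobEnMSRStabilizes_of_capacity (hK : ∀ l, 1 ≤ K l) (μ : Measure (Req d))
    [IsProbabilityMeasure μ] {lam : ℝ} (hlam : 0 < lam)
    (c : Capacity K fun i => lam * typeProb μ K i) : TwoJobEnMSRStabilizes lam μ K := by
  have hη := c.η_pos
  have hε : 0 < c.η / (4 * (lam + c.η)) := by positivity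
  refine ⟨c.nmsr hK hε, stable_nmsr hK μ hlam c hε (le_of_eq ?_)⟩
  field_simp

end SwitchingStability

/-! ### No stability at arrival rates of at least 2 -/

section Necessity

variable {d : ℕ}

/-- The total requirement of the resource `l` by the jobs present. -/
def workload (l : Fin d) (x : State d) : ℝ≥0∞ := ∑ n, ENNReal.ofReal ((x.2 n).1 l)

theorem measurable_workload (l : Fin d) : Measurable (workload l) := by
  refine measurable_of_sigma fun N => ?_
  change Measurable fun y : Fin N → Req d => ∑ n, ENNReal.ofReal ((y n).1 l)
  refine Finset.measurable_sum _ fun n _ => ?_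
  exact ((measurable_pi_apply l).comp
    (measurable_subtype_coe.comp (measurable_pi_apply n))).ennreal_ofReal

theorem workload_le (l : Fin d) (x : State d) : workload l x ≤ x.1 := by
  refine (Finset.sum_le_card_nsmul _ _ 1 fun n _ => ?_).trans_eq (by simp)
  rw [← ENNReal.ofReal_one]
  exact ENNReal.ofReal_le_ofReal ((x.2 n).2 l (Set.mem_univ l)).2

theorem workload_arrive (l : Fin d) (x : State d) (v : Req d) :
    workload l (arrive x v) = workload l x + ENNReal.ofReal (v.1 l) := by
  unfold workload
  change ∑ n : Fin (x.1 + 1), ENNReal.ofReal ((Fin.snoc (α := fun _ => Req d) x.2 v n).1 l) = _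
  rw [Fin.sum_univ_castSucc]
  simp

theorem workload_depart (l : Fin d) : ∀ (x : State d) (n : Fin x.1),
    workload l (depart x n) + ENNReal.ofReal ((x.2 n).1 l) = workload l x
  | ⟨0, _⟩, n => n.elim0
  | ⟨N + 1, x⟩, n => by
    unfold workload
    rw [Fin.sum_univ_succAbove _ n, add_comm]
    rfl

/-- No policy stabilizes the system at an arrival rate `lam ≥ 2`. -/
theorem lt_two_of_stable (hd : 1 ≤ d) {f : Req d → ℝ} {μ : Measure (Req d)}
    [IsProbabilityMeasure μ] (hf : IsPDF f μ) (hs : IsCentrallySymmetric f) {lam : ℝ}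
    {π : Policy d} (hπ : Stable lam μ π) : lam < 2 := by
  by_contra! hlam
  set l : Fin d := ⟨0, hd⟩
  have hmean := lintegral_coord hf hs l
  have hW := measurable_workload l
  have hint : ∀ x : State d, ∫⁻ v, workload l (arrive x v) ∂μ =
      workload l x + ENNReal.ofReal (1 / 2) := by
    intro x
    simp_rw [workload_arrive]
    rw [lintegral_add_left measurable_const, hmean, lintegral_const, measure_univ, mul_one]
  -- Work for the resource enters at rate at least 1, as much as feasibility allows to leave.
  have hhalf : 1 ≤ ENNReal.ofReal lam * ENNReal.ofReal (1 / 2) := by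
    rw [← ENNReal.ofReal_mul (by linarith), ← ENNReal.ofReal_one]
    exact ENNReal.ofReal_le_ofReal (by linarith)
  refine not_positiveRecurrent_of_drift (mrjRates lam μ π) (emptyState d) (fun x => ?_)
    (fun x => ?_) hW (measurable_card d) (workload_le l) rfl ?_ (fun x _ => ?_)
    (b := ENNReal.ofReal lam) ENNReal.ofReal_ne_top (fun x => ?_) hπ
  · rw [exitRate_mrjRates]
    exact ENNReal.add_ne_top.2 ⟨ENNReal.ofReal_ne_top, ENNReal.natCast_ne_top _⟩
  · rw [exitRate_mrjRates]
    exact (add_pos_of_pos_of_nonneg (ENNReal.ofReal_pos.2 (by linarith)) zero_le).ne'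
  · rw [lintegral_mrjRates _ _ _ _ hW, hint, mul_add]
    refine ne_of_gt (lt_of_lt_of_le one_pos ?_)
    exact hhalf.trans (le_add_self.trans le_self_add)
  · rw [lintegral_mrjRates _ _ _ _ hW, hint, exitRate_mrjRates, add_mul, mul_add, add_assoc]
    refine add_le_add le_rfl ?_
    have h1 : ((π.serve x).card : ℝ≥0∞) * workload l x =
        ∑ n ∈ π.serve x, workload l (depart x n) +
          ∑ n ∈ π.serve x, ENNReal.ofReal ((x.2 n).1 l) := by
      rw [← Finset.sum_add_distrib, Finset.sum_congr rfl fun n _ => workload_depart l x n,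
        Finset.sum_const, nsmul_eq_mul]
    have h2 : ∑ n ∈ π.serve x, ENNReal.ofReal ((x.2 n).1 l) ≤ 1 := by
      rw [← ENNReal.ofReal_sum_of_nonneg fun n _ => ((x.2 n).2 l (Set.mem_univ l)).1.le,
        ← ENNReal.ofReal_one]
      exact ENNReal.ofReal_le_ofReal (π.feasible x l)
    rw [h1, add_comm]
    exact add_le_add (h2.trans hhalf) le_rfl
  · have hm : Measurable fun y : State d => ((y.1 - x.1 : ℕ) : ℝ≥0∞) :=
      (measurable_of_countable fun k : ℕ => ((k - x.1 : ℕ) : ℝ≥0∞)).comp (measurable_card d)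
    rw [lintegral_mrjRates _ _ _ _ hm]
    have h0 : ∑ n ∈ π.serve x, (((depart x n).1 - x.1 : ℕ) : ℝ≥0∞) = 0 := by
      refine Finset.sum_eq_zero fun n _ => ?_
      have := depart_fst x n
      rw [Nat.sub_eq_zero_of_le (by omega), Nat.cast_zero]
    rw [h0, add_zero]
    simp [arrive_fst]

end Necessity

/-! ### Choice of the discretization -/

section Main

variable {d : ℕ}

theorem stabilizes_of_capacity {K : Fin d → ℕ} (hK : ∀ l, 1 ≤ K l) (μ : Measure (Req d))
    [IsProbabilityMeasure μ] {lam : ℝ} (hlam : 0 < lam)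
    (h : Nonempty (Capacity K fun i => lam * typeProb μ K i)) :
    TwoJobEMWStabilizes lam μ K ∧ TwoJobEnMSRStabilizes lam μ K := by
  obtain ⟨c⟩ := h
  exact ⟨⟨exists_isEMW hK, fun π hπ => stable_of_isEMW hK μ hlam c hπ⟩,
    twoJobEnMSRStabilizes_of_capacity hK μ hlam c⟩

theorem exists_stabilizes {f : Req d → ℝ} {μ : Measure (Req d)} [IsProbabilityMeasure μ]
    (hf : IsPDF f μ) (hL : ∃ C, LipschitzWith C f) (hs : IsCentrallySymmetric f) {lam : ℝ}
    (hlam : 0 < lam) (hlam2 : lam < 2) : ∃ K : Fin d → ℕ, (∀ l, 1 ≤ K l) ∧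
      TwoJobEMWStabilizes lam μ K ∧ TwoJobEnMSRStabilizes lam μ K := by
  obtain ⟨C, hC⟩ := hL
  -- The cube has sup-norm diameter at most 1, so the Lipschitz condition bounds the density by its
  -- value at one corner plus C.
  set e : Req d := ⟨1, fun _ _ => ⟨one_pos, le_rfl⟩⟩ with he
  have hF : ∀ v, f v ≤ f e + C := by
    intro v
    have h1 := (le_abs_self _).trans (hC.dist_le_mul v e)
    have h2 : dist v e ≤ 1 := by
      change dist v.1 1 ≤ 1
      refine (dist_pi_le_iff zero_le_one).2 fun l => ?_
      have := v.2 l (Set.mem_univ l)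
      rw [Real.dist_eq, abs_le]
      simp only [Pi.one_apply]
      constructor <;> linarith [this.1, this.2]
    have h3 := mul_le_mul_of_nonneg_left h2 C.coe_nonneg
    linarith
  have hF0 : 0 ≤ f e + C := add_nonneg (hf.2.1 e) C.coe_nonneg
  obtain ⟨k, hk⟩ := exists_nat_gt (lam * ((f e + C) * d + C) / (2 - lam))
  have h2 : 0 < 2 - lam := by linarith
  have hk0 : 0 < k := by
    have : (0 : ℝ) < k := lt_of_le_of_lt (by positivity) hk
    exact_mod_cast this
  refine ⟨fun _ => k, fun _ => hk0, stabilizes_of_capacity (fun _ => hk0) μ hlam ?_⟩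
  refine capacity_of_lipschitz hf hs hC hF hF0 hk0 (fun _ => le_rfl) hlam ?_
  rwa [div_lt_iff₀' h2] at hk

/-- A constant density has Lipschitz constant 0 and bound 1, so only the boundary term λd remains in
the capacity condition. -/
theorem stabilizes_uniform {μ : Measure (Req d)} [IsProbabilityMeasure μ]
    (hμ : μ = cubeVolume d) {lam : ℝ} (hlam : 0 < lam) {k : ℕ} (hk : 0 < k)
    (hlk : lam * d < (2 - lam) * k) {K : Fin d → ℕ} (hK : ∀ l, k ≤ K l) :
    TwoJobEMWStabilizes lam μ K ∧ TwoJobEnMSRStabilizes lam μ K := by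
  have hf : IsPDF (fun _ : Req d => (1 : ℝ)) μ := by
    refine ⟨measurable_const, fun _ => zero_le_one, ?_⟩
    rw [hμ]
    simp only [ENNReal.ofReal_one]
    exact withDensity_one.symm
  refine stabilizes_of_capacity (fun l => le_trans hk (hK l)) μ hlam ?_
  refine capacity_of_lipschitz hf (fun _ _ _ => rfl) (C := 0) (LipschitzWith.const _) (F := 1)
    (fun _ => le_rfl) zero_le_one hk hK hlam ?_
  simpa using hlk

theorem lt_mul_of_floor_add_one_le {a b : ℝ} (hb : 0 < b) {k : ℕ} (h : ⌊a / b⌋ + 1 ≤ (k : ℤ)) :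
    a < b * k := by
  have h1 : (⌊a / b⌋ : ℝ) + 1 ≤ k := by exact_mod_cast h
  have h2 := Int.lt_floor_add_one (a / b)
  rw [← div_lt_iff₀' hb]
  linarith

end Main

end

end MRJ

theorem mainTheorem5 :
    -- Lipschitz continuous, centrally symmetric densities
    (∀ (d : ℕ), 1 ≤ d → ∀ (μ : MeasureTheory.Measure (MRJ.Req d))
        [MeasureTheory.IsProbabilityMeasure μ] (f : MRJ.Req d → ℝ),
        MRJ.IsPDF f μ → (∃ C, LipschitzWith C f) → MRJ.IsCentrallySymmetric f →
      MRJ.ThroughputOptimal μ (fun lam K => MRJ.TwoJobEMWStabilizes lam μ K) ∧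
      MRJ.ThroughputOptimal μ (fun lam K => MRJ.TwoJobEnMSRStabilizes lam μ K) ∧
      ∀ lam : ℝ, 0 < lam → lam < 2 →
        ∃ K : Fin d → ℕ, (∀ l, 1 ≤ K l) ∧
          MRJ.TwoJobEMWStabilizes lam μ K ∧ MRJ.TwoJobEnMSRStabilizes lam μ K) ∧
    -- the uniform distribution on `(0,1]^d`
    (∀ (d : ℕ), 1 ≤ d → ∀ (μ : MeasureTheory.Measure (MRJ.Req d))
        [MeasureTheory.IsProbabilityMeasure μ], μ = MRJ.cubeVolume d →
      ∀ lam : ℝ, 0 < lam → lam < 2 →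
        ∀ K₀ : ℕ, IsLeast {k : ℕ | Odd k ∧ ⌊2 * lam * d / (2 - lam)⌋ + 1 ≤ (k : ℤ)} K₀ →
          ∀ K : Fin d → ℕ, (∀ l, K₀ ≤ K l) →
            MRJ.TwoJobEMWStabilizes lam μ K ∧ MRJ.TwoJobEnMSRStabilizes lam μ K) ∧
    -- the uniform distribution on `(0,1]`
    (∀ (μ : MeasureTheory.Measure (MRJ.Req 1)) [MeasureTheory.IsProbabilityMeasure μ],
        μ = MRJ.cubeVolume 1 →
      ∀ lam : ℝ, 0 < lam → lam < 2 →
        ∀ k : ℕ, Odd k → ⌊lam / (2 - lam)⌋ + 1 ≤ (k : ℤ) →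
          MRJ.TwoJobEMWStabilizes lam μ (fun _ => k) ∧
          MRJ.TwoJobEnMSRStabilizes lam μ (fun _ => k)) := by
  refine ⟨fun d hd μ _ f hf hL hs => ?_, fun d hd μ _ hμ lam h0 h2 K₀ hK₀ K hK => ?_,
    fun μ _ hμ lam h0 h2 k hk hlk => ?_⟩
  · have hmain := fun (lam : ℝ) (h0 : 0 < lam) (h2 : lam < 2) =>
      MRJ.exists_stabilizes hf hL hs h0 h2
    refine ⟨fun lam h0 hstab => ?_, fun lam h0 hstab => ?_, hmain⟩
    · obtain ⟨π, hπ⟩ := hstab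
      obtain ⟨K, hK, h, -⟩ := hmain lam h0 (MRJ.lt_two_of_stable hd hf hs hπ)
      exact ⟨K, hK, h⟩
    · obtain ⟨π, hπ⟩ := hstab
      obtain ⟨K, hK, -, h⟩ := hmain lam h0 (MRJ.lt_two_of_stable hd hf hs hπ)
      exact ⟨K, hK, h⟩
  -- The floor condition gives 2λd < (2 - λ)K₀, from which λd < (2 - λ)K₀ follows since λd ≥ 0.
  -- Oddness gives K₀ > 0.
  · have h1 := MRJ.lt_mul_of_floor_add_one_le (sub_pos.2 h2) hK₀.1.2
    have h3 : 0 ≤ lam * d := by positivity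
    exact MRJ.stabilizes_uniform hμ h0 hK₀.1.1.pos (by linarith) hK
  · have h1 := MRJ.lt_mul_of_floor_add_one_le (sub_pos.2 h2) hlk
    exact MRJ.stabilizes_uniform hμ h0 hk.pos (by simpa using h1) fun _ => le_rfl
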